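/- Let $p\ge 1$, let $\lambda_1\ge\cdots\ge\lambda_p\ge 0$ with $\lambda\neq 0$, let $\delta>0$, and let $x\in\mathbb{R}^p$ have exactly $k\ge 1$ nonzero entries, whose absolute values are pairwise distinct (no tied nonzero entries). For a nonincreasing nonnegative weight vector $\mu\in\mathbb{R}^m$ and $\gamma>0$ let $$\eta(u;\gamma,\mu)=\operatorname*{argmin}_{z\in\mathbb{R}^m}\ \tfrac12\|u-z\|_2^2+\gamma\sum_{i=1}^m\mu_i|z|_{(i)},$$ where $|z|_{(i)}$ is the $i$-th largest of $|z_1|,\dots,|z_m|$, and write $\eta(u;\gamma)=\eta(u;\gamma,\lambda)$ for $u\in\mathbb{R}^p$. Let $h\sim\mathcal N(0,I_p)$. (Well-posedness.) For all $\gamma,\sigma_z>0$ there is exactly one pair $(\sigma^*,\chi^*)\in(0,\infty)^2$ that solves the state evolution equations $$(\sigma^*)^2=\sigma_z^2+\frac1{\delta p}\,\mathbb{E}\|\eta(x+\sigma^*h;\sigma^*\chi^*)-x\|_2^2,\qquad \gamma=\sigma^*\chi^*\Big(1-\frac1{\delta\sigma^*p}\,\mathbb{E}\langle\eta(x+\sigma^*h;\sigma^*\chi^*),h\rangle\Big).$$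 Let $e_\lambda(\gamma,\sigma_z)=\frac1p\mathbb{E}\|\eta(x+\sigma^*h;\sigma^*\chi^*)-x\|_2^2$ for this pair. For every $\sigma_z>0$ the function $\gamma\mapsto e_\lambda(\gamma,\sigma_z)$ attains its minimum over $\gamma>0$; let $\gamma^*_\lambda=\gamma^*_\lambda(\sigma_z)$ be any minimizer. Let $$M_\lambda=\frac1p\inf_{\alpha>0}\Big\{k+\alpha^2\sum_{i=1}^k\lambda_i^2+\mathbb{E}\|\eta(\tilde h;\alpha,\lambda_{[k+1:p]})\|_2^2\Big\},\qquad \tilde h\sim\mathcal N(0,I_{p-k}),\quad \lambda_{[k+1:p]}=(\lambda_{k+1},\dots,\lambda_p).$$ Then, as $\sigma_z\downarrow 0$ with $x,\lambda,\delta$ fixed: (a) $e_\lambda(\gamma^*_\lambda,\sigma_z)$ converges to a positive limit if $\delta<M_\lambda$, and to $0$ if $\delta>M_\lambda$; (b) $e_\lambda(\gamma^*_\lambda,\sigma_z)/\sigma_z^2\to\infty$ if $\delta<M_\lambda$, and $e_\lambda(\gamma^*_\lambda,\sigma_z)/\sigma_z^2\to\dfrac{\delta M_\lambda}{\delta-M_\lambda}$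 if $\delta>M_\lambda$. -/

import Mathlib

open MeasureTheory ProbabilityTheory Filter Topology

noncomputable section

namespace Slope

/-- `absSorted v i` is the `i`-th largest (counting from `i = 0`) of the numbers `|v j|`. -/
def absSorted {m : ℕ} (v : Fin m → ℝ) (i : Fin m) : ℝ :=
  |v (Tuple.sort (fun j => -|v j|) i)|

/-- The sorted `ℓ₁` norm of `v` with weights `lam`. -/
def sortedL1 {m : ℕ} (lam v : Fin m → ℝ) : ℝ :=
  ∑ i, lam i * absSorted v i

/-- The squared Euclidean norm. -/
def sqNorm {m : ℕ} (v : Fin m → ℝ) : ℝ := ∑ i, v i ^ 2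

/-- The objective function of the proximal problem of `γ * sortedL1 lam` at `u`. -/
def proxObj {m : ℕ} (lam : Fin m → ℝ) (γ : ℝ) (u z : Fin m → ℝ) : ℝ :=
  1 / 2 * sqNorm (u - z) + γ * sortedL1 lam z

/-- The proximal operator `η(u; γ, lam)`: the minimizer of the (strongly convex) function
`proxObj lam γ u`. -/
def prox {m : ℕ} (u : Fin m → ℝ) (γ : ℝ) (lam : Fin m → ℝ) : Fin m → ℝ :=
  Classical.epsilon fun z => ∀ w, proxObj lam γ u z ≤ proxObj lam γ u w

/-- The law `N(0, I_m)` of a standard Gaussian vector. -/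
def stdGauss (m : ℕ) : Measure (Fin m → ℝ) :=
  Measure.pi fun _ => gaussianReal 0 1

variable {p : ℕ}

/-- `(1/p) E ‖η(x + σ h; σ χ) - x‖²` with `h ∼ N(0, I_p)`. -/
def risk (lam x : Fin p → ℝ) (σ χ : ℝ) : ℝ :=
  1 / (p : ℝ) * ∫ h, sqNorm (prox (x + σ • h) (σ * χ) lam - x) ∂stdGauss p

/-- `(1/p) E ⟨η(x + σ h; σ χ), h⟩` with `h ∼ N(0, I_p)`. -/
def corr (lam x : Fin p → ℝ) (σ χ : ℝ) : ℝ :=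
  1 / (p : ℝ) * ∫ h, ∑ i, prox (x + σ • h) (σ * χ) lam i * h i ∂stdGauss p

/-- `(σ, χ)` is a solution of the two state evolution equations with tuning parameter `γ` and
noise level `σz`. -/
def IsStateEvolution (δ : ℝ) (lam x : Fin p → ℝ) (γ σz : ℝ) (s : ℝ × ℝ) : Prop :=
  0 < s.1 ∧ 0 < s.2 ∧
    s.1 ^ 2 = σz ^ 2 + 1 / δ * risk lam x s.1 s.2 ∧
    γ = s.1 * s.2 * (1 - 1 / (δ * s.1) * corr lam x s.1 s.2)

/-- The solution `(σ*, χ*)` of the state evolution equations. -/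
def seSolution (δ : ℝ) (lam x : Fin p → ℝ) (γ σz : ℝ) : ℝ × ℝ :=
  Classical.epsilon (IsStateEvolution δ lam x γ σz)

/-- The state evolution mean square error `e_lam(γ, σz)`. -/
def seMSE (δ : ℝ) (lam x : Fin p → ℝ) (γ σz : ℝ) : ℝ :=
  risk lam x (seSolution δ lam x γ σz).1 (seSolution δ lam x γ σz).2

/-- `γ` is an optimal tuning: it minimizes `e_lam(·, σz)` over the positive reals. -/
def IsOptimalTuning (δ : ℝ) (lam x : Fin p → ℝ) (σz γ : ℝ) : Prop :=
  0 < γ ∧ ∀ γ' : ℝ, 0 < γ' → seMSE δ lam x γ σz ≤ seMSE δ lam x γ' σz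

/-- `‖x‖₀`, the number of nonzero entries of `x`. -/
def sparsity (x : Fin p → ℝ) : ℕ := (Finset.univ.filter fun i => x i ≠ 0).card

/-- `x` has no tied nonzero entries: the nonzero `|x i|` are distinct. -/
def NoTies (x : Fin p → ℝ) : Prop :=
  ∀ i j, i ≠ j → x i ≠ 0 → x j ≠ 0 → |x i| ≠ |x j|

/-- The subvector of `lam` that remains after the first `k` entries are removed. -/
def tailWeights (lam : Fin p → ℝ) (k : ℕ) : Fin (p - k) → ℝ :=
  fun j => lam ⟨k + j, by omega⟩

/-- The threshold `M_lam` at sparsity `k`. -/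
def threshold (lam : Fin p → ℝ) (k : ℕ) : ℝ :=
  1 / (p : ℝ) * ⨅ α : Set.Ioi (0 : ℝ),
    ((k : ℝ) + (α : ℝ) ^ 2 * ∑ i ∈ Finset.univ.filter (fun i : Fin p => (i : ℕ) < k), lam i ^ 2
      + ∫ h, sqNorm (prox h (α : ℝ) (tailWeights lam k)) ∂stdGauss (p - k))

end Slope

end

/-!
In the variables `t = 1 / σ` and `d = δ p`, and with `ρ(t, χ) = E ‖η(t x + h; χ) - t x‖²`
(`scaledRisk`) and `c(t, χ) = E ⟨η(t x + h; χ) - t x, h⟩` (`scaledCorr`), positive homogeneity of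
the proximal operator turns the state evolution equations into

  `ρ(t, χ) = d (1 - σz² t²)`  and  `γ t d = χ (d - c(t, χ))`   (`isStateEvolution_iff`),

and the mean square error at a solution is `δ (1 / t² - σz²)`.

*Uniqueness* is monotonicity of the subdifferential of the sorted norm, integrated over the noise
(`scaled_monotonicity`): for two solutions it becomes a sum of two squares that is at most zero.

*Existence.* For fixed noise the error `‖η(t x + h; χ) - t x‖` is nondecreasing in `t`
(`sqNorm_err_mono`), so the first equation has at most one root `t = T(χ)` (`strength`, with the
value `0` if there is no root), and `T` is continuous. The second equation is then solved by the
intermediate value theorem. The delicate point is the sign of its defect near `χ = 0` when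
`d = p`, where `T(χ)` is at least of order `√χ` because smoothing strictly increases the mean of the
sorted norm.

*Optimal tuning* amounts to maximizing `T`. The maximum is attained at some `0 < χ < ∞`: small `χ`
improves on the observation itself (`exists_scaledRisk_lt_card`), and some finite `χ` improves on
the zero estimator (`exists_scaledRisk_lt_sqNorm`), since by the Cameron–Martin formula the energy
of the estimator for large `χ` is exponentially larger with a signal than without. The maximizer
belongs to a positive `γ` only if `c < d` there. This follows from `c ≤ ρ`, a first order
condition for minimizing `ρ(t, ·)` (`scaledCorr_le_scaledRisk`). It rests on the fact that scaling
up the observation increases the mean correlation of the residual with the signal. Averaging over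
signed permutations replaces the signal by its posterior mean given its orbit; this is a monotone
equivariant function of the observation, so that it preserves the chamber of sorted nonnegative
vectors (`Chamber.map_of_equivariant`), where the claim is that the partial sums of the residual
increase (`psum_residual_mono`).

*Limits.* At the optimum, `d (1 - σz² t²)` is the minimum of `ρ(t, ·)`. As `t → ∞` the nonzero
entries separate from each other and from the noise, so that `ρ(t, χ)` increases to the function
whose infimum is `p M` (`tendsto_scaledRisk_atTop`). By compactness the minima converge to `p M`
as well (`exists_lt_scaledRisk`). If `d < p M`, then `t` stays bounded, and it converges by
monotonicity in `σz`. If `d > p M`, then `t → ∞` and `σz² t² → 1 - M / δ`.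
-/

noncomputable section

namespace Slope

variable {m : ℕ} {lam : Fin m → ℝ}

/-! ### Signed permutations and the chamber of sorted nonnegative vectors -/

/-- The closed Weyl chamber of the group of signed permutations: nonincreasing vectors with
nonnegative entries. Weight vectors are exactly the elements of the chamber. -/
def Chamber (v : Fin m → ℝ) : Prop := Antitone v ∧ ∀ i, 0 ≤ v i

/-- The action of the signed permutation with permutation `e` and signs `s`. -/
def sperm (e : Equiv.Perm (Fin m)) (s : Fin m → ℤˣ) (v : Fin m → ℝ) : Fin m → ℝ :=
  fun i => ((s i : ℤ) : ℝ) * v (e i)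

lemma sign_mul_self (a : ℤˣ) : ((a : ℤ) : ℝ) * ((a : ℤ) : ℝ) = 1 := by
  rcases Int.units_eq_one_or a with h | h <;> simp [h]

lemma abs_sign (a : ℤˣ) : |((a : ℤ) : ℝ)| = 1 := by
  rcases Int.units_eq_one_or a with h | h <;> simp [h]

lemma sperm_sub (e : Equiv.Perm (Fin m)) (s : Fin m → ℤˣ) (u v : Fin m → ℝ) :
    sperm e s (u - v) = sperm e s u - sperm e s v := by
  ext i; simp [sperm, mul_sub]

lemma sperm_add (e : Equiv.Perm (Fin m)) (s : Fin m → ℤˣ) (u v : Fin m → ℝ) :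
    sperm e s (u + v) = sperm e s u + sperm e s v := by
  ext i; simp [sperm, mul_add]

lemma sperm_smul (e : Equiv.Perm (Fin m)) (s : Fin m → ℤˣ) (c : ℝ) (v : Fin m → ℝ) :
    sperm e s (c • v) = c • sperm e s v := by
  ext i; simp [sperm]; ring

lemma sperm_dotProduct (e : Equiv.Perm (Fin m)) (s : Fin m → ℤˣ) (u v : Fin m → ℝ) :
    sperm e s u ⬝ᵥ sperm e s v = u ⬝ᵥ v := by
  simp only [dotProduct, sperm]
  rw [← Equiv.sum_comp e (fun i => u i * v i)]
  refine Finset.sum_congr rfl fun i _ => ?_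
  rw [mul_mul_mul_comm, sign_mul_self, one_mul]

lemma sperm_comp (e e' : Equiv.Perm (Fin m)) (s s' : Fin m → ℤˣ) (v : Fin m → ℝ) :
    sperm e s (sperm e' s' v) = sperm (e' * e) (fun i => s i * s' (e i)) v := by
  ext i; simp [sperm, mul_assoc]

lemma sperm_inv_sperm (e : Equiv.Perm (Fin m)) (s : Fin m → ℤˣ) (v : Fin m → ℝ) :
    sperm e⁻¹ (fun i => s (e⁻¹ i)) (sperm e s v) = v := by
  ext i; simp [sperm, ← mul_assoc, sign_mul_self]

lemma sperm_sperm_inv (e : Equiv.Perm (Fin m)) (s : Fin m → ℤˣ) (v : Fin m → ℝ) :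
    sperm e s (sperm e⁻¹ (fun i => s (e⁻¹ i)) v) = v := by
  ext i; simp [sperm, ← mul_assoc, sign_mul_self]

lemma exists_sign (a : ℝ) : ∃ s : ℤˣ, ((s : ℤ) : ℝ) * a = |a| := by
  rcases le_total 0 a with h | h
  · exact ⟨1, by simp [abs_of_nonneg h]⟩
  · exact ⟨-1, by simp [abs_of_nonpos h]⟩

/-- Every vector can be brought into the chamber by a signed permutation. -/
lemma exists_sperm_chamber (v : Fin m → ℝ) : ∃ e s, Chamber (sperm e s v) := by
  choose s hs using fun a : ℝ => exists_sign a
  refine ⟨Tuple.sort (fun j => -|v j|), fun i => s (v (Tuple.sort (fun j => -|v j|) i)), ?_, ?_⟩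
  · intro i j hij
    have := Tuple.monotone_sort (fun j => -|v j|) hij
    simp only [sperm, hs]
    simpa using this
  · intro i; simp only [sperm, hs]; exact abs_nonneg _

/-! ### The sorted norm -/

lemma sum_le_sortedL1 (hl : Chamber lam) (v : Fin m → ℝ) (e : Equiv.Perm (Fin m)) :
    ∑ i, lam i * |v (e i)| ≤ sortedL1 lam v := by
  set τ := Tuple.sort (fun j => -|v j|) with hτ
  have hanti : Antitone (fun i => |v (τ i)|) := by
    intro i j hij
    have := Tuple.monotone_sort (fun j => -|v j|) hij
    simpa using this
  have := (hl.1.monovary hanti).sum_mul_comp_perm_le_sum_mul (σ := τ⁻¹ * e)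
  simpa [sortedL1, absSorted] using this

lemma sortedL1_eq_sup' (hl : Chamber lam) (v : Fin m → ℝ) :
    sortedL1 lam v = Finset.univ.sup' Finset.univ_nonempty
      (fun e : Equiv.Perm (Fin m) => ∑ i, lam i * |v (e i)|) := by
  refine le_antisymm ?_ (Finset.sup'_le _ _ fun e _ => sum_le_sortedL1 hl v e)
  exact Finset.le_sup' (fun e : Equiv.Perm (Fin m) => ∑ i, lam i * |v (e i)|)
    (Finset.mem_univ (Tuple.sort (fun j => -|v j|)))

lemma exists_sortedL1_eq (lam v : Fin m → ℝ) :
    ∃ e : Equiv.Perm (Fin m), sortedL1 lam v = ∑ i, lam i * |v (e i)| :=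
  ⟨Tuple.sort (fun j => -|v j|), rfl⟩

lemma sortedL1_nonneg (hl : Chamber lam) (v : Fin m → ℝ) : 0 ≤ sortedL1 lam v :=
  Finset.sum_nonneg fun i _ => mul_nonneg (hl.2 i) (abs_nonneg _)

lemma sortedL1_add_le (hl : Chamber lam) (u v : Fin m → ℝ) :
    sortedL1 lam (u + v) ≤ sortedL1 lam u + sortedL1 lam v := by
  obtain ⟨e, he⟩ := exists_sortedL1_eq lam (u + v)
  rw [he]
  refine le_trans ?_ (add_le_add (sum_le_sortedL1 hl u e) (sum_le_sortedL1 hl v e))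
  rw [← Finset.sum_add_distrib]
  refine Finset.sum_le_sum fun i _ => ?_
  rw [← mul_add]
  exact mul_le_mul_of_nonneg_left (abs_add_le _ _) (hl.2 i)

lemma sortedL1_smul (hl : Chamber lam) (c : ℝ) (v : Fin m → ℝ) :
    sortedL1 lam (c • v) = |c| * sortedL1 lam v := by
  apply le_antisymm
  · obtain ⟨e, he⟩ := exists_sortedL1_eq lam (c • v)
    refine he.trans_le (le_trans (le_of_eq ?_)
      (mul_le_mul_of_nonneg_left (sum_le_sortedL1 hl v e) (abs_nonneg c)))
    rw [Finset.mul_sum]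
    exact Finset.sum_congr rfl fun i _ => by simp [abs_mul]; ring
  · obtain ⟨e, he⟩ := exists_sortedL1_eq lam v
    refine le_trans (le_of_eq ?_) (sum_le_sortedL1 hl (c • v) e)
    rw [he, Finset.mul_sum]
    exact Finset.sum_congr rfl fun i _ => by simp [abs_mul]; ring

lemma sortedL1_zero (hl : Chamber lam) : sortedL1 lam 0 = 0 := by
  simpa using sortedL1_smul hl 0 0

lemma sortedL1_neg (hl : Chamber lam) (v : Fin m → ℝ) :
    sortedL1 lam (-v) = sortedL1 lam v := by
  simpa using sortedL1_smul hl (-1) v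

lemma continuous_sortedL1 (hl : Chamber lam) : Continuous (sortedL1 lam) := by
  have : sortedL1 lam = fun v => Finset.univ.sup' Finset.univ_nonempty
      (fun e : Equiv.Perm (Fin m) => ∑ i, lam i * |v (e i)|) :=
    funext (sortedL1_eq_sup' hl)
  rw [this]
  exact Continuous.finset_sup'_apply _ fun e _ => by fun_prop

lemma sortedL1_sperm (hl : Chamber lam) (e : Equiv.Perm (Fin m)) (s : Fin m → ℤˣ)
    (v : Fin m → ℝ) : sortedL1 lam (sperm e s v) = sortedL1 lam v := by
  have key : ∀ (e : Equiv.Perm (Fin m)) (s : Fin m → ℤˣ) (v : Fin m → ℝ),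
      sortedL1 lam (sperm e s v) ≤ sortedL1 lam v := by
    intro e s v
    obtain ⟨e', he'⟩ := exists_sortedL1_eq lam (sperm e s v)
    rw [he']
    refine le_trans (le_of_eq ?_) (sum_le_sortedL1 hl v (e * e'))
    exact Finset.sum_congr rfl fun i _ => by simp [sperm, abs_mul, abs_sign]
  refine le_antisymm (key e s v) ?_
  conv_lhs => rw [← sperm_inv_sperm e s v]
  exact key _ _ _

lemma sum_mul_le_sortedL1 (hl : Chamber lam) (v : Fin m → ℝ) :
    ∑ i, lam i * v i ≤ sortedL1 lam v :=
  le_trans (Finset.sum_le_sum fun i _ => mul_le_mul_of_nonneg_left (le_abs_self _) (hl.2 i))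
    (sum_le_sortedL1 hl v 1)

lemma sortedL1_of_chamber (hl : Chamber lam) {v : Fin m → ℝ} (hv : Chamber v) :
    sortedL1 lam v = ∑ i, lam i * v i := by
  refine le_antisymm ?_ (sum_mul_le_sortedL1 hl v)
  obtain ⟨e, he⟩ := exists_sortedL1_eq lam v
  rw [he]
  simp only [abs_of_nonneg (hv.2 _)]
  exact (hl.1.monovary hv.1).sum_mul_comp_perm_le_sum_mul

lemma mul_abs_le_sortedL1 (hl : Chamber lam) (v : Fin m → ℝ) (i j : Fin m) :
    lam i * |v j| ≤ sortedL1 lam v := by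
  refine le_trans ?_ (sum_le_sortedL1 hl v (Equiv.swap i j))
  have := Finset.single_le_sum (f := fun l => lam l * |v (Equiv.swap i j l)|)
    (fun l _ => mul_nonneg (hl.2 l) (abs_nonneg _)) (Finset.mem_univ i)
  simpa using this

lemma sortedL1_le_sum_abs (hl : Chamber lam) (v : Fin m → ℝ) :
    sortedL1 lam v ≤ (∑ i, lam i) * ∑ i, |v i| := by
  obtain ⟨e, he⟩ := exists_sortedL1_eq lam v
  rw [he, Finset.sum_mul]
  refine Finset.sum_le_sum fun i _ => mul_le_mul_of_nonneg_left ?_ (hl.2 i)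
  exact Finset.single_le_sum (f := fun i => |v i|) (fun _ _ => abs_nonneg _) (Finset.mem_univ (e i))

/-! ### The squared norm -/

lemma sqNorm_eq_dotProduct (v : Fin m → ℝ) : sqNorm v = v ⬝ᵥ v := by
  simp [sqNorm, dotProduct, sq]

lemma sqNorm_nonneg (v : Fin m → ℝ) : 0 ≤ sqNorm v :=
  Finset.sum_nonneg fun _ _ => sq_nonneg _

lemma sq_apply_le_sqNorm (v : Fin m → ℝ) (i : Fin m) : v i ^ 2 ≤ sqNorm v :=
  Finset.single_le_sum (f := fun i => v i ^ 2) (fun _ _ => sq_nonneg _) (Finset.mem_univ i)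

lemma sqNorm_eq_zero {v : Fin m → ℝ} : sqNorm v = 0 ↔ v = 0 := by
  rw [sqNorm_eq_dotProduct, dotProduct_self_eq_zero]

lemma sqNorm_add (u v : Fin m → ℝ) : sqNorm (u + v) = sqNorm u + 2 * (u ⬝ᵥ v) + sqNorm v := by
  simp only [sqNorm_eq_dotProduct, add_dotProduct, dotProduct_add, dotProduct_comm v u]; ring

lemma sqNorm_sub (u v : Fin m → ℝ) : sqNorm (u - v) = sqNorm u - 2 * (u ⬝ᵥ v) + sqNorm v := by
  simp only [sqNorm_eq_dotProduct, sub_dotProduct, dotProduct_sub, dotProduct_comm v u]; ring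

lemma sqNorm_smul (c : ℝ) (v : Fin m → ℝ) : sqNorm (c • v) = c ^ 2 * sqNorm v := by
  simp only [sqNorm_eq_dotProduct, smul_dotProduct, dotProduct_smul, smul_eq_mul]; ring

lemma sqNorm_neg (v : Fin m → ℝ) : sqNorm (-v) = sqNorm v := by
  simpa using sqNorm_smul (-1) v

lemma sqNorm_sperm (e : Equiv.Perm (Fin m)) (s : Fin m → ℤˣ) (v : Fin m → ℝ) :
    sqNorm (sperm e s v) = sqNorm v := by
  rw [sqNorm_eq_dotProduct, sperm_dotProduct, sqNorm_eq_dotProduct]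

lemma continuous_sqNorm : Continuous (sqNorm : (Fin m → ℝ) → ℝ) := by
  unfold sqNorm; fun_prop

lemma two_mul_dotProduct_le (u v : Fin m → ℝ) : 2 * (u ⬝ᵥ v) ≤ sqNorm u + sqNorm v := by
  have := sqNorm_nonneg (u - v)
  rw [sqNorm_sub] at this; linarith

lemma two_mul_abs_dotProduct_le (u v : Fin m → ℝ) : 2 * |u ⬝ᵥ v| ≤ sqNorm u + sqNorm v := by
  rcases abs_cases (u ⬝ᵥ v) with ⟨h, _⟩ | ⟨h, _⟩ <;> rw [h]
  · exact two_mul_dotProduct_le u v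
  · have := two_mul_dotProduct_le (-u) v
    rwa [neg_dotProduct, sqNorm_neg] at this

lemma sqNorm_add_le (u v : Fin m → ℝ) : sqNorm (u + v) ≤ 2 * sqNorm u + 2 * sqNorm v := by
  have := two_mul_dotProduct_le u v
  rw [sqNorm_add]; linarith

lemma sqNorm_sub_le (u v : Fin m → ℝ) : sqNorm (u - v) ≤ 2 * sqNorm u + 2 * sqNorm v := by
  rw [sub_eq_add_neg]
  simpa [sqNorm_neg] using sqNorm_add_le u (-v)

/-! ### The proximal operator -/

/-- The optimality condition for the proximal problem: the residual `u - z` lies in `χ` times the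
unit ball of the dual norm and is aligned with `z`. -/
def IsProx (lam : Fin m → ℝ) (χ : ℝ) (u z : Fin m → ℝ) : Prop :=
  (∀ v, (u - z) ⬝ᵥ v ≤ χ * sortedL1 lam v) ∧ (u - z) ⬝ᵥ z = χ * sortedL1 lam z

lemma IsProx.proxObj_add_le {χ : ℝ} {u z : Fin m → ℝ} (h : IsProx lam χ u z) (w : Fin m → ℝ) :
    proxObj lam χ u z + 1 / 2 * sqNorm (w - z) ≤ proxObj lam χ u w := by
  have e : u - w = (u - z) - (w - z) := by abel
  have h1 := h.1 w
  unfold proxObj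
  rw [e, sqNorm_sub (u - z) (w - z), dotProduct_sub, h.2]
  linarith

lemma isProx_of_isMin (hl : Chamber lam) {χ : ℝ} (hχ : 0 ≤ χ) {u z : Fin m → ℝ}
    (h : ∀ w, proxObj lam χ u z ≤ proxObj lam χ u w) : IsProx lam χ u z := by
  have vi : ∀ w, (u - z) ⬝ᵥ (w - z) ≤ χ * (sortedL1 lam w - sortedL1 lam z) := by
    intro w
    -- compare with the segment from `z` to `w` and let the step tend to zero
    have hε : ∀ ε : ℝ, 0 < ε → ε ≤ 1 → (u - z) ⬝ᵥ (w - z) ≤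
        χ * (sortedL1 lam w - sortedL1 lam z) + ε * (1 / 2 * sqNorm (w - z)) := by
      intro ε h0 h1
      have hm := h ((1 - ε) • z + ε • w)
      have hJ : sortedL1 lam ((1 - ε) • z + ε • w) ≤
          (1 - ε) * sortedL1 lam z + ε * sortedL1 lam w := by
        refine (sortedL1_add_le hl _ _).trans (le_of_eq ?_)
        rw [sortedL1_smul hl, sortedL1_smul hl, abs_of_nonneg (by linarith), abs_of_nonneg h0.le]
      have e : u - ((1 - ε) • z + ε • w) = (u - z) - ε • (w - z) := by
        ext i; simp; ring
      unfold proxObj at hm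
      rw [e, sqNorm_sub (u - z) (ε • _), sqNorm_smul, dotProduct_smul, smul_eq_mul] at hm
      have hJ' := mul_le_mul_of_nonneg_left hJ hχ
      have : ε * ((u - z) ⬝ᵥ (w - z)) ≤
        ε * (χ * (sortedL1 lam w - sortedL1 lam z) + ε * (1 / 2 * sqNorm (w - z))) := by
        nlinarith
      exact le_of_mul_le_mul_left this h0
    have ht : Tendsto (fun ε : ℝ => χ * (sortedL1 lam w - sortedL1 lam z) +
        ε * (1 / 2 * sqNorm (w - z))) (𝓝[>] 0)
        (𝓝 (χ * (sortedL1 lam w - sortedL1 lam z) + 0 * (1 / 2 * sqNorm (w - z)))) := by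
      refine Tendsto.mono_left ?_ nhdsWithin_le_nhds
      exact (Continuous.tendsto (by fun_prop) 0)
    rw [zero_mul, add_zero] at ht
    refine ge_of_tendsto ht ?_
    filter_upwards [Ioc_mem_nhdsGT (zero_lt_one' ℝ)] with ε hε'
    exact hε ε hε'.1 hε'.2
  -- homogeneity: the points `0` and `2 z` of the ray through `z` force equality
  have h0 := vi 0
  have h2 := vi ((2 : ℝ) • z)
  rw [sortedL1_zero hl, dotProduct_sub, dotProduct_zero] at h0
  rw [sortedL1_smul hl, dotProduct_sub, dotProduct_smul, smul_eq_mul, abs_of_pos two_pos] at h2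
  have heq : (u - z) ⬝ᵥ z = χ * sortedL1 lam z := by linarith
  refine ⟨fun v => ?_, heq⟩
  have := vi v
  rw [dotProduct_sub, heq] at this
  linarith

lemma exists_isProx (hl : Chamber lam) {χ : ℝ} (hχ : 0 ≤ χ) (u : Fin m → ℝ) :
    ∃ z, IsProx lam χ u z := by
  have hc : Continuous (proxObj lam χ u) := by
    unfold proxObj
    have h1 := continuous_sortedL1 hl
    have h2 : Continuous fun z : Fin m → ℝ => sqNorm (u - z) :=
      continuous_sqNorm.comp (by fun_prop)
    fun_prop
  have hcoer : Tendsto (proxObj lam χ u) (cocompact _) atTop := by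
    have h1 : Tendsto (fun z : Fin m → ℝ => ‖z - u‖) (cocompact _) atTop := by
      have := (Homeomorph.subRight u).isClosedEmbedding.tendsto_cocompact
      exact (tendsto_norm_cocompact_atTop (E := Fin m → ℝ)).comp this
    have h2 : Tendsto (fun z : Fin m → ℝ => 1 / 2 * ‖z - u‖ ^ 2) (cocompact _) atTop :=
      ((tendsto_pow_atTop two_ne_zero).comp h1).const_mul_atTop (by norm_num)
    refine tendsto_atTop_mono (fun z => ?_) h2
    have h3 : ‖z - u‖ ^ 2 ≤ sqNorm (u - z) := by
      rw [← abs_of_nonneg (sqNorm_nonneg (u - z)), ← Real.sq_sqrt (abs_nonneg (sqNorm (u - z)))]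
      refine pow_le_pow_left₀ (norm_nonneg _) ?_ 2
      refine (pi_norm_le_iff_of_nonneg (Real.sqrt_nonneg _)).2 fun i => ?_
      rw [abs_of_nonneg (sqNorm_nonneg (u - z))]
      refine Real.le_sqrt_of_sq_le ?_
      rw [Real.norm_eq_abs, sq_abs]
      have := sq_apply_le_sqNorm (u - z) i
      simp only [Pi.sub_apply] at this ⊢
      nlinarith
    have h4 := mul_nonneg hχ (sortedL1_nonneg hl z)
    unfold proxObj
    linarith
  obtain ⟨z, hz⟩ := hc.exists_forall_le hcoer
  exact ⟨z, isProx_of_isMin hl hχ hz⟩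

lemma isProx_prox (hl : Chamber lam) {χ : ℝ} (hχ : 0 ≤ χ) (u : Fin m → ℝ) :
    IsProx lam χ u (prox u χ lam) := by
  obtain ⟨z, hz⟩ := exists_isProx hl hχ u
  refine isProx_of_isMin hl hχ ?_
  refine Classical.epsilon_spec (p := fun z => ∀ w, proxObj lam χ u z ≤ proxObj lam χ u w)
    ⟨z, fun w => ?_⟩
  have := hz.proxObj_add_le w
  have := sqNorm_nonneg (w - z)
  linarith

lemma IsProx.eq_prox (hl : Chamber lam) {χ : ℝ} (hχ : 0 ≤ χ) {u z : Fin m → ℝ}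
    (h : IsProx lam χ u z) : prox u χ lam = z := by
  have h1 := h.proxObj_add_le (prox u χ lam)
  have h2 := (isProx_prox hl hχ u).proxObj_add_le z
  have h3 := sqNorm_nonneg (prox u χ lam - z)
  have h4 := sqNorm_nonneg (z - prox u χ lam)
  exact sub_eq_zero.1 (sqNorm_eq_zero.1 (by linarith))

lemma residual_dotProduct_le (hl : Chamber lam) {χ : ℝ} (hχ : 0 ≤ χ) (u v : Fin m → ℝ) :
    (u - prox u χ lam) ⬝ᵥ v ≤ χ * sortedL1 lam v :=
  (isProx_prox hl hχ u).1 v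

lemma residual_dotProduct_prox (hl : Chamber lam) {χ : ℝ} (hχ : 0 ≤ χ) (u : Fin m → ℝ) :
    (u - prox u χ lam) ⬝ᵥ prox u χ lam = χ * sortedL1 lam (prox u χ lam) :=
  (isProx_prox hl hχ u).2

lemma prox_zero_right (hl : Chamber lam) (u : Fin m → ℝ) : prox u 0 lam = u :=
  IsProx.eq_prox hl le_rfl ⟨fun v => by simp, by simp⟩

lemma prox_smul_smul (hl : Chamber lam) {χ c : ℝ} (hχ : 0 ≤ χ) (hc : 0 ≤ c) (u : Fin m → ℝ) :
    prox (c • u) (c * χ) lam = c • prox u χ lam := by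
  refine IsProx.eq_prox hl (mul_nonneg hc hχ) ⟨fun v => ?_, ?_⟩
  · rw [← smul_sub, smul_dotProduct, smul_eq_mul, mul_assoc]
    exact mul_le_mul_of_nonneg_left (residual_dotProduct_le hl hχ u v) hc
  · rw [← smul_sub, smul_dotProduct, dotProduct_smul, residual_dotProduct_prox hl hχ,
      sortedL1_smul hl, abs_of_nonneg hc]
    simp only [smul_eq_mul]; ring

lemma prox_sperm (hl : Chamber lam) {χ : ℝ} (hχ : 0 ≤ χ) (e : Equiv.Perm (Fin m))
    (s : Fin m → ℤˣ) (u : Fin m → ℝ) :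
    prox (sperm e s u) χ lam = sperm e s (prox u χ lam) := by
  refine IsProx.eq_prox hl hχ ⟨fun v => ?_, ?_⟩
  · rw [← sperm_sub, ← sperm_sperm_inv e s v, sperm_dotProduct, sortedL1_sperm hl]
    exact residual_dotProduct_le hl hχ _ _
  · rw [← sperm_sub, sperm_dotProduct, sortedL1_sperm hl]
    exact residual_dotProduct_prox hl hχ _

lemma prox_neg (hl : Chamber lam) {χ : ℝ} (hχ : 0 ≤ χ) (u : Fin m → ℝ) :
    prox (-u) χ lam = -prox u χ lam := by
  have h : ∀ v : Fin m → ℝ, sperm 1 (fun _ => -1) v = -v := fun v => by ext i; simp [sperm]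
  simpa [h] using prox_sperm hl hχ 1 (fun _ => -1) u

/-- The residual maximizes the pairing with `prox u χ lam` over the scaled dual ball. -/
lemma residual_le_residual (hl : Chamber lam) {χ : ℝ} (hχ : 0 ≤ χ) (u u' : Fin m → ℝ) :
    (u' - prox u' χ lam) ⬝ᵥ prox u χ lam ≤ (u - prox u χ lam) ⬝ᵥ prox u χ lam := by
  rw [residual_dotProduct_prox hl hχ u]
  exact residual_dotProduct_le hl hχ u' _

/-- Firm nonexpansiveness. -/
lemma sqNorm_prox_sub_le (hl : Chamber lam) {χ : ℝ} (hχ : 0 ≤ χ) (u u' : Fin m → ℝ) :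
    sqNorm (prox u χ lam - prox u' χ lam) ≤ (prox u χ lam - prox u' χ lam) ⬝ᵥ (u - u') := by
  have h1 := residual_le_residual hl hχ u u'
  have h2 := residual_le_residual hl hχ u' u
  rw [sqNorm_eq_dotProduct]
  simp only [sub_dotProduct, dotProduct_sub] at *
  linarith [dotProduct_comm (prox u χ lam) (prox u' χ lam), dotProduct_comm u (prox u χ lam),
    dotProduct_comm u (prox u' χ lam), dotProduct_comm u' (prox u χ lam),
    dotProduct_comm u' (prox u' χ lam)]

/-! ### Pathwise estimates for the proximal operator -/

lemma sqNorm_prox_sub_le_sqNorm (hl : Chamber lam) {χ : ℝ} (hχ : 0 ≤ χ) (u u' : Fin m → ℝ) :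
    sqNorm (prox u χ lam - prox u' χ lam) ≤ sqNorm (u - u') := by
  have h1 := sqNorm_prox_sub_le hl hχ u u'
  have h2 := two_mul_dotProduct_le (prox u χ lam - prox u' χ lam) (u - u')
  linarith

lemma sortedL1_single_le (hl : Chamber lam) (i : Fin m) (c : ℝ) :
    sortedL1 lam (Pi.single i c) ≤ (∑ j, lam j) * |c| := by
  refine (sortedL1_le_sum_abs hl _).trans (le_of_eq ?_)
  congr 1
  rw [Finset.sum_eq_single i]
  · simp
  · intro j _ hj; simp [hj]
  · simp

lemma abs_residual_le (hl : Chamber lam) {χ : ℝ} (hχ : 0 ≤ χ) (u : Fin m → ℝ) (i : Fin m) :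
    |(u - prox u χ lam) i| ≤ χ * ∑ j, lam j := by
  obtain ⟨s, hs⟩ := exists_sign ((u - prox u χ lam) i)
  have h1 := residual_dotProduct_le hl hχ u (Pi.single i ((s : ℤ) : ℝ))
  have h2 := mul_le_mul_of_nonneg_left (sortedL1_single_le hl i ((s : ℤ) : ℝ)) hχ
  rw [dotProduct_single, mul_comm, hs] at h1
  rw [abs_sign, mul_one] at h2
  exact h1.trans h2

lemma sqNorm_residual_le (hl : Chamber lam) {χ : ℝ} (hχ : 0 ≤ χ) (u : Fin m → ℝ) :
    sqNorm (u - prox u χ lam) ≤ χ ^ 2 * (m * (∑ j, lam j) ^ 2) := by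
  have : ∀ i ∈ Finset.univ, (u - prox u χ lam) i ^ 2 ≤ (χ * ∑ j, lam j) ^ 2 := fun i _ =>
    sq_le_sq' (by linarith [neg_le_of_abs_le (abs_residual_le hl hχ u i)])
      (le_of_abs_le (abs_residual_le hl hχ u i))
  refine (Finset.sum_le_sum this).trans (le_of_eq ?_)
  simp; ring

lemma sortedL1_residual_le (hl : Chamber lam) {χ : ℝ} (hχ : 0 ≤ χ) (u : Fin m → ℝ) :
    sortedL1 lam (u - prox u χ lam) ≤ χ * (m * (∑ j, lam j) ^ 2) := by
  refine (sortedL1_le_sum_abs hl _).trans ?_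
  have h := Finset.sum_le_sum fun i (_ : i ∈ Finset.univ) => abs_residual_le hl hχ u i
  refine (mul_le_mul_of_nonneg_left h (Finset.sum_nonneg fun i _ => hl.2 i)).trans (le_of_eq ?_)
  simp; ring

lemma abs_sortedL1_sub_le (hl : Chamber lam) (u v : Fin m → ℝ) :
    |sortedL1 lam u - sortedL1 lam v| ≤ sortedL1 lam (u - v) := by
  have h1 := sortedL1_add_le hl (u - v) v
  have h2 := sortedL1_add_le hl (v - u) u
  rw [sub_add_cancel] at h1 h2
  rw [← neg_sub u v, sortedL1_neg hl] at h2
  exact abs_le.2 ⟨by linarith, by linarith⟩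

lemma sortedL1_sq_le (hl : Chamber lam) (v : Fin m → ℝ) :
    sortedL1 lam v ^ 2 ≤ (m * (∑ j, lam j) ^ 2) * sqNorm v := by
  have h1 := sortedL1_le_sum_abs hl v
  have h2 := sq_sum_le_card_mul_sum_sq (s := Finset.univ) (f := fun i => |v i|)
  simp only [sq_abs, Finset.card_univ, Fintype.card_fin] at h2
  calc sortedL1 lam v ^ 2 ≤ ((∑ i, lam i) * ∑ i, |v i|) ^ 2 :=
        pow_le_pow_left₀ (sortedL1_nonneg hl v) h1 2
    _ = (∑ i, lam i) ^ 2 * (∑ i, |v i|) ^ 2 := by ring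
    _ ≤ (∑ i, lam i) ^ 2 * (m * ∑ i, v i ^ 2) := mul_le_mul_of_nonneg_left h2 (sq_nonneg _)
    _ = _ := by unfold sqNorm; ring

lemma sqNorm_prox_sub_prox_le (hl : Chamber lam) {χ χ' : ℝ} (hχ : 0 ≤ χ) (hχ' : 0 ≤ χ')
    (u : Fin m → ℝ) :
    sqNorm (prox u χ lam - prox u χ' lam) ≤ (χ - χ') ^ 2 * (m * (∑ j, lam j) ^ 2) := by
  set z := prox u χ lam with hz
  set z' := prox u χ' lam with hz'
  have h1 := residual_dotProduct_le hl hχ u z'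
  have h2 := residual_dotProduct_prox hl hχ u
  have h3 := residual_dotProduct_le hl hχ' u z
  have h4 := residual_dotProduct_prox hl hχ' u
  rw [← hz] at h1 h2
  rw [← hz'] at h3 h4
  have key : sqNorm (z - z') ≤ (χ - χ') * (sortedL1 lam z' - sortedL1 lam z) := by
    have : sqNorm (z - z') = (u - z) ⬝ᵥ z' - (u - z) ⬝ᵥ z + ((u - z') ⬝ᵥ z - (u - z') ⬝ᵥ z') := by
      rw [sqNorm_eq_dotProduct]
      simp only [sub_dotProduct, dotProduct_sub]
      ring
    rw [this]; linarith
  have hJ := abs_sortedL1_sub_le hl z' z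
  have hJ2 := sortedL1_sq_le hl (z' - z)
  rw [← neg_sub z z', sqNorm_neg, neg_sub z z'] at hJ2
  have hd := sqNorm_nonneg (z - z')
  have h5 : sqNorm (z - z') ^ 2 ≤ (χ - χ') ^ 2 * ((m * (∑ j, lam j) ^ 2) * sqNorm (z - z')) := by
    calc sqNorm (z - z') ^ 2 ≤ ((χ - χ') * (sortedL1 lam z' - sortedL1 lam z)) ^ 2 :=
          pow_le_pow_left₀ hd key 2
      _ = (χ - χ') ^ 2 * |sortedL1 lam z' - sortedL1 lam z| ^ 2 := by rw [mul_pow, sq_abs]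
      _ ≤ _ := by
        refine mul_le_mul_of_nonneg_left (le_trans ?_ hJ2) (sq_nonneg _)
        exact pow_le_pow_left₀ (abs_nonneg _) hJ 2
  rcases hd.eq_or_lt with h0 | h0
  · rw [← h0]; positivity
  · refine le_of_mul_le_mul_right ?_ h0
    linarith [sq (sqNorm (z - z'))]

/-- The proximal operator is jointly continuous; the truncation `max χ 0` makes the parameter range
over all of `ℝ`. -/
lemma continuous_prox (hl : Chamber lam) :
    Continuous fun q : ℝ × (Fin m → ℝ) => prox q.2 (max q.1 0) lam := by
  refine continuous_pi fun i => continuous_iff_continuousAt.2 fun q₀ => ?_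
  have hb : Continuous fun q : ℝ × (Fin m → ℝ) => Real.sqrt (2 * sqNorm (q.2 - q₀.2) +
      2 * ((max q.1 0 - max q₀.1 0) ^ 2 * (m * (∑ j, lam j) ^ 2))) := by
    have := (continuous_sqNorm (m := m)).comp (f := fun q : ℝ × (Fin m → ℝ) => q.2 - q₀.2)
      (by fun_prop)
    simp only [Function.comp_def] at this
    fun_prop
  have hb0 := hb.tendsto q₀
  have hz : sqNorm (0 : Fin m → ℝ) = 0 := sqNorm_eq_zero.2 rfl
  simp only [sub_self, hz, mul_zero, zero_mul, add_zero, Real.sqrt_zero, ne_eq, OfNat.ofNat_ne_zero,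
    not_false_eq_true, zero_pow] at hb0
  refine tendsto_iff_dist_tendsto_zero.2 (squeeze_zero (fun _ => dist_nonneg) (fun q => ?_) hb0)
  rw [Real.dist_eq]
  refine Real.le_sqrt_of_sq_le ?_
  rw [sq_abs]
  have h1 := sq_apply_le_sqNorm (prox q.2 (max q.1 0) lam - prox q₀.2 (max q₀.1 0) lam) i
  have h2 := sqNorm_add_le (prox q.2 (max q.1 0) lam - prox q₀.2 (max q.1 0) lam)
    (prox q₀.2 (max q.1 0) lam - prox q₀.2 (max q₀.1 0) lam)
  rw [sub_add_sub_cancel] at h2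
  have h3 := sqNorm_prox_sub_le_sqNorm hl (le_max_right q.1 0) q.2 q₀.2
  have h4 := sqNorm_prox_sub_prox_le hl (le_max_right q.1 0) (le_max_right q₀.1 0) q₀.2
  rw [Pi.sub_apply] at h1
  linarith

lemma continuous_prox_left (hl : Chamber lam) {χ : ℝ} (hχ : 0 ≤ χ) :
    Continuous fun u : Fin m → ℝ => prox u χ lam := by
  have := (continuous_prox hl).comp (f := fun u : Fin m → ℝ => (χ, u)) (by fun_prop)
  simpa only [Function.comp_def, max_eq_left hχ] using this

lemma sqNorm_prox_le (hl : Chamber lam) {χ : ℝ} (hχ : 0 ≤ χ) (u : Fin m → ℝ) :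
    sqNorm (prox u χ lam) ≤ sqNorm u := by
  have h1 := residual_dotProduct_prox hl hχ u
  have h2 := mul_nonneg hχ (sortedL1_nonneg hl (prox u χ lam))
  have h3 := sqNorm_add (u - prox u χ lam) (prox u χ lam)
  rw [sub_add_cancel] at h3
  linarith [sqNorm_nonneg (u - prox u χ lam)]

lemma weight_sq_mul_sqNorm_le (hl : Chamber lam) (i : Fin m) (v : Fin m → ℝ) :
    lam i ^ 2 * sqNorm v ≤ m * sortedL1 lam v ^ 2 := by
  have : ∀ j ∈ Finset.univ, lam i ^ 2 * v j ^ 2 ≤ sortedL1 lam v ^ 2 := fun j _ => by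
    rw [← sq_abs (v j), ← mul_pow]
    exact pow_le_pow_left₀ (mul_nonneg (hl.2 i) (abs_nonneg _)) (mul_abs_le_sortedL1 hl v i j) 2
  have := Finset.sum_le_sum this
  rw [← Finset.mul_sum] at this
  simpa [sqNorm] using this

/-- The norm of the proximal point decays like `1 / χ`. -/
lemma sqNorm_prox_decay (hl : Chamber lam) {χ : ℝ} (hχ : 0 ≤ χ) (i : Fin m) (u : Fin m → ℝ) :
    16 * (χ ^ 2 * lam i ^ 2) * sqNorm (prox u χ lam) ≤ m * sqNorm u ^ 2 := by
  set z := prox u χ lam with hz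
  have h1 := residual_dotProduct_prox hl hχ u
  rw [← hz, sub_dotProduct, ← sqNorm_eq_dotProduct] at h1
  have h2 := two_mul_dotProduct_le u ((2 : ℝ) • z)
  rw [dotProduct_smul, sqNorm_smul, smul_eq_mul] at h2
  have h3 : 0 ≤ χ * sortedL1 lam z := mul_nonneg hχ (sortedL1_nonneg hl z)
  have h4 : 4 * (χ * sortedL1 lam z) ≤ sqNorm u := by linarith
  have h5 := weight_sq_mul_sqNorm_le hl i z
  calc 16 * (χ ^ 2 * lam i ^ 2) * sqNorm z = 16 * χ ^ 2 * (lam i ^ 2 * sqNorm z) := by ring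
    _ ≤ 16 * χ ^ 2 * (m * sortedL1 lam z ^ 2) := mul_le_mul_of_nonneg_left h5 (by positivity)
    _ = m * (4 * (χ * sortedL1 lam z)) ^ 2 := by ring
    _ ≤ m * sqNorm u ^ 2 := mul_le_mul_of_nonneg_left
        (pow_le_pow_left₀ (by positivity) h4 2) (Nat.cast_nonneg m)

lemma prox_eq_zero_of_abs_le (hl : Chamber lam) {χ : ℝ} (hχ : 0 ≤ χ) {i : Fin m}
    (hi : 0 < lam i) {B : ℝ} {u : Fin m → ℝ} (hu : ∀ j, |u j| ≤ B) (hB : m * B ≤ χ * lam i) :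
    prox u χ lam = 0 := by
  set z := prox u χ lam with hz
  have h1 := residual_dotProduct_prox hl hχ u
  rw [← hz, sub_dotProduct, ← sqNorm_eq_dotProduct] at h1
  have hB0 : 0 ≤ B := (abs_nonneg _).trans (hu i)
  have h2 : u ⬝ᵥ z ≤ B * ∑ j, |z j| := by
    rw [Finset.mul_sum]
    refine Finset.sum_le_sum fun j _ => (le_abs_self _).trans ?_
    rw [abs_mul]
    exact mul_le_mul_of_nonneg_right (hu j) (abs_nonneg _)
  have h3 : lam i * ∑ j, |z j| ≤ m * sortedL1 lam z := by
    rw [Finset.mul_sum]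
    refine (Finset.sum_le_sum fun j _ => mul_abs_le_sortedL1 hl z i j).trans (le_of_eq ?_)
    simp
  have h4 : lam i * sqNorm z ≤ (m * B - χ * lam i) * sortedL1 lam z := by
    have h5 := mul_le_mul_of_nonneg_left h2 hi.le
    have h6 := mul_le_mul_of_nonneg_left h3 hB0
    have : lam i * (u ⬝ᵥ z) = lam i * (sqNorm z + χ * sortedL1 lam z) := by rw [← h1]; ring
    nlinarith
  have h7 : (m * B - χ * lam i) * sortedL1 lam z ≤ 0 :=
    mul_nonpos_of_nonpos_of_nonneg (by linarith) (sortedL1_nonneg hl z)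
  have h8 : sqNorm z ≤ 0 := by
    by_contra hc
    have := mul_pos hi (not_le.1 hc)
    linarith
  exact sqNorm_eq_zero.1 (le_antisymm h8 (sqNorm_nonneg z))

/-- The estimation error of the proximal denoiser at noise level `1` and signal `t • x`. -/
def err (lam x : Fin m → ℝ) (t χ : ℝ) (h : Fin m → ℝ) : Fin m → ℝ :=
  prox (t • x + h) χ lam - t • x

lemma residual_eq_sub_err (lam x : Fin m → ℝ) (t χ : ℝ) (h : Fin m → ℝ) :
    t • x + h - prox (t • x + h) χ lam = h - err lam x t χ h := by
  unfold err; abel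

/-- For every noise vector the error is nondecreasing in the signal strength. -/
lemma sqNorm_err_mono (hl : Chamber lam) (x : Fin m → ℝ) {χ : ℝ} (hχ : 0 ≤ χ) {t s : ℝ}
    (ht : 0 ≤ t) (hts : t ≤ s) (h : Fin m → ℝ) :
    sqNorm (err lam x t χ h) ≤ sqNorm (err lam x s χ h) := by
  rcases hts.eq_or_lt with rfl | hlt
  · exact le_rfl
  set a := err lam x t χ h with ha
  set b := err lam x s χ h with hb
  have h1 := residual_le_residual hl hχ (t • x + h) (s • x + h)
  have h2 := residual_le_residual hl hχ (s • x + h) (t • x + h)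
  rw [residual_eq_sub_err, residual_eq_sub_err, ← ha, ← hb,
    show prox (t • x + h) χ lam = a + t • x by simp [ha, err]] at h1
  rw [residual_eq_sub_err, residual_eq_sub_err, ← ha, ← hb,
    show prox (s • x + h) χ lam = b + s • x by simp [hb, err]] at h2
  simp only [sub_dotProduct, dotProduct_add, dotProduct_smul, smul_eq_mul] at h1 h2
  have hc := two_mul_dotProduct_le a b
  simp only [sqNorm_eq_dotProduct] at hc ⊢
  rw [dotProduct_comm b a] at h1
  have hs : 0 < s := lt_of_le_of_lt ht hlt
  have h1' := mul_le_mul_of_nonneg_left h1 hs.le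
  have h2' := mul_le_mul_of_nonneg_left h2 ht
  have h3 : (s - t) * (a ⬝ᵥ a) ≤ (s - t) * (b ⬝ᵥ b) := by nlinarith
  exact le_of_mul_le_mul_left h3 (by linarith)

/-- Lower bound on the improvement over the unregularized estimator. -/
lemma sqNorm_sub_sqNorm_err_ge (hl : Chamber lam) (x : Fin m → ℝ) {χ t : ℝ} (hχ : 0 ≤ χ)
    (ht : 0 ≤ t) (h : Fin m → ℝ) :
    2 * χ * (sortedL1 lam (t • x + h) - t * sortedL1 lam x - χ * (m * (∑ j, lam j) ^ 2)) ≤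
      sqNorm h - sqNorm (err lam x t χ h) := by
  have h1 := residual_dotProduct_prox hl hχ (t • x + h)
  have h2 := residual_dotProduct_le hl hχ (t • x + h) (t • x)
  have h3 := sortedL1_residual_le hl hχ (t • x + h)
  have h4 := abs_sortedL1_sub_le hl (t • x + h) (prox (t • x + h) χ lam)
  have h5 := le_of_abs_le h4
  rw [sortedL1_smul hl, abs_of_nonneg ht] at h2
  set r := t • x + h - prox (t • x + h) χ lam with hr
  have e : err lam x t χ h = h - r := by rw [hr, residual_eq_sub_err]; abel
  have e2 : prox (t • x + h) χ lam = h - r + t • x := by rw [← e]; simp [err]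
  have h6 : r ⬝ᵥ prox (t • x + h) χ lam = r ⬝ᵥ h - r ⬝ᵥ r + r ⬝ᵥ (t • x) := by
    rw [e2, dotProduct_add, dotProduct_sub]
  rw [e, sqNorm_sub, dotProduct_comm h r]
  have h7 : χ * (sortedL1 lam (t • x + h) - χ * (m * (∑ j, lam j) ^ 2)) ≤
      χ * sortedL1 lam (prox (t • x + h) χ lam) :=
    mul_le_mul_of_nonneg_left (by linarith) hχ
  have h8 := sqNorm_nonneg r
  rw [sqNorm_eq_dotProduct] at h8 ⊢
  rw [sqNorm_eq_dotProduct]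
  linarith

/-! ### Monotone equivariant maps preserve the chamber -/

/-- A monotone map that commutes with signed permutations maps sorted nonnegative vectors to
sorted nonnegative vectors. -/
lemma Chamber.map_of_equivariant {F : (Fin m → ℝ) → Fin m → ℝ}
    (hF : ∀ e s u, F (sperm e s u) = sperm e s (F u))
    (hmono : ∀ u v, 0 ≤ (F u - F v) ⬝ᵥ (u - v)) {u : Fin m → ℝ} (hu : Chamber u) :
    Chamber (F u) := by
  constructor
  · intro i j hij
    rcases (hu.1 hij).eq_or_lt with he | hlt
    · have h1 : sperm (Equiv.swap i j) 1 u = u := by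
        ext l
        simp only [sperm, Pi.one_apply, Units.val_one, Int.cast_one, one_mul]
        rcases eq_or_ne l i with rfl | hli
        · rw [Equiv.swap_apply_left, he]
        · rcases eq_or_ne l j with rfl | hlj
          · rw [Equiv.swap_apply_right, he]
          · rw [Equiv.swap_apply_of_ne_of_ne hli hlj]
      have h2 := congrFun (hF (Equiv.swap i j) 1 u) i
      rw [h1] at h2
      simp [sperm] at h2
      exact h2.ge
    · have hne : i ≠ j := by rintro rfl; exact lt_irrefl _ hlt
      have h1 : ∀ v : Fin m → ℝ, v - sperm (Equiv.swap i j) 1 v =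
          Pi.single i (v i - v j) + Pi.single j (v j - v i) := by
        intro v
        ext l
        simp only [sperm, Pi.one_apply, Units.val_one, Int.cast_one, one_mul, Pi.sub_apply,
          Pi.add_apply]
        rcases eq_or_ne l i with rfl | hli
        · simp [Pi.single_eq_of_ne hne]
        · rcases eq_or_ne l j with rfl | hlj
          · simp [Pi.single_eq_of_ne hli]
          · rw [Equiv.swap_apply_of_ne_of_ne hli hlj]
            simp [Pi.single_eq_of_ne hli, Pi.single_eq_of_ne hlj]
      -- `u` minus its reflection is a positive multiple of the root, so monotonicity gives the sign
      have h2 := hmono u (sperm (Equiv.swap i j) 1 u)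
      rw [hF, h1, h1, dotProduct_add, dotProduct_single, dotProduct_single] at h2
      simp only [Pi.add_apply, Pi.single_eq_same, Pi.single_eq_of_ne hne,
        Pi.single_eq_of_ne hne.symm] at h2
      nlinarith
  · intro i
    have h1 : ∀ v : Fin m → ℝ, v - sperm 1 (Function.update 1 i (-1)) v =
        Pi.single i (2 * v i) := by
      intro v
      ext l
      simp only [sperm, Pi.sub_apply, Equiv.Perm.one_apply]
      rcases eq_or_ne l i with rfl | hli
      · simp; ring
      · simp [Function.update_of_ne hli, Pi.single_eq_of_ne hli]
    rcases (hu.2 i).eq_or_lt with he | hlt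
    · have h2 := h1 u
      rw [← he, mul_zero, Pi.single_zero, sub_eq_zero] at h2
      have h3 := h1 (F u)
      rw [← hF, ← h2, sub_self] at h3
      have := congrFun h3 i
      simp at this
      exact this.ge
    · have h2 := hmono u (sperm 1 (Function.update 1 i (-1)) u)
      rw [hF, h1, h1, dotProduct_single, Pi.single_eq_same] at h2
      nlinarith

lemma Chamber.prox (hl : Chamber lam) {χ : ℝ} (hχ : 0 ≤ χ) {u : Fin m → ℝ} (hu : Chamber u) :
    Chamber (prox u χ lam) :=
  Chamber.map_of_equivariant (F := fun u => Slope.prox u χ lam)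
    (fun e s u => prox_sperm hl hχ e s u)
    (fun u v => (sqNorm_nonneg _).trans (sqNorm_prox_sub_le hl hχ u v)) hu

/-! ### Partial sums -/

/-- Extension of a vector by zero to a sequence indexed by the natural numbers. -/
def extz (v : Fin m → ℝ) (i : ℕ) : ℝ := if h : i < m then v ⟨i, h⟩ else 0

/-- The sum of the first `j` entries of `v`. -/
def psum (v : Fin m → ℝ) (j : ℕ) : ℝ := ∑ i ∈ Finset.range j, extz v i

lemma extz_apply (v : Fin m → ℝ) (i : Fin m) : extz v i = v i := by simp [extz]

lemma extz_card (v : Fin m → ℝ) : extz v m = 0 := by simp [extz]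

lemma psum_add (u v : Fin m → ℝ) (j : ℕ) : psum (u + v) j = psum u j + psum v j := by
  unfold psum
  rw [← Finset.sum_add_distrib]
  exact Finset.sum_congr rfl fun i _ => by unfold extz; split_ifs <;> simp

lemma psum_sub (u v : Fin m → ℝ) (j : ℕ) : psum (u - v) j = psum u j - psum v j := by
  unfold psum
  rw [← Finset.sum_sub_distrib]
  exact Finset.sum_congr rfl fun i _ => by unfold extz; split_ifs <;> simp

lemma psum_succ (v : Fin m → ℝ) (i : Fin m) : psum v (i + 1) = psum v i + v i := by
  rw [psum, Finset.sum_range_succ, extz_apply, ← psum]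

lemma psum_increments (T : ℕ → ℝ) (hT : T 0 = 0) {j : ℕ} (hj : j ≤ m) :
    psum (fun i : Fin m => T (i + 1) - T i) j = T j := by
  rw [psum]
  have : ∀ i ∈ Finset.range j, extz (fun i : Fin m => T (i + 1) - T i) i = T (i + 1) - T i := by
    intro i hi
    have : i < m := (Finset.mem_range.1 hi).trans_le hj
    simp [extz, this]
  rw [Finset.sum_congr rfl this, Finset.sum_range_sub, hT, sub_zero]

lemma dotProduct_eq_sum_psum (q d : Fin m → ℝ) :
    q ⬝ᵥ d = ∑ i ∈ Finset.range m, (extz q i - extz q (i + 1)) * psum d (i + 1) := by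
  -- summation by parts; the boundary term vanishes at `n = m` because `extz q m = 0`
  have abel : ∀ n : ℕ, ∑ i ∈ Finset.range n, extz q i * extz d i =
      ∑ i ∈ Finset.range n, (extz q i - extz q (i + 1)) * psum d (i + 1) +
        extz q n * psum d n := by
    intro n
    induction n with
    | zero => simp [psum]
    | succ n ih =>
      rw [Finset.sum_range_succ, Finset.sum_range_succ, ih]
      have : psum d (n + 1) = psum d n + extz d n := by
        rw [psum, Finset.sum_range_succ, ← psum]
      rw [this]; ring
  have h := abel m
  rw [extz_card, zero_mul, add_zero] at h
  rw [← h, Finset.sum_range]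
  simp [dotProduct, extz_apply]

lemma Chamber.extz_antitone {q : Fin m → ℝ} (hq : Chamber q) {i : ℕ} (hi : i < m) :
    extz q (i + 1) ≤ extz q i := by
  unfold extz
  rw [dif_pos hi]
  split_ifs with h
  · exact hq.1 (Fin.mk_le_mk.2 (Nat.le_succ i))
  · exact hq.2 _

/-- Vectors of the chamber pair monotonically with the order given by partial sums. -/
lemma Chamber.dotProduct_le {q d d' : Fin m → ℝ} (hq : Chamber q)
    (h : ∀ j ≤ m, psum d j ≤ psum d' j) : q ⬝ᵥ d ≤ q ⬝ᵥ d' := by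
  rw [dotProduct_eq_sum_psum, dotProduct_eq_sum_psum]
  refine Finset.sum_le_sum fun i hi => ?_
  have hi' := Finset.mem_range.1 hi
  exact mul_le_mul_of_nonneg_left (h _ hi') (sub_nonneg.2 (hq.extz_antitone hi'))

lemma Chamber.dotProduct_nonneg {q d : Fin m → ℝ} (hq : Chamber q)
    (h : ∀ j ≤ m, 0 ≤ psum d j) : 0 ≤ q ⬝ᵥ d := by
  have := hq.dotProduct_le (d := 0) (d' := d) fun j hj => by
    simpa [psum, extz] using h j hj
  simpa using this

/-! ### Monotonicity of the residual under scaling -/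

lemma psum_residual_le (hl : Chamber lam) {χ : ℝ} (hχ : 0 ≤ χ) (u : Fin m → ℝ) {j : ℕ}
    (hj : j ≤ m) : psum (u - Slope.prox u χ lam) j ≤ psum (χ • lam) j := by
  set v : Fin m → ℝ := fun i => if (i : ℕ) < j then 1 else 0 with hv
  have hvc : Chamber v := by
    constructor
    · intro a b hab
      simp only [hv]
      have : (a : ℕ) ≤ b := hab
      split_ifs <;> first | omega | norm_num
    · intro i; simp only [hv]; split_ifs <;> norm_num
  have hs : ∀ w : Fin m → ℝ, w ⬝ᵥ v = psum w j := by
    intro w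
    have h1 : psum w j = ∑ i ∈ Finset.range m, if i < j then extz w i else 0 := by
      rw [← Finset.sum_filter, psum]
      refine Finset.sum_congr ?_ fun _ _ => rfl
      ext i; simp; omega
    rw [h1, Finset.sum_range]
    simp [dotProduct, hv, extz_apply]
  have h := residual_dotProduct_le hl hχ u v
  rw [sortedL1_of_chamber hl hvc, hs] at h
  refine h.trans (le_of_eq ?_)
  rw [← hs, smul_dotProduct]
  rfl

/-- On the chamber the residual is the projection onto the larger set given by the bounds on the
partial sums alone. -/
lemma prox_dotProduct_le_of_psum_le (hl : Chamber lam) {χ : ℝ} (hχ : 0 ≤ χ) {u : Fin m → ℝ}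
    (hu : Chamber u) {w : Fin m → ℝ} (hw : ∀ j ≤ m, psum w j ≤ psum (χ • lam) j) :
    Slope.prox u χ lam ⬝ᵥ (w - (u - Slope.prox u χ lam)) ≤ 0 := by
  have hc := Chamber.prox hl hχ hu
  have h1 := hc.dotProduct_le hw
  have h2 := residual_dotProduct_prox hl hχ u
  rw [sortedL1_of_chamber hl hc] at h2
  rw [dotProduct_sub, dotProduct_comm _ (u - Slope.prox u χ lam), h2]
  have h3 : Slope.prox u χ lam ⬝ᵥ (χ • lam) = χ * ∑ i, lam i * Slope.prox u χ lam i := by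
    rw [dotProduct_smul, dotProduct_comm]; rfl
  linarith

/-- The partial sums of the residual of a sorted nonnegative vector grow with the scale of the
vector. This is the monotone comparative statics principle for the projection, a submodular
problem in the partial sums. -/
lemma psum_residual_mono (hl : Chamber lam) {χ : ℝ} (hχ : 0 ≤ χ) {u : Fin m → ℝ}
    (hu : Chamber u) {s : ℝ} (hs : 1 ≤ s) {j : ℕ} (hj : j ≤ m) :
    psum (u - Slope.prox u χ lam) j ≤ psum (s • u - Slope.prox (s • u) χ lam) j := by
  have hsu : Chamber (s • u) := by
    refine ⟨fun i j hij => ?_, fun i => ?_⟩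
    · exact mul_le_mul_of_nonneg_left (hu.1 hij) (by linarith)
    · exact mul_nonneg (by linarith) (hu.2 i)
  set z := u - Slope.prox u χ lam with hz
  set z' := s • u - Slope.prox (s • u) χ lam with hz'
  -- the excess of the partial sums of `z` over those of `z'`, and its increments `e`; the
  -- competitors `z - e` and `z' + e` have the minimum and the maximum of the partial sums
  set T : ℕ → ℝ := fun j => max (psum z j - psum z' j) 0 with hT
  set e : Fin m → ℝ := fun i => T (i + 1) - T i with he
  have hpe : ∀ j ≤ m, psum e j = T j := fun j hj =>
    psum_increments T (by simp [hT, psum]) hj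
  have h1 := prox_dotProduct_le_of_psum_le hl hχ hu (w := z - e) fun j hj => by
    have a := psum_residual_le hl hχ u hj
    have := le_max_right (psum z j - psum z' j) 0
    rw [psum_sub, hpe j hj]
    exact (sub_le_self _ this).trans a
  have h2 := prox_dotProduct_le_of_psum_le hl hχ hsu (w := z' + e) fun j hj => by
    have a := psum_residual_le hl hχ u hj
    have b := psum_residual_le hl hχ (s • u) hj
    rw [psum_add, hpe j hj, ← le_sub_iff_add_le']
    exact max_le (by linarith) (by linarith)
  rw [← hz, show Slope.prox u χ lam = u - z by rw [hz]; abel, show z - e - z = -e by abel,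
    dotProduct_neg] at h1
  rw [← hz', show Slope.prox (s • u) χ lam = s • u - z' by rw [hz']; abel,
    show z' + e - z' = e by abel] at h2
  have h3 : 0 ≤ u ⬝ᵥ e := hu.dotProduct_nonneg fun j hj => by
    rw [hpe j hj]; exact le_max_right _ _
  have h4 : sqNorm e ≤ (z - z') ⬝ᵥ e := by
    rw [sqNorm_eq_dotProduct]
    refine Finset.sum_le_sum fun i _ => ?_
    have a := psum_succ z i
    have b := psum_succ z' i
    have c : (z - z') i = (psum z (i + 1) - psum z' (i + 1)) - (psum z i - psum z' i) := by
      rw [Pi.sub_apply]; linarith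
    rw [c]
    simp only [he, hT]
    generalize psum z (i + 1) - psum z' (i + 1) = p
    generalize psum z i - psum z' i = q
    rcases max_cases p 0 with ⟨hp, _⟩ | ⟨hp, _⟩ <;> rcases max_cases q 0 with ⟨hq, _⟩ | ⟨hq, _⟩ <;>
      rw [hp, hq] <;> nlinarith
  simp only [sub_dotProduct, smul_dotProduct, smul_eq_mul] at h1 h2 h4
  have h5 : sqNorm e ≤ 0 := by nlinarith
  have h6 : e = 0 := sqNorm_eq_zero.1 (le_antisymm h5 (sqNorm_nonneg e))
  have h7 := hpe j hj
  rw [h6] at h7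
  have h8 : T j = 0 := by rw [← h7]; simp [psum, extz]
  have := le_max_left (psum z j - psum z' j) 0
  change psum z j - psum z' j ≤ T j at this
  linarith

/-- The exponentially weighted orbit sum of `x` under the group of signed permutations. Up to
normalization this is the posterior mean of a uniformly random point of the orbit of `x`. -/
def orbitMean (x : Fin m → ℝ) (u : Fin m → ℝ) : Fin m → ℝ :=
  ∑ e : Equiv.Perm (Fin m), ∑ s : Fin m → ℤˣ, Real.exp (sperm e s x ⬝ᵥ u) • sperm e s x

lemma sum_sperm_comp (f : (Fin m → ℝ) → ℝ) (e : Equiv.Perm (Fin m)) (s : Fin m → ℤˣ)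
    (x : Fin m → ℝ) :
    ∑ e' : Equiv.Perm (Fin m), ∑ s' : Fin m → ℤˣ, f (sperm e s (sperm e' s' x)) =
      ∑ e' : Equiv.Perm (Fin m), ∑ s' : Fin m → ℤˣ, f (sperm e' s' x) := by
  simp only [sperm_comp]
  rw [← Equiv.sum_comp (Equiv.mulRight e) fun e' => ∑ s' : Fin m → ℤˣ, f (sperm e' s' x)]
  refine Finset.sum_congr rfl fun e' _ => ?_
  exact Equiv.sum_comp ((Equiv.arrowCongr e.symm (Equiv.refl ℤˣ)).trans (Equiv.mulLeft s))
    fun s' => f (sperm (e' * e) s' x)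

lemma orbitMean_sperm (x u : Fin m → ℝ) (e : Equiv.Perm (Fin m)) (s : Fin m → ℤˣ) :
    orbitMean x (sperm e s u) = sperm e s (orbitMean x u) := by
  ext i
  have h := sum_sperm_comp (fun y => Real.exp (y ⬝ᵥ sperm e s u) * y i) e s x
  simp only [sperm_dotProduct] at h
  simp only [orbitMean, Finset.sum_apply, Pi.smul_apply, smul_eq_mul]
  rw [← h]
  simp only [sperm, Finset.sum_apply, Finset.mul_sum, Pi.smul_apply, smul_eq_mul]
  exact Finset.sum_congr rfl fun e' _ => Finset.sum_congr rfl fun s' _ => by ring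

lemma orbitMean_dotProduct (x u v : Fin m → ℝ) : orbitMean x u ⬝ᵥ v =
    ∑ e : Equiv.Perm (Fin m), ∑ s : Fin m → ℤˣ,
      Real.exp (sperm e s x ⬝ᵥ u) * (sperm e s x ⬝ᵥ v) := by
  simp [orbitMean, sum_dotProduct, smul_dotProduct]

lemma orbitMean_mono (x u v : Fin m → ℝ) :
    0 ≤ (orbitMean x u - orbitMean x v) ⬝ᵥ (u - v) := by
  rw [sub_dotProduct, orbitMean_dotProduct, orbitMean_dotProduct, ← Finset.sum_sub_distrib]
  refine Finset.sum_nonneg fun e _ => ?_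
  rw [← Finset.sum_sub_distrib]
  refine Finset.sum_nonneg fun s _ => ?_
  rw [← sub_mul, dotProduct_sub]
  rcases le_total (sperm e s x ⬝ᵥ u) (sperm e s x ⬝ᵥ v) with h | h
  · exact mul_nonneg_of_nonpos_of_nonpos (sub_nonpos.2 (Real.exp_le_exp.2 h)) (sub_nonpos.2 h)
  · exact mul_nonneg (sub_nonneg.2 (Real.exp_le_exp.2 h)) (sub_nonneg.2 h)

/-- Scaling up the observation increases the correlation of the residual with the orbit mean. -/
lemma orbitMean_dotProduct_residual_mono (hl : Chamber lam) {χ : ℝ} (hχ : 0 ≤ χ)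
    (x u : Fin m → ℝ) {s : ℝ} (hs : 1 ≤ s) :
    0 ≤ orbitMean x u ⬝ᵥ
      ((s • u - Slope.prox (s • u) χ lam) - (u - Slope.prox u χ lam)) := by
  obtain ⟨e, σ, hc⟩ := exists_sperm_chamber u
  rw [← sperm_dotProduct e σ, ← orbitMean_sperm, sperm_sub, sperm_sub, sperm_sub, sperm_smul,
    ← prox_sperm hl hχ, ← prox_sperm hl hχ, sperm_smul]
  refine Chamber.dotProduct_nonneg
    (Chamber.map_of_equivariant (fun e s u => orbitMean_sperm x u e s) (orbitMean_mono x) hc) ?_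
  intro j hj
  rw [psum_sub, sub_nonneg]
  exact psum_residual_mono hl hχ hc hs hj

/-! ### The standard Gaussian vector -/

instance instIsProbabilityMeasureStdGauss (m : ℕ) : IsProbabilityMeasure (stdGauss m) := by
  unfold stdGauss; infer_instance

instance instIsOpenPosMeasureStdGauss (m : ℕ) : (stdGauss m).IsOpenPosMeasure := by
  have : (gaussianReal 0 1).IsOpenPosMeasure :=
    (gaussianReal_absolutelyContinuous' 0 one_ne_zero).isOpenPosMeasure
  unfold stdGauss; infer_instance

/-- Selecting distinct coordinates of a standard Gaussian vector gives a standard Gaussian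
vector. -/
lemma measurePreserving_comp_injective {m n : ℕ} {ι : Fin n → Fin m}
    (hι : Function.Injective ι) :
    MeasurePreserving (fun (h : Fin m → ℝ) j => h (ι j)) (stdGauss m) (stdGauss n) := by
  refine ⟨by fun_prop, ?_⟩
  symm
  refine Measure.pi_eq fun s hs => ?_
  rw [Measure.map_apply (by fun_prop) (MeasurableSet.univ_pi hs)]
  set t : Fin m → Set ℝ := Function.extend ι s (fun _ => Set.univ) with ht
  have h1 : (fun (h : Fin m → ℝ) j => h (ι j)) ⁻¹' Set.univ.pi s = Set.univ.pi t := by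
    ext h
    simp only [Set.mem_preimage, Set.mem_univ_pi]
    constructor
    · intro H i
      by_cases hi : ∃ j, ι j = i
      · obtain ⟨j, rfl⟩ := hi
        rw [ht, hι.extend_apply]; exact H j
      · rw [ht, Function.extend_apply' _ _ _ hi]; trivial
    · intro H j
      have := H (ι j)
      rwa [ht, hι.extend_apply] at this
  rw [h1, stdGauss, Measure.pi_pi]
  have h2 : ∏ i, (gaussianReal 0 1) (t i) =
      ∏ i ∈ Finset.univ.map ⟨ι, hι⟩, (gaussianReal 0 1) (t i) := by
    symm
    refine Finset.prod_subset (Finset.subset_univ _) fun i _ hi => ?_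
    have : ¬ ∃ j, ι j = i := by simpa using hi
    rw [ht, Function.extend_apply' _ _ _ this, measure_univ]
  rw [h2, Finset.prod_map]
  refine Finset.prod_congr rfl fun j _ => ?_
  simp [ht, hι.extend_apply]

lemma measurePreserving_sperm (e : Equiv.Perm (Fin m)) (s : Fin m → ℤˣ) :
    MeasurePreserving (sperm e s) (stdGauss m) (stdGauss m) := by
  have h1 := measurePreserving_comp_injective (ι := e) e.injective
  have h2 : ∀ i, MeasurePreserving (fun a : ℝ => ((s i : ℤ) : ℝ) * a) (gaussianReal 0 1)
      (gaussianReal 0 1) := by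
    intro i
    refine ⟨by fun_prop, ?_⟩
    rw [gaussianReal_map_const_mul, mul_zero]
    congr 1
    ext
    rcases Int.units_eq_one_or (s i) with h | h <;> simp [h]
  exact (measurePreserving_pi (fun _ => gaussianReal 0 1) (fun _ => gaussianReal 0 1) h2).comp h1

lemma continuous_sperm (e : Equiv.Perm (Fin m)) (s : Fin m → ℤˣ) :
    Continuous (sperm e s : (Fin m → ℝ) → Fin m → ℝ) := by
  unfold sperm; fun_prop

lemma measurableEmbedding_sperm (e : Equiv.Perm (Fin m)) (s : Fin m → ℤˣ) :
    MeasurableEmbedding (sperm e s : (Fin m → ℝ) → Fin m → ℝ) :=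
  MeasurableEquiv.measurableEmbedding
    { toFun := sperm e s
      invFun := sperm e⁻¹ (fun i => s (e⁻¹ i))
      left_inv := sperm_inv_sperm e s
      right_inv := sperm_sperm_inv e s
      measurable_toFun := (continuous_sperm _ _).measurable
      measurable_invFun := (continuous_sperm _ _).measurable }

lemma integral_comp_sperm (e : Equiv.Perm (Fin m)) (s : Fin m → ℤˣ) (f : (Fin m → ℝ) → ℝ) :
    ∫ h, f (sperm e s h) ∂stdGauss m = ∫ h, f h ∂stdGauss m :=
  (measurePreserving_sperm e s).integral_comp (measurableEmbedding_sperm e s) f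

lemma integrable_comp_sperm (e : Equiv.Perm (Fin m)) (s : Fin m → ℤˣ) (f : (Fin m → ℝ) → ℝ) :
    Integrable (fun h => f (sperm e s h)) (stdGauss m) ↔ Integrable f (stdGauss m) :=
  (measurePreserving_sperm e s).integrable_comp_emb (measurableEmbedding_sperm e s)

lemma integral_neg_comp (f : (Fin m → ℝ) → ℝ) :
    ∫ h, f (-h) ∂stdGauss m = ∫ h, f h ∂stdGauss m := by
  have h : ∀ v : Fin m → ℝ, sperm 1 (fun _ => -1) v = -v := fun v => by ext i; simp [sperm]
  simpa [h] using integral_comp_sperm 1 (fun _ => -1) f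

lemma integrable_sqNorm_sq : Integrable (fun h => sqNorm h ^ 2) (stdGauss m) := by
  have h4 : ∀ i : Fin m, Integrable (fun h : Fin m → ℝ => h i ^ 4) (stdGauss m) := by
    intro i
    have h1 : Integrable (fun a : ℝ => a ^ 4) (gaussianReal 0 1) := by
      have := (memLp_id_gaussianReal (μ := 0) (v := 1) 4).integrable_norm_pow (by norm_num)
      refine this.congr (ae_of_all _ fun a => ?_)
      simp only [id, Real.norm_eq_abs]
      exact Even.pow_abs (by decide) a
    exact integrable_comp_eval (μ := fun _ : Fin m => gaussianReal 0 1) (i := i) h1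
  have hs : Integrable (fun h : Fin m → ℝ => (m : ℝ) * ∑ i, h i ^ 4) (stdGauss m) :=
    (integrable_finsetSum _ fun i _ => h4 i).const_mul _
  refine hs.mono' (continuous_sqNorm.pow 2).aestronglyMeasurable (ae_of_all _ fun h => ?_)
  rw [Real.norm_of_nonneg (sq_nonneg _)]
  have := sq_sum_le_card_mul_sum_sq (s := Finset.univ) (f := fun i => h i ^ 2)
  simp only [Finset.card_univ, Fintype.card_fin, ← pow_mul] at this
  exact this

lemma integrable_of_abs_le {f : (Fin m → ℝ) → ℝ} (hf : Continuous f) (A : ℝ)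
    (h : ∀ v, |f v| ≤ A * (1 + sqNorm v ^ 2)) : Integrable f (stdGauss m) :=
  (((integrable_const (1 : ℝ)).add integrable_sqNorm_sq).const_mul A).mono'
    hf.aestronglyMeasurable (ae_of_all _ h)

lemma sqNorm_le_one_add_sq (v : Fin m → ℝ) : sqNorm v ≤ 1 + sqNorm v ^ 2 := by
  nlinarith [sq_nonneg (sqNorm v - 1)]

/-- Continuous functions of quadratic growth are integrable. -/
lemma integrable_of_abs_le_sqNorm {f : (Fin m → ℝ) → ℝ} (hf : Continuous f) (A B : ℝ) (hA : 0 ≤ A)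
    (hB : 0 ≤ B) (h : ∀ v, |f v| ≤ A + B * sqNorm v) : Integrable f (stdGauss m) := by
  refine integrable_of_abs_le hf (A + B) fun v => (h v).trans ?_
  have := mul_le_mul_of_nonneg_left (sqNorm_le_one_add_sq v) hB
  have := mul_nonneg hA (sq_nonneg (sqNorm v))
  linarith

lemma integrable_sqNorm : Integrable (fun h => sqNorm h) (stdGauss m) :=
  integrable_of_abs_le_sqNorm continuous_sqNorm 0 1 le_rfl zero_le_one fun v => by
    rw [abs_of_nonneg (sqNorm_nonneg v)]; linarith

lemma integral_apply (i : Fin m) : ∫ h, h i ∂stdGauss m = 0 := by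
  have := (measurePreserving_eval (fun _ : Fin m => gaussianReal 0 1) i).map_eq
  have h2 : ∫ a, a ∂((stdGauss m).map (Function.eval i)) = ∫ h, h i ∂stdGauss m :=
    integral_map (measurable_pi_apply i).aemeasurable aestronglyMeasurable_id
  rw [← h2, stdGauss, this]
  exact integral_id_gaussianReal

lemma integral_apply_sq (i : Fin m) : ∫ h, h i ^ 2 ∂stdGauss m = 1 := by
  have := (measurePreserving_eval (fun _ : Fin m => gaussianReal 0 1) i).map_eq
  have h2 : ∫ a, a ^ 2 ∂((stdGauss m).map (Function.eval i)) = ∫ h, h i ^ 2 ∂stdGauss m :=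
    integral_map (measurable_pi_apply i).aemeasurable (by fun_prop)
  rw [← h2, stdGauss, this]
  have h3 := variance_fun_id_gaussianReal (μ := 0) (v := 1)
  rw [variance_of_integral_eq_zero (by fun_prop) integral_id_gaussianReal] at h3
  simpa using h3

lemma integrable_apply_sq (i : Fin m) : Integrable (fun h => h i ^ 2) (stdGauss m) :=
  integrable_sqNorm.mono' (Continuous.aestronglyMeasurable (by fun_prop)) (ae_of_all _ fun h => by
    rw [Real.norm_of_nonneg (sq_nonneg _)]; exact sq_apply_le_sqNorm h i)

lemma integrable_apply (i : Fin m) : Integrable (fun h => h i) (stdGauss m) :=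
  integrable_of_abs_le_sqNorm (by fun_prop) 1 1 zero_le_one zero_le_one fun h => by
    have := sq_apply_le_sqNorm h i
    rw [← sq_abs] at this
    nlinarith [sq_nonneg (|h i| - 1), abs_nonneg (h i)]

lemma integral_sqNorm : ∫ h, sqNorm h ∂stdGauss m = m := by
  unfold sqNorm
  rw [integral_finsetSum _ fun i _ => integrable_apply_sq i]
  simp [integral_apply_sq]

lemma integrable_dotProduct_left (v : Fin m → ℝ) : Integrable (fun h => v ⬝ᵥ h) (stdGauss m) :=
  integrable_finsetSum _ fun i _ => (integrable_apply i).const_mul _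

lemma integral_dotProduct_left (v : Fin m → ℝ) : ∫ h, v ⬝ᵥ h ∂stdGauss m = 0 := by
  simp only [dotProduct]
  rw [integral_finsetSum _ fun i _ => (integrable_apply i).const_mul _]
  simp [integral_const_mul, integral_apply]

/-! ### Translation of the Gaussian measure and averaging over signed permutations -/

lemma gaussianReal_eq_withDensity (y : ℝ) : gaussianReal y 1 =
    (gaussianReal 0 1).withDensity fun a => ENNReal.ofReal (Real.exp (y * a - y ^ 2 / 2)) := by
  rw [gaussianReal_of_var_ne_zero _ one_ne_zero, gaussianReal_of_var_ne_zero _ one_ne_zero,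
    ← withDensity_mul _ (measurable_gaussianPDF _ _) (by fun_prop)]
  congr 1
  ext a
  simp only [Pi.mul_apply, gaussianPDF, gaussianPDFReal]
  rw [← ENNReal.ofReal_mul (by positivity), mul_assoc (_⁻¹), ← Real.exp_add]
  congr 3
  simp
  ring

lemma map_add_stdGauss (y : Fin m → ℝ) : (stdGauss m).map (fun h => y + h) =
    (stdGauss m).withDensity fun h => ENNReal.ofReal (Real.exp (y ⬝ᵥ h - sqNorm y / 2)) := by
  have h1 : (stdGauss m).map (fun h => y + h) = Measure.pi fun i => gaussianReal (y i) 1 := by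
    have := Measure.pi_map_pi (μ := fun _ : Fin m => gaussianReal 0 1)
      (f := fun i a => y i + a) (fun i => by fun_prop)
    have e : (fun h : Fin m → ℝ => y + h) = fun h i => y i + h i := rfl
    rw [e, stdGauss, this]
    simp only [gaussianReal_map_const_add, zero_add]
  rw [h1]
  refine Measure.pi_eq fun s hs => ?_
  rw [withDensity_apply _ (MeasurableSet.univ_pi hs), stdGauss, Measure.restrict_pi_pi]
  have hint : ∀ i, Integrable (fun a => Real.exp (y i * a - y i ^ 2 / 2))
      ((gaussianReal 0 1).restrict (s i)) := by
    intro i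
    have : Integrable (fun a => Real.exp (y i * a) * Real.exp (-(y i ^ 2 / 2)))
      (gaussianReal 0 1) := (integrable_exp_mul_gaussianReal (y i)).mul_const _
    refine (this.congr (ae_of_all _ fun a => ?_)).restrict
    simp only [← Real.exp_add]
    rfl
  have hprod : ∀ h : Fin m → ℝ, Real.exp (y ⬝ᵥ h - sqNorm y / 2) =
      ∏ i, Real.exp (y i * h i - y i ^ 2 / 2) := by
    intro h
    rw [← Real.exp_sum, Finset.sum_sub_distrib, ← Finset.sum_div]
    rfl
  simp only [hprod]
  rw [← ofReal_integral_eq_lintegral_ofReal (Integrable.fintype_prod hint)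
    (ae_of_all _ fun h => Finset.prod_nonneg fun i _ => (Real.exp_pos _).le),
    integral_fintype_prod_eq_prod (f := fun i a => Real.exp (y i * a - y i ^ 2 / 2)),
    ENNReal.ofReal_prod_of_nonneg
      (fun i _ => integral_nonneg fun a => (Real.exp_pos _).le)]
  refine Finset.prod_congr rfl fun i _ => ?_
  rw [gaussianReal_eq_withDensity (y i), withDensity_apply _ (hs i),
    ofReal_integral_eq_lintegral_ofReal (hint i) (ae_of_all _ fun a => (Real.exp_pos _).le)]

/-- The Cameron--Martin formula for the standard Gaussian vector. -/
lemma integral_add_stdGauss (y : Fin m → ℝ) (f : (Fin m → ℝ) → ℝ) :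
    ∫ h, f (y + h) ∂stdGauss m =
      Real.exp (-(sqNorm y / 2)) * ∫ h, Real.exp (y ⬝ᵥ h) * f h ∂stdGauss m := by
  have h1 : ∫ h, f (y + h) ∂stdGauss m = ∫ h, f h ∂((stdGauss m).map fun h => y + h) :=
    ((MeasurableEquiv.addLeft y).measurableEmbedding.integral_map f).symm
  rw [h1, map_add_stdGauss, integral_withDensity_eq_integral_toReal_smul
    (by
      refine ENNReal.measurable_ofReal.comp (Real.measurable_exp.comp ?_)
      exact Continuous.measurable (by fun_prop))
    (ae_of_all _ fun h => ENNReal.ofReal_lt_top), ← integral_const_mul]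
  refine integral_congr_ae (ae_of_all _ fun h => ?_)
  simp only [smul_eq_mul]
  rw [ENNReal.toReal_ofReal (Real.exp_pos _).le, ← mul_assoc, ← Real.exp_add]
  congr 2
  ring

lemma integrable_exp_mul_of_integrable_add {y : Fin m → ℝ} {f : (Fin m → ℝ) → ℝ}
    (hf : Integrable (fun h => f (y + h)) (stdGauss m)) :
    Integrable (fun h => Real.exp (y ⬝ᵥ h) * f h) (stdGauss m) := by
  have h1 : Integrable f ((stdGauss m).map fun h => y + h) :=
    ((MeasurableEquiv.addLeft y).measurableEmbedding.integrable_map_iff).2 hf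
  rw [map_add_stdGauss, integrable_withDensity_iff_integrable_smul'
    (by
      refine ENNReal.measurable_ofReal.comp (Real.measurable_exp.comp ?_)
      exact Continuous.measurable (by fun_prop))
    (ae_of_all _ fun h => ENNReal.ofReal_lt_top)] at h1
  refine (h1.const_mul (Real.exp (sqNorm y / 2))).congr (ae_of_all _ fun h => ?_)
  simp only [smul_eq_mul]
  rw [ENNReal.toReal_ofReal (Real.exp_pos _).le, ← mul_assoc, ← Real.exp_add]
  congr 2
  ring

/-- The expectation of an invariant function of signal and noise is an average over the orbit of
the signal. -/
lemma card_mul_integral_eq (F : (Fin m → ℝ) → (Fin m → ℝ) → ℝ)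
    (hF : ∀ e s y h, F (sperm e s y) (sperm e s h) = F y h) (y : Fin m → ℝ)
    (hint : Integrable (F y) (stdGauss m)) :
    Integrable (fun h => ∑ e, ∑ s, F (sperm e s y) h) (stdGauss m) ∧
    (Fintype.card (Equiv.Perm (Fin m)) * Fintype.card (Fin m → ℤˣ) : ℝ) *
      ∫ h, F y h ∂stdGauss m = ∫ h, ∑ e, ∑ s, F (sperm e s y) h ∂stdGauss m := by
  have h1 : ∀ e s, Integrable (F (sperm e s y)) (stdGauss m) := by
    intro e s
    rw [← integrable_comp_sperm e s]
    simpa only [hF] using hint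
  have h2 : ∀ e s, ∫ h, F (sperm e s y) h ∂stdGauss m = ∫ h, F y h ∂stdGauss m := by
    intro e s
    rw [← integral_comp_sperm e s]
    simp only [hF]
  refine ⟨integrable_finsetSum _ fun e _ => integrable_finsetSum _ fun s _ => h1 e s, ?_⟩
  rw [integral_finsetSum _ fun e _ => integrable_finsetSum _ fun s _ => h1 e s]
  have : ∀ e : Equiv.Perm (Fin m), ∫ h, ∑ s, F (sperm e s y) h ∂stdGauss m =
      Fintype.card (Fin m → ℤˣ) * ∫ h, F y h ∂stdGauss m := by
    intro e
    rw [integral_finsetSum _ fun s _ => h1 e s]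
    simp [h2]
  simp [this, mul_assoc]

/-- `f` is integrable with expectation `a` under the standard Gaussian law. -/
def HasMean (f : (Fin m → ℝ) → ℝ) (a : ℝ) : Prop :=
  Integrable f (stdGauss m) ∧ ∫ h, f h ∂stdGauss m = a

lemma _root_.MeasureTheory.Integrable.hasMean {f : (Fin m → ℝ) → ℝ}
    (hf : Integrable f (stdGauss m)) : HasMean f (∫ h, f h ∂stdGauss m) := ⟨hf, rfl⟩

namespace HasMean

variable {f g : (Fin m → ℝ) → ℝ} {a b : ℝ}

lemma const (c : ℝ) : HasMean (fun _ : Fin m → ℝ => c) c := ⟨integrable_const c, by simp⟩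

lemma add (hf : HasMean f a) (hg : HasMean g b) : HasMean (fun h => f h + g h) (a + b) :=
  ⟨hf.1.add hg.1, by rw [integral_add hf.1 hg.1, hf.2, hg.2]⟩

lemma sub (hf : HasMean f a) (hg : HasMean g b) : HasMean (fun h => f h - g h) (a - b) :=
  ⟨hf.1.sub hg.1, by rw [integral_sub hf.1 hg.1, hf.2, hg.2]⟩

lemma const_mul (c : ℝ) (hf : HasMean f a) : HasMean (fun h => c * f h) (c * a) :=
  ⟨hf.1.const_mul c, by rw [integral_const_mul, hf.2]⟩

lemma mono (hf : HasMean f a) (hg : HasMean g b) (h : ∀ v, f v ≤ g v) : a ≤ b := by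
  rw [← hf.2, ← hg.2]; exact integral_mono hf.1 hg.1 h

lemma eq (hf : HasMean f a) (hg : HasMean g b) (h : ∀ v, f v = g v) : a = b :=
  le_antisymm (hf.mono hg fun v => (h v).le) (hg.mono hf fun v => (h v).ge)

lemma abs_le (hf : HasMean f a) (hg : HasMean g b) (h : ∀ v, |f v| ≤ g v) : |a| ≤ b :=
  _root_.abs_le.2 ⟨by
    have := (hg.const_mul (-1)).mono hf fun v => by linarith [(_root_.abs_le.1 (h v)).1]
    linarith, hf.mono hg fun v => (_root_.abs_le.1 (h v)).2⟩

end HasMean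

lemma hasMean_sqNorm : HasMean (fun h : Fin m → ℝ => sqNorm h) m :=
  ⟨integrable_sqNorm, integral_sqNorm⟩

/-! ### The scaled risk and the scaled correlation -/

/-- `E ‖η(t x + h; χ) - t x‖²`, the risk at noise level one and signal strength `t = 1 / σ`, without
the normalization by the dimension. The truncation `max χ 0` makes it continuous on all of `ℝ`. -/
def scaledRisk (lam x : Fin m → ℝ) (t χ : ℝ) : ℝ :=
  ∫ h, sqNorm (err lam x t (max χ 0) h) ∂stdGauss m

/-- `E ⟨η(t x + h; χ) - t x, h⟩`, the correlation of the error with the noise, with the same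
conventions as `scaledRisk`. -/
def scaledCorr (lam x : Fin m → ℝ) (t χ : ℝ) : ℝ :=
  ∫ h, h ⬝ᵥ err lam x t (max χ 0) h ∂stdGauss m

/-- The bound for the squared norm of the residuals at `χ = 1`. -/
def resBound (lam : Fin m → ℝ) : ℝ := m * (∑ j, lam j) ^ 2

lemma resBound_nonneg (lam : Fin m → ℝ) : 0 ≤ resBound lam := by unfold resBound; positivity

lemma continuous_err_uncurry (hl : Chamber lam) (x : Fin m → ℝ) :
    Continuous fun q : (ℝ × ℝ) × (Fin m → ℝ) => err lam x q.1.1 (max q.1.2 0) q.2 := by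
  have := (continuous_prox hl).comp
    (f := fun q : (ℝ × ℝ) × (Fin m → ℝ) => (q.1.2, q.1.1 • x + q.2)) (by fun_prop)
  unfold err
  exact this.sub (by fun_prop)

lemma continuous_err (hl : Chamber lam) (x : Fin m → ℝ) (t : ℝ) {χ : ℝ} (hχ : 0 ≤ χ) :
    Continuous (err lam x t χ) := by
  have := (continuous_err_uncurry hl x).comp (f := fun h : Fin m → ℝ => ((t, χ), h)) (by fun_prop)
  simpa only [Function.comp_def, max_eq_left hχ] using this

lemma sqNorm_err_le (hl : Chamber lam) (x : Fin m → ℝ) (t : ℝ) {χ : ℝ} (hχ : 0 ≤ χ)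
    (h : Fin m → ℝ) : sqNorm (err lam x t χ h) ≤ 2 * (χ ^ 2 * resBound lam) + 2 * sqNorm h := by
  have h1 := sqNorm_residual_le hl hχ (t • x + h)
  have h2 := sqNorm_sub_le h (t • x + h - prox (t • x + h) χ lam)
  rw [residual_eq_sub_err] at h1 h2
  rw [sub_sub_cancel] at h2
  unfold resBound
  linarith

lemma continuous_integral_of_bound {g : ℝ × ℝ → (Fin m → ℝ) → ℝ}
    (hg : Continuous fun q : (ℝ × ℝ) × (Fin m → ℝ) => g q.1 q.2) {a : ℝ × ℝ → ℝ}
    (ha : Continuous a) (b : ℝ) (hb : ∀ q h, |g q h| ≤ a q + b * sqNorm h) :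
    Continuous fun q => ∫ h, g q h ∂stdGauss m := by
  refine continuous_iff_continuousAt.2 fun q₀ => ?_
  refine continuousAt_of_dominated (bound := fun h => (a q₀ + 1) + b * sqNorm h)
    (Eventually.of_forall fun q => ?_) ?_ ?_ (ae_of_all _ fun h => ?_)
  · exact (hg.comp (f := fun h : Fin m → ℝ => (q, h)) (by fun_prop)).aestronglyMeasurable
  · have : ∀ᶠ q in 𝓝 q₀, a q < a q₀ + 1 := ha.continuousAt.eventually_lt_const (by linarith)
    filter_upwards [this] with q hq
    refine ae_of_all _ fun h => ?_
    have := hb q h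
    rw [Real.norm_eq_abs]
    linarith
  · exact (integrable_const _).add (integrable_sqNorm.const_mul _)
  · exact (hg.comp (f := fun q : ℝ × ℝ => (q, h)) (by fun_prop)).continuousAt

lemma abs_dotProduct_err_le (hl : Chamber lam) (x : Fin m → ℝ) (t : ℝ) {χ : ℝ} (hχ : 0 ≤ χ)
    (h : Fin m → ℝ) : |h ⬝ᵥ err lam x t χ h| ≤ 2 * (χ ^ 2 * resBound lam) + 2 * sqNorm h := by
  have h1 := two_mul_abs_dotProduct_le h (err lam x t χ h)
  have h2 := sqNorm_err_le hl x t hχ h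
  have h3 := mul_nonneg (sq_nonneg χ) (resBound_nonneg lam)
  have h4 := sqNorm_nonneg h
  linarith

lemma continuous_scaledRisk (hl : Chamber lam) (x : Fin m → ℝ) :
    Continuous fun q : ℝ × ℝ => scaledRisk lam x q.1 q.2 := by
  refine continuous_integral_of_bound (g := fun q h => sqNorm (err lam x q.1 (max q.2 0) h))
    (continuous_sqNorm.comp (continuous_err_uncurry hl x))
    (a := fun q => 2 * ((max q.2 0) ^ 2 * resBound lam)) (by fun_prop) 2 fun q h => ?_
  rw [abs_of_nonneg (sqNorm_nonneg _)]
  exact sqNorm_err_le hl x q.1 (le_max_right _ _) h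

lemma continuous_scaledCorr (hl : Chamber lam) (x : Fin m → ℝ) :
    Continuous fun q : ℝ × ℝ => scaledCorr lam x q.1 q.2 := by
  refine continuous_integral_of_bound (g := fun q h => h ⬝ᵥ err lam x q.1 (max q.2 0) h)
    (continuous_snd.dotProduct (continuous_err_uncurry hl x))
    (a := fun q => 2 * ((max q.2 0) ^ 2 * resBound lam)) (by fun_prop) 2 fun q h => ?_
  exact abs_dotProduct_err_le hl x q.1 (le_max_right _ _) h

lemma scaledRisk_eq (lam x : Fin m → ℝ) (t : ℝ) {χ : ℝ} (hχ : 0 ≤ χ) :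
    scaledRisk lam x t χ = ∫ h, sqNorm (err lam x t χ h) ∂stdGauss m := by
  rw [scaledRisk, max_eq_left hχ]

lemma scaledCorr_eq (lam x : Fin m → ℝ) (t : ℝ) {χ : ℝ} (hχ : 0 ≤ χ) :
    scaledCorr lam x t χ = ∫ h, h ⬝ᵥ err lam x t χ h ∂stdGauss m := by
  rw [scaledCorr, max_eq_left hχ]

lemma integrable_sqNorm_err (hl : Chamber lam) (x : Fin m → ℝ) (t : ℝ) {χ : ℝ} (hχ : 0 ≤ χ) :
    Integrable (fun h => sqNorm (err lam x t χ h)) (stdGauss m) :=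
  integrable_of_abs_le_sqNorm (continuous_sqNorm.comp (continuous_err hl x t hχ))
    (2 * (χ ^ 2 * resBound lam)) 2
    (mul_nonneg zero_le_two (mul_nonneg (sq_nonneg _) (resBound_nonneg lam))) zero_le_two
    fun h => by
      rw [abs_of_nonneg (sqNorm_nonneg _)]; exact sqNorm_err_le hl x t hχ h

lemma integrable_dotProduct_err (hl : Chamber lam) (x : Fin m → ℝ) (t : ℝ) {χ : ℝ} (hχ : 0 ≤ χ) :
    Integrable (fun h => h ⬝ᵥ err lam x t χ h) (stdGauss m) :=
  integrable_of_abs_le_sqNorm (continuous_id.dotProduct (continuous_err hl x t hχ))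
    (2 * (χ ^ 2 * resBound lam)) 2
    (mul_nonneg zero_le_two (mul_nonneg (sq_nonneg _) (resBound_nonneg lam))) zero_le_two fun h =>
      abs_dotProduct_err_le hl x t hχ h

lemma hasMean_sqNorm_err (hl : Chamber lam) (x : Fin m → ℝ) (t : ℝ) {χ : ℝ} (hχ : 0 ≤ χ) :
    HasMean (fun h => sqNorm (err lam x t χ h)) (scaledRisk lam x t χ) :=
  ⟨integrable_sqNorm_err hl x t hχ, (scaledRisk_eq lam x t hχ).symm⟩

lemma hasMean_dotProduct_err (hl : Chamber lam) (x : Fin m → ℝ) (t : ℝ) {χ : ℝ} (hχ : 0 ≤ χ) :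
    HasMean (fun h => h ⬝ᵥ err lam x t χ h) (scaledCorr lam x t χ) :=
  ⟨integrable_dotProduct_err hl x t hχ, (scaledCorr_eq lam x t hχ).symm⟩

lemma scaledRisk_nonneg (lam x : Fin m → ℝ) (t χ : ℝ) : 0 ≤ scaledRisk lam x t χ :=
  integral_nonneg fun _ => sqNorm_nonneg _

lemma scaledRisk_mono (hl : Chamber lam) (x : Fin m → ℝ) (χ : ℝ) {t s : ℝ} (ht : 0 ≤ t)
    (hts : t ≤ s) : scaledRisk lam x t χ ≤ scaledRisk lam x s χ :=
  integral_mono (integrable_sqNorm_err hl x t (le_max_right _ _))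
    (integrable_sqNorm_err hl x s (le_max_right _ _))
    fun h => sqNorm_err_mono hl x (le_max_right _ _) ht hts h

lemma err_zero_right (hl : Chamber lam) (x : Fin m → ℝ) (t : ℝ) (h : Fin m → ℝ) :
    err lam x t 0 h = h := by
  unfold err
  rw [prox_zero_right hl]; abel

lemma scaledRisk_zero_right (hl : Chamber lam) (x : Fin m → ℝ) (t : ℝ) :
    scaledRisk lam x t 0 = m := by
  rw [scaledRisk_eq _ _ _ le_rfl]
  simp only [err_zero_right hl, integral_sqNorm]

lemma prox_eq_err_add (lam x : Fin m → ℝ) (t χ : ℝ) (h : Fin m → ℝ) :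
    prox (t • x + h) χ lam = err lam x t χ h + t • x := by
  unfold err; abel

lemma continuous_prox_shift (hl : Chamber lam) (x : Fin m → ℝ) (t : ℝ) {χ : ℝ} (hχ : 0 ≤ χ) :
    Continuous fun h => prox (t • x + h) χ lam :=
  (continuous_prox_left hl hχ).comp (by fun_prop)

lemma integrable_sqNorm_prox (hl : Chamber lam) (x : Fin m → ℝ) (t : ℝ) {χ : ℝ} (hχ : 0 ≤ χ) :
    Integrable (fun h => sqNorm (prox (t • x + h) χ lam)) (stdGauss m) :=
  integrable_of_abs_le_sqNorm (continuous_sqNorm.comp (continuous_prox_shift hl x t hχ))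
    (2 * sqNorm (t • x)) 2 (mul_nonneg zero_le_two (sqNorm_nonneg _)) zero_le_two fun h => by
      rw [abs_of_nonneg (sqNorm_nonneg _)]
      exact (sqNorm_prox_le hl hχ _).trans (sqNorm_add_le _ _)

lemma integrable_dotProduct_prox (hl : Chamber lam) (x v : Fin m → ℝ) (t : ℝ) {χ : ℝ}
    (hχ : 0 ≤ χ) : Integrable (fun h => v ⬝ᵥ prox (t • x + h) χ lam) (stdGauss m) := by
  refine (((integrable_const (sqNorm v)).add (integrable_sqNorm_prox hl x t hχ))).mono'
    (continuous_const.dotProduct (continuous_prox_shift hl x t hχ)).aestronglyMeasurable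
    (ae_of_all _ fun h => ?_)
  have := two_mul_abs_dotProduct_le v (prox (t • x + h) χ lam)
  rw [Real.norm_eq_abs]
  have := abs_nonneg (v ⬝ᵥ prox (t • x + h) χ lam)
  simp only [Pi.add_apply]
  linarith

lemma integrable_noise_dotProduct_prox (hl : Chamber lam) (x : Fin m → ℝ) (t : ℝ) {χ : ℝ}
    (hχ : 0 ≤ χ) : Integrable (fun h => h ⬝ᵥ prox (t • x + h) χ lam) (stdGauss m) := by
  simp only [prox_eq_err_add, dotProduct_add, dotProduct_comm _ (t • x)]
  exact (integrable_dotProduct_err hl x t hχ).add (integrable_dotProduct_left _)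

lemma scaledCorr_eq_integral_prox (hl : Chamber lam) (x : Fin m → ℝ) (t : ℝ) {χ : ℝ}
    (hχ : 0 ≤ χ) : scaledCorr lam x t χ = ∫ h, h ⬝ᵥ prox (t • x + h) χ lam ∂stdGauss m := by
  rw [scaledCorr_eq _ _ _ hχ]
  simp only [prox_eq_err_add, dotProduct_add, dotProduct_comm _ (t • x)]
  rw [integral_add (integrable_dotProduct_err hl x t hχ) (integrable_dotProduct_left _),
    integral_dotProduct_left, add_zero]

lemma scaledRisk_eq_integral_prox (hl : Chamber lam) (x : Fin m → ℝ) (t : ℝ) {χ : ℝ}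
    (hχ : 0 ≤ χ) : scaledRisk lam x t χ =
      ∫ h, sqNorm (prox (t • x + h) χ lam) ∂stdGauss m -
      2 * t * ∫ h, x ⬝ᵥ prox (t • x + h) χ lam ∂stdGauss m + t ^ 2 * sqNorm x := by
  refine (hasMean_sqNorm_err hl x t hχ).eq
    (((integrable_sqNorm_prox hl x t hχ).hasMean.sub
      ((integrable_dotProduct_prox hl x x t hχ).hasMean.const_mul (2 * t))).add
      (HasMean.const _)) fun h => ?_
  simp only [err, sqNorm_sub, sqNorm_smul, dotProduct_smul, smul_eq_mul, dotProduct_comm _ x]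
  ring

/-- In the absence of a signal, the correlation with the noise exceeds the risk. -/
lemma scaledRisk_lt_scaledCorr_zero_left (hl : Chamber lam) {i : Fin m} (hi : 0 < lam i)
    (x : Fin m → ℝ) {χ : ℝ} (hχ : 0 < χ) (hpos : 0 < scaledRisk lam x 0 χ) :
    scaledRisk lam x 0 χ < scaledCorr lam x 0 χ := by
  have hz : ∀ h, err lam x 0 χ h = prox h χ lam := fun h => by simp [err]
  rw [scaledRisk_eq _ _ _ hχ.le] at hpos ⊢
  rw [scaledCorr_eq _ _ _ hχ.le]
  have i1 := integrable_sqNorm_err hl x 0 hχ.le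
  have i2 := integrable_dotProduct_err hl x 0 hχ.le
  simp only [hz] at *
  have hd : ∀ h, h ⬝ᵥ prox h χ lam - sqNorm (prox h χ lam) =
      χ * sortedL1 lam (prox h χ lam) := fun h => by
    rw [← residual_dotProduct_prox hl hχ.le, sub_dotProduct, sqNorm_eq_dotProduct]
  have hnn : ∀ h, 0 ≤ h ⬝ᵥ prox h χ lam - sqNorm (prox h χ lam) := fun h => by
    rw [hd]; exact mul_nonneg hχ.le (sortedL1_nonneg hl _)
  have hle : 0 ≤ ∫ h, (h ⬝ᵥ prox h χ lam - sqNorm (prox h χ lam)) ∂stdGauss m :=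
    integral_nonneg hnn
  have hsub := integral_sub i2 i1
  rcases hle.eq_or_lt with h0 | h0
  · exfalso
    have hae := (integral_eq_zero_iff_of_nonneg hnn (i2.sub i1)).1 h0.symm
    have : ∫ h, sqNorm (prox h χ lam) ∂stdGauss m = 0 := by
      rw [← integral_zero (Fin m → ℝ) ℝ (μ := stdGauss m)]
      refine integral_congr_ae ?_
      filter_upwards [hae] with h hh
      have hh' : χ * sortedL1 lam (prox h χ lam) = 0 := by rw [← hd]; exact hh
      have hJ : sortedL1 lam (prox h χ lam) = 0 := by
        rcases mul_eq_zero.1 hh' with h | h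
        · exact absurd h hχ.ne'
        · exact h
      have := weight_sq_mul_sqNorm_le hl i (prox h χ lam)
      rw [hJ, zero_pow two_ne_zero, mul_zero] at this
      have h3 : 0 < lam i ^ 2 := by positivity
      have h4 := sqNorm_nonneg (prox h χ lam)
      nlinarith
    linarith
  · linarith

/-- For strong regularization the estimator is close to zero, uniformly on bounded ranges of the
signal strength. -/
lemma exists_bound_large (hl : Chamber lam) {i : Fin m} (hi : 0 < lam i) (x : Fin m → ℝ)
    {T : ℝ} (hT : 0 ≤ T) : ∃ K, 0 ≤ K ∧ ∀ t, 0 ≤ t → t ≤ T → ∀ χ, 1 ≤ χ →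
      |scaledCorr lam x t χ| ≤ K / χ ∧ |scaledRisk lam x t χ - t ^ 2 * sqNorm x| ≤ K / χ := by
  set C : ℝ := m / (16 * lam i ^ 2) with hC
  have hC0 : 0 ≤ C := by positivity
  set I4 : ℝ := ∫ h, sqNorm h ^ 2 ∂stdGauss m with hI4
  have hI40 : 0 ≤ I4 := integral_nonneg fun _ => sq_nonneg _
  set X := sqNorm x with hX
  have hX0 : 0 ≤ X := sqNorm_nonneg x
  set K₀ : ℝ := C * (8 * (T ^ 2 * X) ^ 2 + 8 * I4) with hK₀
  have hK₀0 : 0 ≤ K₀ := by positivity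
  refine ⟨(m + K₀) + (K₀ + T * X + T * K₀), by positivity, fun t ht htT χ hχ1 => ?_⟩
  have hχ : 0 ≤ χ := by linarith
  have hχp : 0 < χ := by linarith
  have hN : ∫ h, sqNorm (prox (t • x + h) χ lam) ∂stdGauss m ≤ K₀ / χ ^ 2 := by
    have hb : ∀ h, sqNorm (prox (t • x + h) χ lam) ≤
        C * (8 * (T ^ 2 * X) ^ 2 + 8 * sqNorm h ^ 2) / χ ^ 2 := by
      intro h
      have h1 := sqNorm_prox_decay hl hχ i (t • x + h)
      have h2 : sqNorm (t • x + h) ≤ 2 * (T ^ 2 * X) + 2 * sqNorm h := by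
        refine (sqNorm_add_le _ _).trans ?_
        rw [sqNorm_smul]
        have : t ^ 2 ≤ T ^ 2 := pow_le_pow_left₀ ht htT 2
        have := mul_le_mul_of_nonneg_right this hX0
        linarith
      have h3 : sqNorm (t • x + h) ^ 2 ≤ 8 * (T ^ 2 * X) ^ 2 + 8 * sqNorm h ^ 2 := by
        refine (pow_le_pow_left₀ (sqNorm_nonneg _) h2 2).trans ?_
        nlinarith [sq_nonneg (T ^ 2 * X - sqNorm h)]
      have h4 : 16 * (χ ^ 2 * lam i ^ 2) * sqNorm (prox (t • x + h) χ lam) ≤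
          m * (8 * (T ^ 2 * X) ^ 2 + 8 * sqNorm h ^ 2) :=
        h1.trans (mul_le_mul_of_nonneg_left h3 (Nat.cast_nonneg m))
      rw [hC, le_div_iff₀ (by positivity), div_mul_eq_mul_div, le_div_iff₀ (by positivity)]
      linarith
    have := (integrable_sqNorm_prox hl x t hχ).hasMean.mono
      (((HasMean.const (8 * (T ^ 2 * X) ^ 2)).add
        (integrable_sqNorm_sq.hasMean.const_mul 8)).const_mul (C / χ ^ 2)) fun h =>
        (hb h).trans (le_of_eq (by ring))
    refine this.trans (le_of_eq ?_)
    rw [hK₀]; ring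
  have hi1 := integrable_sqNorm_prox hl x t hχ
  set N := ∫ h, sqNorm (prox (t • x + h) χ lam) ∂stdGauss m with hNdef
  have hN0 : 0 ≤ N := integral_nonneg fun _ => sqNorm_nonneg _
  have hχN : χ * N ≤ K₀ / χ := by
    have := mul_le_mul_of_nonneg_left hN hχ
    refine this.trans (le_of_eq ?_)
    field_simp
  -- Young's inequality, weighted so that both terms are of order `1 / χ` when `w` is the estimator
  have hab : ∀ v w : Fin m → ℝ, 2 * |v ⬝ᵥ w| ≤ sqNorm v / χ + χ * sqNorm w := by
    intro v w
    have h1 := two_mul_abs_dotProduct_le v (χ • w)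
    rw [dotProduct_smul, smul_eq_mul, abs_mul, abs_of_pos hχp, sqNorm_smul] at h1
    have : χ * (2 * |v ⬝ᵥ w|) ≤ χ * (sqNorm v / χ + χ * sqNorm w) := by
      have e : χ * (sqNorm v / χ + χ * sqNorm w) = sqNorm v + χ ^ 2 * sqNorm w := by
        field_simp
      rw [e]; linarith
    exact le_of_mul_le_mul_left this hχp
  constructor
  · rw [scaledCorr_eq_integral_prox hl x t hχ]
    have h1 := (integrable_noise_dotProduct_prox hl x t hχ).hasMean.abs_le
      ((hasMean_sqNorm.const_mul χ⁻¹).add (hi1.hasMean.const_mul χ)) fun h => by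
        have h1 := hab h (prox (t • x + h) χ lam)
        have h2 := abs_nonneg (h ⬝ᵥ prox (t • x + h) χ lam)
        rw [div_eq_inv_mul] at h1
        linarith
    rw [← div_eq_inv_mul] at h1
    refine h1.trans ((add_le_add_right hχN _).trans ?_)
    rw [← add_div]
    have : 0 ≤ K₀ + T * X + T * K₀ := by positivity
    exact div_le_div_of_nonneg_right (by linarith) hχ
  · rw [scaledRisk_eq_integral_prox hl x t hχ, add_sub_cancel_right]
    have h1 : 2 * |∫ h, x ⬝ᵥ prox (t • x + h) χ lam ∂stdGauss m| ≤ X / χ + χ * N := by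
      have := (integrable_dotProduct_prox hl x x t hχ).hasMean.abs_le
        ((HasMean.const (1 / 2 * (X / χ))).add (hi1.hasMean.const_mul (1 / 2 * χ))) fun h => by
          have := hab x (prox (t • x + h) χ lam)
          linarith
      rw [← hNdef] at this
      linarith
    set P := ∫ h, x ⬝ᵥ prox (t • x + h) χ lam ∂stdGauss m with hP
    have h2 : |N - 2 * t * P| ≤ N + t * (2 * |P|) := by
      refine (abs_sub _ _).trans (le_of_eq ?_)
      rw [abs_of_nonneg hN0, abs_mul, abs_of_nonneg (by positivity)]
      ring
    have h3 : t * (2 * |P|) ≤ T * (X / χ + K₀ / χ) :=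
      mul_le_mul htT (by linarith) (by positivity) hT
    have h4 : N ≤ K₀ / χ := by
      refine hN.trans ?_
      have : χ ≤ χ ^ 2 := by nlinarith
      gcongr
    refine h2.trans ((add_le_add h4 h3).trans ?_)
    rw [← add_div, mul_div_assoc', ← add_div]
    have : (0 : ℝ) ≤ m + K₀ := by positivity
    exact div_le_div_of_nonneg_right (by linarith) hχ

lemma integrable_sortedL1 (hl : Chamber lam) (y : Fin m → ℝ) :
    Integrable (fun h => sortedL1 lam (y + h)) (stdGauss m) := by
  have hc : Continuous fun h => sortedL1 lam (y + h) :=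
    (continuous_sortedL1 hl).comp (by fun_prop)
  refine integrable_of_abs_le_sqNorm hc (1 + resBound lam * (2 * sqNorm y)) (resBound lam * 2)
    ?_ ?_ fun h => ?_
  · have := mul_nonneg (resBound_nonneg lam) (mul_nonneg zero_le_two (sqNorm_nonneg y))
    linarith
  · have := resBound_nonneg lam
    linarith
  · rw [abs_of_nonneg (sortedL1_nonneg hl _)]
    have h1 := sortedL1_sq_le hl (y + h)
    have h2 := mul_le_mul_of_nonneg_left (sqNorm_add_le y h) (resBound_nonneg lam)
    unfold resBound at *
    nlinarith [sq_nonneg (sortedL1 lam (y + h) - 1), sortedL1_nonneg hl (y + h)]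

/-- The gain in risk over the unregularized estimator is at least of first order in `χ`, with a
coefficient that compares the norm of the noisy signal with that of the signal. -/
lemma card_sub_scaledRisk_ge (hl : Chamber lam) (x : Fin m → ℝ) {t χ : ℝ} (ht : 0 ≤ t)
    (hχ : 0 ≤ χ) :
    2 * χ * (∫ h, sortedL1 lam (t • x + h) ∂stdGauss m - t * sortedL1 lam x -
      χ * resBound lam) ≤ m - scaledRisk lam x t χ := by
  exact ((((integrable_sortedL1 hl (t • x)).hasMean.sub (HasMean.const _)).sub
    (HasMean.const _)).const_mul (2 * χ)).mono
    (hasMean_sqNorm.sub (hasMean_sqNorm_err hl x t hχ)) fun h =>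
      sqNorm_sub_sqNorm_err_ge hl x hχ ht h

lemma card_sub_scaledCorr_le (hl : Chamber lam) (x : Fin m → ℝ) (t : ℝ) {χ : ℝ}
    (hχ : 0 < χ) : m - scaledCorr lam x t χ ≤ χ * (m + resBound lam) := by
  have hb : ∀ h, sqNorm h - h ⬝ᵥ err lam x t χ h ≤ χ * (sqNorm h + resBound lam) := by
    intro h
    have h1 := sqNorm_residual_le hl hχ.le (t • x + h)
    rw [residual_eq_sub_err] at h1
    have h2 := two_mul_dotProduct_le (χ • h) (h - err lam x t χ h)
    rw [smul_dotProduct, smul_eq_mul, sqNorm_smul, dotProduct_sub, ← sqNorm_eq_dotProduct] at h2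
    have h3 := sqNorm_nonneg h
    have h4 : χ * (2 * (sqNorm h - h ⬝ᵥ err lam x t χ h)) ≤
        χ * (χ * (sqNorm h + resBound lam)) := by
      unfold resBound; linarith
    have h5 := le_of_mul_le_mul_left h4 hχ
    have := mul_nonneg hχ.le (add_nonneg h3 (resBound_nonneg lam))
    linarith
  exact (hasMean_sqNorm.sub (hasMean_dotProduct_err hl x t hχ.le)).mono
    ((hasMean_sqNorm.add (HasMean.const _)).const_mul χ) hb

/-- Monotonicity of the subdifferential of the sorted norm, integrated over the noise, at two pairs
of parameters. -/
lemma scaled_monotonicity (hl : Chamber lam) (x : Fin m → ℝ) {t₁ t₂ χ₁ χ₂ : ℝ} (ht₁ : 0 ≤ t₁)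
    (ht₂ : 0 ≤ t₂) (hχ₁ : 0 ≤ χ₁) (hχ₂ : 0 ≤ χ₂) :
    χ₂ * t₁ * (scaledCorr lam x t₂ χ₂ - (scaledRisk lam x t₁ χ₁ + scaledRisk lam x t₂ χ₂) / 2) +
      χ₁ * t₂ * (scaledCorr lam x t₁ χ₁ - (scaledRisk lam x t₁ χ₁ + scaledRisk lam x t₂ χ₂) / 2) ≤
    χ₁ * t₁ * (scaledCorr lam x t₂ χ₂ - scaledRisk lam x t₂ χ₂) +
      χ₂ * t₂ * (scaledCorr lam x t₁ χ₁ - scaledRisk lam x t₁ χ₁) := by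
  have r1 := hasMean_sqNorm_err hl x t₁ hχ₁
  have r2 := hasMean_sqNorm_err hl x t₂ hχ₂
  have c1 := hasMean_dotProduct_err hl x t₁ hχ₁
  have c2 := hasMean_dotProduct_err hl x t₂ hχ₂
  have r12 := (r1.add r2).const_mul (1 / 2)
  have key := (((c2.sub r12).const_mul (χ₂ * t₁)).add ((c1.sub r12).const_mul (χ₁ * t₂))).mono
    (((c2.sub r2).const_mul (χ₁ * t₁)).add ((c1.sub r1).const_mul (χ₂ * t₂))) fun h => by
      -- each normalized residual maximizes the pairing with its own estimator over the dual ball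
      have a1 := residual_dotProduct_le hl hχ₁ (t₁ • x + h) (prox (t₂ • x + h) χ₂ lam)
      have a2 := residual_dotProduct_prox hl hχ₂ (t₂ • x + h)
      have b1 := residual_dotProduct_le hl hχ₂ (t₂ • x + h) (prox (t₁ • x + h) χ₁ lam)
      have b2 := residual_dotProduct_prox hl hχ₁ (t₁ • x + h)
      have a3 := mul_le_mul_of_nonneg_left a1 hχ₂
      have b3 := mul_le_mul_of_nonneg_left b1 hχ₁
      have a4 := congrArg (fun r => χ₁ * r) a2
      have b4 := congrArg (fun r => χ₂ * r) b2
      simp only [residual_eq_sub_err] at a3 b3 a4 b4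
      rw [prox_eq_err_add] at a3 b3 a4 b4
      set J1 := sortedL1 lam (err lam x t₁ χ₁ h + t₁ • x)
      set J2 := sortedL1 lam (err lam x t₂ χ₂ h + t₂ • x)
      have hW := two_mul_dotProduct_le (err lam x t₁ χ₁ h) (err lam x t₂ χ₂ h)
      set W1 := err lam x t₁ χ₁ h
      set W2 := err lam x t₂ χ₂ h
      have a5 : χ₂ * ((h - W1) ⬝ᵥ (W2 + t₂ • x)) ≤ χ₁ * ((h - W2) ⬝ᵥ (W2 + t₂ • x)) := by linarith
      have b5 : χ₁ * ((h - W2) ⬝ᵥ (W1 + t₁ • x)) ≤ χ₂ * ((h - W1) ⬝ᵥ (W1 + t₁ • x)) := by linarith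
      have a6 := mul_le_mul_of_nonneg_left a5 ht₁
      have b6 := mul_le_mul_of_nonneg_left b5 ht₂
      rw [sqNorm_eq_dotProduct, sqNorm_eq_dotProduct] at *
      simp only [sub_dotProduct, dotProduct_add, dotProduct_smul, smul_eq_mul,
        dotProduct_comm W2 W1] at a6 b6
      have h7 := mul_le_mul_of_nonneg_left hW (mul_nonneg hχ₂ ht₁)
      have h8 := mul_le_mul_of_nonneg_left hW (mul_nonneg hχ₁ ht₂)
      linarith
  linarith

lemma HasMean.pos {f : (Fin m → ℝ) → ℝ} {a : ℝ} (hf : HasMean f a) (hc : Continuous f)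
    (h0 : ∀ v, 0 ≤ f v) {v : Fin m → ℝ} (hv : f v ≠ 0) : 0 < a := by
  rw [← hf.2]
  refine (integral_nonneg h0).lt_of_ne' fun h => hv ?_
  have := (integral_eq_zero_iff_of_nonneg h0 hf.1).1 h
  exact congrFun ((hc.ae_eq_iff_eq (stdGauss m) continuous_const).1 this) v

lemma HasMean.comp_neg {f : (Fin m → ℝ) → ℝ} {a : ℝ} (hf : HasMean f a) :
    HasMean (fun h => f (-h)) a := by
  have h : ∀ v : Fin m → ℝ, sperm 1 (fun _ => -1) v = -v := fun v => by ext i; simp [sperm]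
  refine ⟨?_, by rw [integral_neg_comp, hf.2]⟩
  have := (integrable_comp_sperm 1 (fun _ => -1) f).2 hf.1
  simpa only [h] using this

/-! ### Neither vanishing nor infinite regularization is optimal -/

/-- Strict Jensen inequality for the sorted norm of the noisy signal. -/
lemma mul_sortedL1_lt_integral (hl : Chamber lam) {i : Fin m} (hi : 0 < lam i) (x : Fin m → ℝ)
    {t : ℝ} (ht : 0 ≤ t) :
    t * sortedL1 lam x < ∫ h, sortedL1 lam (t • x + h) ∂stdGauss m := by
  have hm := (integrable_sortedL1 hl (t • x)).hasMean
  have hJ := continuous_sortedL1 hl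
  have hx : sortedL1 lam (t • x) = t * sortedL1 lam x := by
    rw [sortedL1_smul hl, abs_of_nonneg ht]
  have e2 : ∀ v : Fin m → ℝ, sortedL1 lam ((2 : ℝ) • v) = 2 * sortedL1 lam v := fun v => by
    rw [sortedL1_smul hl, abs_of_pos two_pos]
  have h1 : ∀ h : Fin m → ℝ, 2 * (t * sortedL1 lam x) ≤
      sortedL1 lam (t • x + h) + sortedL1 lam (t • x + -h) := fun h => by
    rw [← hx, ← e2]
    refine le_trans (le_of_eq ?_) (sortedL1_add_le hl _ _)
    congr 1
    rw [two_smul]; abel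
  have h2 : ∀ h : Fin m → ℝ, 2 * sortedL1 lam h ≤
      sortedL1 lam (t • x + h) + sortedL1 lam (t • x + -h) := fun h => by
    rw [← sortedL1_neg hl (t • x + -h), ← e2]
    refine le_trans (le_of_eq ?_) (sortedL1_add_le hl _ _)
    congr 1
    rw [two_smul]; abel
  -- the symmetrized inequality `h1` is strict at a large multiple of a basis vector, by `h2`
  have hpos := ((hm.add hm.comp_neg).sub (HasMean.const (2 * (t * sortedL1 lam x)))).pos
    (by fun_prop) (fun v => sub_nonneg.2 (h1 v))
    (v := Pi.single i ((t * sortedL1 lam x + 1) / lam i)) (by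
      have a := h2 (Pi.single i ((t * sortedL1 lam x + 1) / lam i))
      have b := mul_abs_le_sortedL1 hl (Pi.single i ((t * sortedL1 lam x + 1) / lam i)) i i
      have c := (mul_nonneg ht (sortedL1_nonneg hl x))
      rw [Pi.single_eq_same, abs_of_nonneg (by positivity), mul_div_cancel₀ _ hi.ne'] at b
      linarith)
  linarith

lemma exists_scaledRisk_lt_card (hl : Chamber lam) {i : Fin m} (hi : 0 < lam i) (x : Fin m → ℝ)
    {t : ℝ} (ht : 0 ≤ t) : ∃ χ, 0 < χ ∧ scaledRisk lam x t χ < m := by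
  set g := ∫ h, sortedL1 lam (t • x + h) ∂stdGauss m - t * sortedL1 lam x with hg
  have hg0 : 0 < g := sub_pos.2 (mul_sortedL1_lt_integral hl hi x ht)
  have hL := resBound_nonneg lam
  have h1 : 0 < g / (resBound lam + 1) := by positivity
  refine ⟨g / (resBound lam + 1), h1, ?_⟩
  have h2 := card_sub_scaledRisk_ge hl x ht h1.le
  rw [← hg] at h2
  have h3 : 0 < g - g / (resBound lam + 1) * resBound lam := by
    rw [div_mul_eq_mul_div, sub_pos, div_lt_iff₀ (by linarith)]
    linarith
  have h4 := mul_pos (mul_pos two_pos h1) h3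
  linarith

/-- The signed permutation aligning a large entry of `y` with a large entry of `h`. -/
lemma exists_sperm_dotProduct_ge (y h : Fin m → ℝ) (i j : Fin m) :
    ∃ e s, |y i| * |h j| ≤ sperm e s y ⬝ᵥ h := by
  choose σ hσ using fun a : ℝ => exists_sign a
  refine ⟨Equiv.swap j i, fun l => σ (y (Equiv.swap j i l)) * σ (h l), ?_⟩
  have : ∀ l, sperm (Equiv.swap j i) (fun l => σ (y (Equiv.swap j i l)) * σ (h l)) y l * h l =
      |y (Equiv.swap j i l)| * |h l| := by
    intro l
    rw [← hσ (y (Equiv.swap j i l)), ← hσ (h l)]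
    simp only [sperm, Units.val_mul, Int.cast_mul]
    ring
  simp only [dotProduct, this]
  have := Finset.single_le_sum (f := fun l => |y (Equiv.swap j i l)| * |h l|)
    (fun l _ => mul_nonneg (abs_nonneg _) (abs_nonneg _)) (Finset.mem_univ j)
  simpa using this

/-- For strong regularization the energy of the estimator in the presence of a signal is
exponentially larger than its energy under pure noise. -/
lemma exp_mul_integral_prox_le (hl : Chamber lam) {i : Fin m} (hi : 0 < lam i) (y : Fin m → ℝ)
    (j : Fin m) {χ : ℝ} (hχ : 0 ≤ χ) :
    Real.exp (-(sqNorm y / 2)) * (Real.exp (|y j| * (χ * lam i / m)) *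
      ∫ h, sqNorm (prox h χ lam) ∂stdGauss m) ≤
    (Fintype.card (Equiv.Perm (Fin m)) * Fintype.card (Fin m → ℤˣ) : ℝ) *
      ∫ h, sqNorm (prox (y + h) χ lam) ∂stdGauss m := by
  have hm : (0 : ℝ) < m := by
    have : 0 < m := i.pos
    exact_mod_cast this
  have hint : Integrable (fun h => sqNorm (prox (y + h) χ lam)) (stdGauss m) := by
    simpa using integrable_sqNorm_prox hl y 1 hχ
  have hint0 : Integrable (fun h => sqNorm (prox h χ lam)) (stdGauss m) := by
    simpa using integrable_sqNorm_prox hl y 0 hχ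
  have h1 := integrable_exp_mul_of_integrable_add (y := y)
    (f := fun h => sqNorm (prox h χ lam)) hint
  obtain ⟨h2, h3⟩ := card_mul_integral_eq
    (fun y h => Real.exp (y ⬝ᵥ h) * sqNorm (prox h χ lam))
    (fun e s y h => by simp only [sperm_dotProduct, prox_sperm hl hχ, sqNorm_sperm]) y h1
  rw [integral_add_stdGauss y (fun h => sqNorm (prox h χ lam)), mul_left_comm (_ * _ : ℝ), h3]
  refine mul_le_mul_of_nonneg_left ?_ (Real.exp_pos _).le
  refine (hint0.hasMean.const_mul _).mono h2.hasMean fun h => ?_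
  by_cases hz : prox h χ lam = 0
  · simp [hz, sqNorm_eq_zero.2]
  · obtain ⟨l, hlh⟩ : ∃ l, χ * lam i / m < |h l| := by
      by_contra! hcon
      exact hz (prox_eq_zero_of_abs_le hl hχ hi hcon (by rw [mul_div_cancel₀ _ hm.ne']))
    obtain ⟨e, s, hes⟩ := exists_sperm_dotProduct_ge y h j l
    have h5 : Real.exp (|y j| * (χ * lam i / m)) ≤ Real.exp (sperm e s y ⬝ᵥ h) :=
      Real.exp_le_exp.2 (le_trans (mul_le_mul_of_nonneg_left hlh.le (abs_nonneg _)) hes)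
    have hnn : ∀ e s, 0 ≤ Real.exp (sperm e s y ⬝ᵥ h) * sqNorm (prox h χ lam) := fun e s =>
      mul_nonneg (Real.exp_pos _).le (sqNorm_nonneg _)
    refine (mul_le_mul_of_nonneg_right h5 (sqNorm_nonneg _)).trans ?_
    refine (Finset.single_le_sum (f := fun s =>
      Real.exp (sperm e s y ⬝ᵥ h) * sqNorm (prox h χ lam)) (fun s _ => hnn e s)
      (Finset.mem_univ s)).trans ?_
    exact Finset.single_le_sum (f := fun e => ∑ s,
      Real.exp (sperm e s y ⬝ᵥ h) * sqNorm (prox h χ lam))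
      (fun e _ => Finset.sum_nonneg fun s _ => hnn e s) (Finset.mem_univ e)

/-- Some finite `χ` beats the zero estimator. Otherwise firm nonexpansiveness would bound the energy
of the estimator by its energy under pure noise, contradicting `exp_mul_integral_prox_le`. -/
lemma exists_scaledRisk_lt_sqNorm (hl : Chamber lam) {i : Fin m} (hi : 0 < lam i)
    {x : Fin m → ℝ} (hx : x ≠ 0) {t : ℝ} (ht : 0 < t) :
    ∃ χ, 0 < χ ∧ scaledRisk lam x t χ < t ^ 2 * sqNorm x := by
  by_contra! hcon
  obtain ⟨j, hj⟩ : ∃ j, x j ≠ 0 := by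
    by_contra! h; exact hx (funext h)
  have hm : (0 : ℝ) < m := by
    have : 0 < m := i.pos
    exact_mod_cast this
  set c : ℝ := (Fintype.card (Equiv.Perm (Fin m)) * Fintype.card (Fin m → ℤˣ) : ℝ) with hc
  have hc0 : 0 ≤ c := by positivity
  have hbound : ∀ χ, 0 < χ →
      Real.exp (-(sqNorm (t • x) / 2)) * Real.exp (|(t • x) j| * (χ * lam i / m)) ≤ 12 * c := by
    intro χ hχ
    have hN := (integrable_sqNorm_prox hl x t hχ.le).hasMean
    have hP := (integrable_dotProduct_prox hl x x t hχ.le).hasMean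
    have hP0 := (integrable_dotProduct_prox hl x x 0 hχ.le).hasMean
    have hN0 := (integrable_sqNorm_prox hl x 0 hχ.le).hasMean
    simp only [zero_smul, zero_add] at hP0 hN0
    set N := ∫ h, sqNorm (prox (t • x + h) χ lam) ∂stdGauss m
    set N₀ := ∫ h, sqNorm (prox h χ lam) ∂stdGauss m with hN₀
    set P := ∫ h, x ⬝ᵥ prox (t • x + h) χ lam ∂stdGauss m
    -- by oddness of the estimator
    have hz : ∫ h, x ⬝ᵥ prox h χ lam ∂stdGauss m = 0 := by
      have := (hP0.comp_neg).eq (hP0.const_mul (-1)) fun h => by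
        rw [prox_neg hl hχ.le, dotProduct_neg]; ring
      linarith
    rw [hz] at hP0
    -- firm nonexpansiveness at `t x + h` and `h`, with a cross term of at most `N / 3 + 3 N₀`; as
    -- the negation of the claim says `2 t P ≤ N`, this leads to `N ≤ 12 N₀`
    have h1 : N ≤ 3 / 2 * (t * (P - 0)) + 3 * N₀ := by
      refine hN.mono (((((hP.sub hP0).const_mul t)).const_mul (3 / 2)).add (hN0.const_mul 3))
        fun h => ?_
      have a := sqNorm_prox_sub_le hl hχ.le (t • x + h) h
      rw [add_sub_cancel_right, dotProduct_smul, smul_eq_mul, dotProduct_comm,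
        dotProduct_sub] at a
      have b := sqNorm_nonneg (prox (t • x + h) χ lam - (3 : ℝ) • prox h χ lam)
      rw [sqNorm_sub, dotProduct_smul, sqNorm_smul, smul_eq_mul] at b
      rw [sqNorm_sub] at a
      nlinarith
    have h2 := hcon χ hχ
    rw [scaledRisk_eq_integral_prox hl x t hχ.le] at h2
    have h3 : N ≤ 12 * N₀ := by linarith
    have h4 : 0 < N₀ := by
      refine hN0.pos (continuous_sqNorm.comp (continuous_prox_left hl hχ.le))
        (fun v => sqNorm_nonneg _) (v := Pi.single i (χ * ∑ l, lam l + 1)) ?_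
      intro h
      have h5 := abs_residual_le hl hχ.le (Pi.single i (χ * ∑ l, lam l + 1)) i
      rw [sqNorm_eq_zero.1 h, sub_zero, Pi.single_eq_same] at h5
      linarith [le_abs_self (χ * ∑ l, lam l + 1)]
    have h5 := exp_mul_integral_prox_le hl hi (t • x) j hχ.le
    rw [← hc, ← mul_assoc] at h5
    have h6 := mul_le_mul_of_nonneg_left h3 hc0
    refine le_of_mul_le_mul_right ?_ h4
    linarith
  have hjt : 0 < |(t • x) j| := abs_pos.2 (mul_ne_zero ht.ne' hj)
  have htend : Tendsto (fun χ : ℝ => Real.exp (-(sqNorm (t • x) / 2)) *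
      Real.exp (|(t • x) j| * (χ * lam i / m))) atTop atTop := by
    refine Tendsto.const_mul_atTop (Real.exp_pos _) (Real.tendsto_exp_atTop.comp ?_)
    refine Tendsto.const_mul_atTop hjt (Tendsto.atTop_div_const hm ?_)
    exact tendsto_id.atTop_mul_const hi
  obtain ⟨χ, h1, h2⟩ := ((htend.eventually_gt_atTop (12 * c)).and (eventually_gt_atTop 0)).exists
  exact absurd (hbound χ h2) (not_le.2 h1)

/-! ### The first order condition at an optimal threshold -/

lemma integrable_dotProduct_residual (hl : Chamber lam) (v y : Fin m → ℝ) (s : ℝ) {χ : ℝ}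
    (hχ : 0 ≤ χ) :
    Integrable (fun h => v ⬝ᵥ (s • (y + h) - prox (s • (y + h)) χ lam)) (stdGauss m) := by
  have hc : Continuous fun h => prox (s • (y + h)) χ lam :=
    (continuous_prox_left hl hχ).comp (by fun_prop)
  refine integrable_of_abs_le_sqNorm (continuous_const.dotProduct (by fun_prop))
    (sqNorm v + χ ^ 2 * resBound lam) 0 ?_ le_rfl fun h => ?_
  · have := mul_nonneg (sq_nonneg χ) (resBound_nonneg lam)
    linarith [sqNorm_nonneg v]
  · have h1 := two_mul_abs_dotProduct_le v (s • (y + h) - prox (s • (y + h)) χ lam)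
    have h2 := sqNorm_residual_le hl hχ (s • (y + h))
    have h3 := abs_nonneg (v ⬝ᵥ (s • (y + h) - prox (s • (y + h)) χ lam))
    unfold resBound
    linarith

/-- Scaling up the observation increases the mean correlation of the residual with the signal. -/
lemma integral_residual_scale_nonneg (hl : Chamber lam) (y : Fin m → ℝ) {s χ : ℝ} (hs : 1 ≤ s)
    (hχ : 0 ≤ χ) :
    0 ≤ ∫ h, y ⬝ᵥ ((s • (y + h) - prox (s • (y + h)) χ lam) -
      ((y + h) - prox (y + h) χ lam)) ∂stdGauss m := by
  have hint : Integrable (fun h => y ⬝ᵥ ((s • (y + h) - prox (s • (y + h)) χ lam) -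
      ((y + h) - prox (y + h) χ lam))) (stdGauss m) := by
    have h1 := integrable_dotProduct_residual hl y y s hχ
    have h2 := integrable_dotProduct_residual hl y y 1 hχ
    simp only [one_smul] at h2
    simp only [dotProduct_sub y (_ - _)]
    exact h1.sub h2
  have h1 := integrable_exp_mul_of_integrable_add (y := y) (f := fun h =>
    y ⬝ᵥ ((s • h - prox (s • h) χ lam) - (h - prox h χ lam))) hint
  obtain ⟨-, h3⟩ := card_mul_integral_eq (fun y h => Real.exp (y ⬝ᵥ h) *
    (y ⬝ᵥ ((s • h - prox (s • h) χ lam) - (h - prox h χ lam))))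
    (fun e σ y h => by
      simp only [← sperm_smul, prox_sperm hl hχ, ← sperm_sub, sperm_dotProduct]) y h1
  have h4 := integral_add_stdGauss y (fun h =>
    y ⬝ᵥ ((s • h - prox (s • h) χ lam) - (h - prox h χ lam)))
  rw [h4]
  refine mul_nonneg (Real.exp_pos _).le ?_
  simp only [← orbitMean_dotProduct] at h3
  have h5 : 0 ≤ ∫ h, orbitMean y h ⬝ᵥ ((s • h - prox (s • h) χ lam) - (h - prox h χ lam))
      ∂stdGauss m :=
    integral_nonneg fun h => orbitMean_dotProduct_residual_mono hl hχ y h hs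
  rw [← h3] at h5
  exact nonneg_of_mul_nonneg_right h5 (by positivity)

lemma integrable_err_dotProduct_err (hl : Chamber lam) (x : Fin m → ℝ) (t : ℝ) {χ χ' : ℝ}
    (hχ : 0 ≤ χ) (hχ' : 0 ≤ χ') :
    Integrable (fun h => err lam x t χ h ⬝ᵥ err lam x t χ' h) (stdGauss m) := by
  refine ((integrable_sqNorm_err hl x t hχ).add (integrable_sqNorm_err hl x t hχ')).mono'
    ((continuous_err hl x t hχ).dotProduct (continuous_err hl x t hχ')).aestronglyMeasurable
    (ae_of_all _ fun h => ?_)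
  have h1 := two_mul_abs_dotProduct_le (err lam x t χ h) (err lam x t χ' h)
  have h2 := abs_nonneg (err lam x t χ h ⬝ᵥ err lam x t χ' h)
  rw [Real.norm_eq_abs]
  simp only [Pi.add_apply]
  linarith

lemma integrable_noise_dotProduct_err (hl : Chamber lam) (x : Fin m → ℝ) (t : ℝ) {χ : ℝ}
    (hχ : 0 ≤ χ) : Integrable (fun h => err lam x t χ h ⬝ᵥ h) (stdGauss m) := by
  simpa only [dotProduct_comm] using integrable_dotProduct_err hl x t hχ

/-- First order condition for increasing `χ`: if no larger threshold has a smaller risk, then the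
correlation of the error with the noise is at most the risk. -/
lemma scaledCorr_le_scaledRisk (hl : Chamber lam) (x : Fin m → ℝ) {t χ : ℝ}
    (hχ : 0 < χ) (hmin : ∀ χ', χ < χ' → scaledRisk lam x t χ ≤ scaledRisk lam x t χ') :
    scaledCorr lam x t χ ≤ scaledRisk lam x t χ := by
  have key : ∀ ε : ℝ, 0 < ε → scaledCorr lam x t χ - scaledRisk lam x t χ ≤
      ε * (resBound lam + χ ^ 2 * resBound lam) := by
    intro ε hε
    set χ' := χ + ε with hχ'def
    have hχχ' : χ < χ' := by linarith
    have hχ' : 0 ≤ χ' := by linarith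
    set s := χ' / χ with hs
    have hs1 : 1 < s := (one_lt_div hχ).2 hχχ'
    have hsχ : s * χ = χ' := div_mul_cancel₀ _ hχ.ne'
    have hscale := integral_residual_scale_nonneg hl (t • x) hs1.le hχ'
    have r := hasMean_sqNorm_err hl x t hχ.le
    have r' := hasMean_sqNorm_err hl x t hχ'
    have c := hasMean_dotProduct_err hl x t hχ.le
    have w := (integrable_err_dotProduct_err hl x t hχ' hχ.le).hasMean
    have n := (integrable_noise_dotProduct_err hl x t hχ').hasMean
    set b := ∫ h, err lam x t χ' h ⬝ᵥ err lam x t χ h ∂stdGauss m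
    set d := ∫ h, err lam x t χ' h ⬝ᵥ h ∂stdGauss m
    have hD : Integrable (fun h => (t • x) ⬝ᵥ ((s • (t • x + h) - prox (s • (t • x + h)) χ' lam) -
        ((t • x + h) - prox (t • x + h) χ' lam))) (stdGauss m) := by
      have h1 := integrable_dotProduct_residual hl (t • x) (t • x) s hχ'
      have h2 := integrable_dotProduct_residual hl (t • x) (t • x) 1 hχ'
      simp only [one_smul] at h2
      simp only [dotProduct_sub (t • x) (_ - _)]
      exact h1.sub h2
    -- minimality at `χ`, by convexity of the square
    have hb1 : b - scaledRisk lam x t χ' ≤ 0 := by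
      have := hmin χ' hχχ'
      have h2 := ((r'.add (((w.sub r').const_mul 2)))).mono r fun h => by
        have a := sqNorm_nonneg (err lam x t χ h - err lam x t χ' h)
        rw [sqNorm_sub, dotProduct_comm] at a
        linarith
      linarith
    -- `s • prox (t x + h) χ` is the estimator at `χ'` for the scaled observation
    have hb2 : s * (d - b) - (d - scaledRisk lam x t χ') ≤ 0 := by
      have h2 := (((n.sub w).const_mul s).sub (n.sub r')).mono (hD.hasMean.const_mul (-1))
        fun h => by
          have a1 := residual_dotProduct_le hl hχ.le (t • x + h) (prox (t • x + h) χ' lam)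
          have a2 := residual_dotProduct_prox hl hχ' (t • x + h)
          have a3 := mul_le_mul_of_nonneg_left a1 (by linarith : 0 ≤ s)
          rw [← mul_assoc, hsχ, ← a2] at a3
          rw [← hsχ, prox_smul_smul hl hχ.le (by linarith), hsχ, ← smul_sub]
          rw [residual_eq_sub_err, residual_eq_sub_err] at a3 ⊢
          rw [prox_eq_err_add] at a3
          simp only [dotProduct_add, dotProduct_sub, sub_dotProduct, dotProduct_smul,
            smul_dotProduct, smul_eq_mul, sqNorm_eq_dotProduct] at a3 ⊢
          rw [dotProduct_comm h, dotProduct_comm h x, dotProduct_comm (err lam x t χ h),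
            dotProduct_comm (err lam x t χ h) x, dotProduct_comm (err lam x t χ' h) x] at a3
          linarith
      linarith
    have hb3 : d - b ≤ 0 := by
      have : (s - 1) * (d - b) ≤ 0 := by linarith
      exact nonpos_of_mul_nonpos_right this (by linarith)
    -- replacing the error at `χ'` by the one at `χ` costs `O(ε)`
    have h4 : (scaledCorr lam x t χ - scaledRisk lam x t χ) ≤
        (d - b) + ε * (resBound lam + χ ^ 2 * resBound lam) := by
      refine (c.sub r).mono ((n.sub w).add (HasMean.const _)) fun h => ?_
      have a1 := sqNorm_prox_sub_prox_le hl hχ.le hχ' (t • x + h)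
      have a2 := sqNorm_residual_le hl hχ.le (t • x + h)
      rw [residual_eq_sub_err] at a2
      rw [prox_eq_err_add, prox_eq_err_add, add_sub_add_right_eq_sub,
        show (χ - χ') ^ 2 = ε ^ 2 by rw [hχ'def]; ring] at a1
      have a3 := two_mul_dotProduct_le (err lam x t χ h - err lam x t χ' h)
        (ε • (h - err lam x t χ h))
      rw [dotProduct_smul, sqNorm_smul, smul_eq_mul] at a3
      have a4 := mul_le_mul_of_nonneg_left a2 (sq_nonneg ε)
      have a5 : ε * (2 * ((err lam x t χ h - err lam x t χ' h) ⬝ᵥ (h - err lam x t χ h))) ≤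
          ε * (ε * (resBound lam + χ ^ 2 * resBound lam)) := by
        unfold resBound; linarith
      have a6 := le_of_mul_le_mul_left a5 hε
      have a7 : 0 ≤ ε * (resBound lam + χ ^ 2 * resBound lam) := by
        have := resBound_nonneg lam
        positivity
      simp only [dotProduct_sub, sub_dotProduct] at a6
      rw [sqNorm_eq_dotProduct, dotProduct_comm h]
      linarith
    linarith
  by_contra! hcon
  set C := resBound lam + χ ^ 2 * resBound lam with hC
  have hC0 : 0 ≤ C := by
    have := resBound_nonneg lam
    positivity
  set g := scaledCorr lam x t χ - scaledRisk lam x t χ with hg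
  have hg0 : 0 < g := sub_pos.2 hcon
  have h1 := key (g / (C + 1)) (by positivity)
  have h2 : g / (C + 1) * C < g := by
    rw [div_mul_eq_mul_div, div_lt_iff₀ (by linarith)]; linarith
  linarith

/-! ### Strong signals: splitting off the support -/

/-- The set of the first `k` coordinates. -/
abbrev headSet (m k : ℕ) : Finset (Fin m) := Finset.univ.filter fun i : Fin m => (i : ℕ) < k

/-- The embedding of the last `m - k` coordinates. -/
def tailEmb (m k : ℕ) : Fin (m - k) ↪ Fin m :=
  ⟨fun j => ⟨k + j, by omega⟩, fun a b h => by
    have := congrArg Fin.val h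
    simp only at this
    exact Fin.ext (by omega)⟩

lemma tailEmb_val (k : ℕ) (j : Fin (m - k)) : (tailEmb m k j : ℕ) = k + j := rfl

lemma not_mem_range_tailEmb {k : ℕ} {i : Fin m} (hi : (i : ℕ) < k) :
    i ∉ Set.range (tailEmb m k) := by
  rintro ⟨j, rfl⟩
  rw [tailEmb_val] at hi; omega

lemma exists_tailEmb_eq {k : ℕ} {i : Fin m} (hi : ¬ (i : ℕ) < k) : ∃ j, tailEmb m k j = i :=
  ⟨⟨i - k, by omega⟩, Fin.ext (by rw [tailEmb_val]; simp only; omega)⟩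

lemma sum_eq_head_add_tail (k : ℕ) (f : Fin m → ℝ) :
    ∑ i, f i = ∑ i ∈ headSet m k, f i + ∑ j, f (tailEmb m k j) := by
  rw [← Finset.sum_filter_add_sum_filter_not Finset.univ (fun i : Fin m => (i : ℕ) < k)]
  congr 1
  rw [← Finset.sum_map Finset.univ (tailEmb m k) f]
  refine Finset.sum_congr ?_ fun _ _ => rfl
  ext i
  simp only [Finset.mem_filter, Finset.mem_univ, true_and, Finset.mem_map]
  constructor
  · exact exists_tailEmb_eq
  · rintro ⟨j, rfl⟩; rw [tailEmb_val]; omega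

lemma chamber_tailWeights (hl : Chamber lam) (k : ℕ) : Chamber (tailWeights lam k) :=
  ⟨fun _ _ hab => hl.1 (Fin.mk_le_mk.2 (Nat.add_le_add_left hab k)), fun _ => hl.2 _⟩

lemma head_add_tail_le_sortedL1 (hl : Chamber lam) (k : ℕ) (v : Fin m → ℝ) :
    ∑ i ∈ headSet m k, lam i * v i +
      sortedL1 (tailWeights lam k) (fun j => v (tailEmb m k j)) ≤ sortedL1 lam v := by
  obtain ⟨e, he⟩ := exists_sortedL1_eq (tailWeights lam k) (fun j => v (tailEmb m k j))
  refine le_trans ?_ (sum_le_sortedL1 hl v (e.viaFintypeEmbedding (tailEmb m k)))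
  rw [sum_eq_head_add_tail k, he]
  refine add_le_add (Finset.sum_le_sum fun i hi => ?_) (Finset.sum_le_sum fun j _ => ?_)
  · rw [Equiv.Perm.viaFintypeEmbedding_apply_notMem_range _ _
      (not_mem_range_tailEmb (Finset.mem_filter.1 hi).2)]
    exact mul_le_mul_of_nonneg_left (le_abs_self _) (hl.2 i)
  · rw [Equiv.Perm.viaFintypeEmbedding_apply_image]
    exact le_rfl

/-- If the first `k` entries are sorted and dominate the others, then the sorted norm splits. -/
lemma sortedL1_le_head_add_tail (hl : Chamber lam) (k : ℕ) {z : Fin m → ℝ}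
    (h1 : ∀ i j : Fin m, i ≤ j → (j : ℕ) < k → z j ≤ z i)
    (h2 : ∀ (i : Fin m) (j : Fin (m - k)), (i : ℕ) < k → |z (tailEmb m k j)| ≤ z i)
    (h3 : ∀ i : Fin m, (i : ℕ) < k → 0 ≤ z i) :
    sortedL1 lam z ≤ ∑ i ∈ headSet m k, lam i * z i +
      sortedL1 (tailWeights lam k) (fun j => z (tailEmb m k j)) := by
  set w : Fin (m - k) → ℝ := fun j => z (tailEmb m k j) with hw
  set τ := Tuple.sort (fun j => -|w j|) with hτ
  -- a permutation that fixes the head and sorts the tail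
  set E := τ.viaFintypeEmbedding (tailEmb m k) with hE
  have hEh : ∀ i : Fin m, (i : ℕ) < k → E i = i := fun i hi =>
    Equiv.Perm.viaFintypeEmbedding_apply_notMem_range _ _ (not_mem_range_tailEmb hi)
  have hEt : ∀ j, E (tailEmb m k j) = tailEmb m k (τ j) := fun j =>
    Equiv.Perm.viaFintypeEmbedding_apply_image _ _ j
  choose σ hσ using fun a : ℝ => exists_sign a
  have hsp : sperm E (fun i => σ (z (E i))) z = fun i => |z (E i)| := by
    ext i; simp only [sperm, hσ]
  have hc : Chamber (fun i => |z (E i)|) := by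
    refine ⟨fun i j hij => ?_, fun i => abs_nonneg _⟩
    simp only
    by_cases hj : (j : ℕ) < k
    · have hi : (i : ℕ) < k := lt_of_le_of_lt hij hj
      rw [hEh i hi, hEh j hj, abs_of_nonneg (h3 i hi), abs_of_nonneg (h3 j hj)]
      exact h1 i j hij hj
    · obtain ⟨j', rfl⟩ := exists_tailEmb_eq hj
      rw [hEt]
      by_cases hi : (i : ℕ) < k
      · rw [hEh i hi, abs_of_nonneg (h3 i hi)]
        exact h2 i _ hi
      · obtain ⟨i', rfl⟩ := exists_tailEmb_eq hi
        rw [hEt]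
        have hle : i' ≤ j' := by
          have : k + (i' : ℕ) ≤ k + j' := hij
          exact Fin.le_def.2 (by omega)
        have := Tuple.monotone_sort (fun j => -|w j|) hle
        simpa using this
  rw [← sortedL1_sperm hl E (fun i => σ (z (E i))) z, hsp, sortedL1_of_chamber hl hc,
    sum_eq_head_add_tail k]
  refine add_le_add (Finset.sum_le_sum fun i hi => ?_) (le_of_eq ?_)
  · have hi := (Finset.mem_filter.1 hi).2
    rw [hEh i hi, abs_of_nonneg (h3 i hi)]
  · refine Finset.sum_congr rfl fun j _ => ?_
    rw [hEt]; rfl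

/-- The combination of a shifted head and the proximal point of the tail. -/
lemma prox_split (hl : Chamber lam) (k : ℕ) {χ : ℝ} (hχ : 0 ≤ χ) {u z : Fin m → ℝ}
    (hz : ∀ i : Fin m, (i : ℕ) < k → z i = u i - χ * lam i)
    (hzt : ∀ j, z (tailEmb m k j) =
      prox (fun j => u (tailEmb m k j)) χ (tailWeights lam k) j)
    (h1 : ∀ i j : Fin m, i ≤ j → (j : ℕ) < k → z j ≤ z i)
    (h2 : ∀ (i : Fin m) (j : Fin (m - k)), (i : ℕ) < k → |z (tailEmb m k j)| ≤ z i)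
    (h3 : ∀ i : Fin m, (i : ℕ) < k → 0 ≤ z i) : prox u χ lam = z := by
  have ht := chamber_tailWeights hl k
  set ut : Fin (m - k) → ℝ := fun j => u (tailEmb m k j) with hut
  have hzt' : (fun j => z (tailEmb m k j)) = prox ut χ (tailWeights lam k) := funext hzt
  have hq : ∀ v : Fin m → ℝ, (u - z) ⬝ᵥ v = χ * ∑ i ∈ headSet m k, lam i * v i +
      (ut - prox ut χ (tailWeights lam k)) ⬝ᵥ (fun j => v (tailEmb m k j)) := by
    intro v
    simp only [dotProduct]
    rw [sum_eq_head_add_tail k, Finset.mul_sum]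
    congr 1
    · refine Finset.sum_congr rfl fun i hi => ?_
      rw [Pi.sub_apply, hz i (Finset.mem_filter.1 hi).2]; ring
    · refine Finset.sum_congr rfl fun j _ => ?_
      rw [Pi.sub_apply, Pi.sub_apply, hzt]
  have hle : ∀ v, (u - z) ⬝ᵥ v ≤ χ * sortedL1 lam v := by
    intro v
    have a := residual_dotProduct_le ht hχ ut (fun j => v (tailEmb m k j))
    have b := mul_le_mul_of_nonneg_left (head_add_tail_le_sortedL1 hl k v) hχ
    rw [hq]; linarith
  refine IsProx.eq_prox hl hχ ⟨hle, le_antisymm (hle z) ?_⟩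
  have a := residual_dotProduct_prox ht hχ ut
  have b := mul_le_mul_of_nonneg_left (sortedL1_le_head_add_tail hl k h1 h2 h3) hχ
  rw [hq, hzt', a]
  rw [hzt'] at b
  linarith

lemma sparsity_sperm (e : Equiv.Perm (Fin m)) (s : Fin m → ℤˣ) (x : Fin m → ℝ) :
    sparsity (sperm e s x) = sparsity x := by
  unfold sparsity
  refine Finset.card_equiv e fun i => ?_
  simp [sperm]

lemma NoTies.sperm {x : Fin m → ℝ} (hx : NoTies x) (e : Equiv.Perm (Fin m)) (s : Fin m → ℤˣ) :
    NoTies (sperm e s x) := by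
  intro i j hij hi hj
  simp only [Slope.sperm, abs_mul, abs_sign, one_mul] at *
  exact hx _ _ (fun h => hij (e.injective h)) (right_ne_zero_of_mul hi) (right_ne_zero_of_mul hj)

lemma Chamber.lt_sparsity_iff {x : Fin m → ℝ} (hx : Chamber x) (i : Fin m) :
    (i : ℕ) < sparsity x ↔ x i ≠ 0 := by
  unfold sparsity
  constructor
  · intro h hi
    have : (Finset.univ.filter fun i => x i ≠ 0) ⊆ Finset.Iio i := by
      intro j hj
      rw [Finset.mem_Iio]
      by_contra hji
      have h1 := hx.1 (not_lt.1 hji)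
      have h2 := hx.2 j
      exact (Finset.mem_filter.1 hj).2 (by linarith)
    have := Finset.card_le_card this
    rw [Fin.card_Iio] at this
    omega
  · intro hi
    have : Finset.Iic i ⊆ (Finset.univ.filter fun i => x i ≠ 0) := by
      intro j hj
      rw [Finset.mem_Iic] at hj
      have h1 := hx.1 hj
      have h2 := (hx.2 i).lt_of_ne' hi
      exact Finset.mem_filter.2 ⟨Finset.mem_univ j, by linarith⟩
    have := Finset.card_le_card this
    rw [Fin.card_Iic] at this
    omega

lemma scaledRisk_sperm (hl : Chamber lam) (e : Equiv.Perm (Fin m)) (s : Fin m → ℤˣ)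
    (x : Fin m → ℝ) (t χ : ℝ) : scaledRisk lam (sperm e s x) t χ = scaledRisk lam x t χ := by
  unfold scaledRisk
  rw [← integral_comp_sperm e s]
  refine integral_congr_ae (ae_of_all _ fun h => ?_)
  simp only [err]
  rw [← sperm_smul, ← sperm_add, prox_sperm hl (le_max_right _ _), ← sperm_sub, sqNorm_sperm]

/-- The limit of the scaled risk for infinitely strong signals of sparsity `k`. -/
def limitRisk (lam : Fin m → ℝ) (k : ℕ) (χ : ℝ) : ℝ :=
  (k : ℝ) + χ ^ 2 * ∑ i ∈ headSet m k, lam i ^ 2 +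
    ∫ h, sqNorm (prox h χ (tailWeights lam k)) ∂stdGauss (m - k)

lemma card_filter_lt {k : ℕ} (hk : k ≤ m) :
    ((Finset.univ.filter fun i : Fin m => (i : ℕ) < k).card : ℝ) = k := by
  have h := Fin.card_filter_val_lt (n := m) (m := k)
  rw [min_eq_right hk] at h
  exact_mod_cast h

lemma eventually_err_eq (hl : Chamber lam) {x : Fin m → ℝ} (hx : Chamber x) (hties : NoTies x)
    {k : ℕ} (hk : k = sparsity x) {χ : ℝ} (hχ : 0 ≤ χ) (h : Fin m → ℝ) :
    ∀ᶠ t in atTop, sqNorm (err lam x t χ h) = ∑ i ∈ headSet m k, (h i - χ * lam i) ^ 2 +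
      sqNorm (prox (fun j => h (tailEmb m k j)) χ (tailWeights lam k)) := by
  have hpos : ∀ i : Fin m, (i : ℕ) < k → 0 < x i := fun i hi =>
    (hx.2 i).lt_of_ne' ((hx.lt_sparsity_iff i).1 (hk ▸ hi))
  have hzero : ∀ j, x (tailEmb m k j) = 0 := fun j => by
    by_contra hc
    have := (hx.lt_sparsity_iff _).2 hc
    rw [← hk, tailEmb_val] at this; omega
  have hstrict : ∀ i j : Fin m, i < j → (j : ℕ) < k → x j < x i := by
    intro i j hij hj
    refine (hx.1 hij.le).lt_of_ne fun he => ?_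
    have hi : (i : ℕ) < k := lt_trans hij hj
    exact hties i j hij.ne (hpos i hi).ne' (hpos j hj).ne' (by rw [he])
  have hlarge : ∀ {a : ℝ} (c : ℝ), 0 < a → ∀ᶠ t in atTop, c ≤ t * a := fun c ha =>
    (tendsto_id.atTop_mul_const ha).eventually_ge_atTop c
  set η := prox (fun j => h (tailEmb m k j)) χ (tailWeights lam k) with hη
  have e1 : ∀ i j : Fin m, i ≤ j → (j : ℕ) < k →
      ∀ᶠ t in atTop, t * x j + h j - χ * lam j ≤ t * x i + h i - χ * lam i := by
    intro i j hij hj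
    rcases hij.eq_or_lt with rfl | hlt
    · exact Eventually.of_forall fun t => le_rfl
    · filter_upwards [hlarge (h j - χ * lam j - (h i - χ * lam i))
        (sub_pos.2 (hstrict i j hlt hj))] with t ht
      linarith
  have e2 : ∀ (i : Fin m) (j : Fin (m - k)), (i : ℕ) < k →
      ∀ᶠ t in atTop, |η j| ≤ t * x i + h i - χ * lam i := by
    intro i j hi
    filter_upwards [hlarge (|η j| - (h i - χ * lam i)) (hpos i hi)] with t ht
    linarith
  have e3 : ∀ i : Fin m, (i : ℕ) < k → ∀ᶠ t in atTop, 0 ≤ t * x i + h i - χ * lam i := by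
    intro i hi
    filter_upwards [hlarge (0 - (h i - χ * lam i)) (hpos i hi)] with t ht
    linarith
  have E1 : ∀ᶠ t in atTop, ∀ i j : Fin m, i ≤ j → (j : ℕ) < k →
      t * x j + h j - χ * lam j ≤ t * x i + h i - χ * lam i := by
    simp only [eventually_all]; exact e1
  have E2 : ∀ᶠ t in atTop, ∀ (i : Fin m) (j : Fin (m - k)), (i : ℕ) < k →
      |η j| ≤ t * x i + h i - χ * lam i := by
    simp only [eventually_all]; exact e2
  have E3 : ∀ᶠ t in atTop, ∀ i : Fin m, (i : ℕ) < k → 0 ≤ t * x i + h i - χ * lam i := by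
    simp only [eventually_all]; exact e3
  filter_upwards [E1, E2, E3] with t a1 a2 a3
  -- on the support the estimator subtracts `χ lam`; the other coordinates form a proximal problem
  -- with the remaining weights
  set z : Fin m → ℝ := fun i => if hi : (i : ℕ) < k then t * x i + h i - χ * lam i
    else η ⟨i - k, by omega⟩ with hzdef
  have zh : ∀ i : Fin m, (i : ℕ) < k → z i = t * x i + h i - χ * lam i := fun i hi => by
    simp only [hzdef, dif_pos hi]
  have zt : ∀ j, z (tailEmb m k j) = η j := fun j => by
    have : ¬ ((tailEmb m k j : ℕ) < k) := by rw [tailEmb_val]; omega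
    simp only [hzdef, dif_neg this]
    congr 1
    exact Fin.ext (by simp [tailEmb_val])
  have hut : (fun j => (t • x + h) (tailEmb m k j)) = fun j => h (tailEmb m k j) := by
    ext j; simp [hzero]
  have hp : prox (t • x + h) χ lam = z := by
    refine prox_split hl k hχ (fun i hi => ?_) (fun j => ?_) (fun i j hij hj => ?_)
      (fun i j hi => ?_) fun i hi => ?_
    · rw [zh i hi]; simp
    · rw [zt, hut]
    · rw [zh i (lt_of_le_of_lt hij hj), zh j hj]; exact a1 i j hij hj
    · rw [zh i hi, zt]; exact a2 i j hi
    · rw [zh i hi]; exact a3 i hi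
  unfold err
  rw [hp]
  unfold sqNorm
  rw [sum_eq_head_add_tail k]
  congr 1
  · refine Finset.sum_congr rfl fun i hi => ?_
    rw [Pi.sub_apply, zh i (Finset.mem_filter.1 hi).2]
    simp; ring
  · refine Finset.sum_congr rfl fun j _ => ?_
    rw [Pi.sub_apply, zt]; simp [hzero]

lemma hasMean_head_add_tail (hl : Chamber lam) {k : ℕ} (hk : k ≤ m) {χ : ℝ} (hχ : 0 ≤ χ) :
    HasMean (fun h : Fin m → ℝ => ∑ i ∈ headSet m k, (h i - χ * lam i) ^ 2 +
      sqNorm (prox (fun j => h (tailEmb m k j)) χ (tailWeights lam k))) (limitRisk lam k χ) := by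
  have ht := chamber_tailWeights hl k
  have hcont : Continuous fun v : Fin (m - k) → ℝ => sqNorm (prox v χ (tailWeights lam k)) :=
    continuous_sqNorm.comp (continuous_prox_left ht hχ)
  have hmp := measurePreserving_comp_injective (tailEmb m k).injective
  have htail : HasMean (fun h : Fin m → ℝ =>
      sqNorm (prox (fun j => h (tailEmb m k j)) χ (tailWeights lam k)))
      (∫ h, sqNorm (prox h χ (tailWeights lam k)) ∂stdGauss (m - k)) := by
    constructor
    · refine integrable_sqNorm.mono'
        (hcont.comp (by fun_prop : Continuous fun (h : Fin m → ℝ) j =>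
          h (tailEmb m k j))).aestronglyMeasurable (ae_of_all _ fun h => ?_)
      rw [Real.norm_of_nonneg (sqNorm_nonneg _)]
      refine (sqNorm_prox_le ht hχ _).trans ?_
      have := sum_eq_head_add_tail k (fun i => h i ^ 2)
      have h2 : 0 ≤ ∑ i ∈ headSet m k, h i ^ 2 := Finset.sum_nonneg fun _ _ => sq_nonneg _
      unfold sqNorm
      linarith
    · rw [← hmp.map_eq, integral_map hmp.aemeasurable hcont.aestronglyMeasurable]
  have hhead : ∀ i : Fin m, HasMean (fun h : Fin m → ℝ => (h i - χ * lam i) ^ 2)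
      (1 + χ ^ 2 * lam i ^ 2) := by
    intro i
    have h1 : HasMean (fun h : Fin m → ℝ => h i ^ 2) 1 :=
      ⟨integrable_apply_sq i, integral_apply_sq i⟩
    have h2 : HasMean (fun h : Fin m → ℝ => h i) 0 := ⟨integrable_apply i, integral_apply i⟩
    have h3 := (h1.sub (h2.const_mul (2 * χ * lam i))).add (HasMean.const (χ ^ 2 * lam i ^ 2))
    simp only [mul_zero, sub_zero] at h3
    convert h3 using 2
    ring
  have hsum : HasMean (fun h : Fin m → ℝ => ∑ i ∈ headSet m k, (h i - χ * lam i) ^ 2)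
      (∑ i ∈ headSet m k, (1 + χ ^ 2 * lam i ^ 2)) :=
    ⟨integrable_finsetSum _ fun i _ => (hhead i).1, by
      rw [integral_finsetSum _ fun i _ => (hhead i).1]
      exact Finset.sum_congr rfl fun i _ => (hhead i).2⟩
  convert hsum.add htail using 1
  rw [limitRisk, Finset.sum_add_distrib, ← Finset.mul_sum, Finset.sum_const, nsmul_eq_mul,
    mul_one, card_filter_lt hk]

lemma sparsity_le (x : Fin m → ℝ) : sparsity x ≤ m := by
  unfold sparsity
  exact (Finset.card_filter_le _ _).trans (by simp)

/-- As the signal becomes strong, the scaled risk converges to the limit risk. -/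
lemma tendsto_scaledRisk_atTop (hl : Chamber lam) {x : Fin m → ℝ} (hties : NoTies x) {χ : ℝ}
    (hχ : 0 ≤ χ) :
    Tendsto (fun t => scaledRisk lam x t χ) atTop (𝓝 (limitRisk lam (sparsity x) χ)) := by
  obtain ⟨e, s, hc⟩ := exists_sperm_chamber x
  rw [← sparsity_sperm e s x]
  simp only [← scaledRisk_sperm hl e s x]
  have hties' := hties.sperm e s
  generalize sperm e s x = y at hc hties'
  rw [← (hasMean_head_add_tail hl (sparsity_le y) hχ).2]
  simp only [scaledRisk_eq _ _ _ hχ]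
  refine tendsto_integral_filter_of_dominated_convergence
    (fun h => 2 * (χ ^ 2 * resBound lam) + 2 * sqNorm h) ?_ ?_ ?_ ?_
  · exact Eventually.of_forall fun t => (integrable_sqNorm_err hl y t hχ).1
  · refine Eventually.of_forall fun t => ae_of_all _ fun h => ?_
    rw [Real.norm_of_nonneg (sqNorm_nonneg _)]
    exact sqNorm_err_le hl y t hχ h
  · exact (integrable_const _).add (integrable_sqNorm.const_mul 2)
  · refine ae_of_all _ fun h => tendsto_const_nhds.congr' ?_
    filter_upwards [eventually_err_eq hl hc hties' rfl hχ h] with t ht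
    exact ht.symm

lemma scaledRisk_le_limitRisk (hl : Chamber lam) {x : Fin m → ℝ} (hties : NoTies x) {t χ : ℝ}
    (ht : 0 ≤ t) (hχ : 0 ≤ χ) : scaledRisk lam x t χ ≤ limitRisk lam (sparsity x) χ := by
  refine ge_of_tendsto (tendsto_scaledRisk_atTop hl hties hχ) ?_
  filter_upwards [eventually_ge_atTop t] with s hs
  exact scaledRisk_mono hl x χ ht hs

/-! ### The threshold -/

lemma limitRisk_nonneg (lam : Fin m → ℝ) (k : ℕ) (χ : ℝ) : 0 ≤ limitRisk lam k χ := by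
  unfold limitRisk
  have h1 : 0 ≤ ∑ i ∈ headSet m k, lam i ^ 2 :=
    Finset.sum_nonneg fun _ _ => sq_nonneg _
  have h2 : 0 ≤ ∫ h, sqNorm (prox h χ (tailWeights lam k)) ∂stdGauss (m - k) :=
    integral_nonneg fun _ => sqNorm_nonneg _
  positivity

lemma mul_threshold_eq (hm : 0 < m) (lam : Fin m → ℝ) (k : ℕ) :
    m * threshold lam k = ⨅ α : Set.Ioi (0 : ℝ), limitRisk lam k α := by
  have : (m : ℝ) ≠ 0 := by exact_mod_cast hm.ne'
  unfold threshold limitRisk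
  rw [← mul_assoc, mul_one_div_cancel this, one_mul]

lemma mul_threshold_le_limitRisk (hm : 0 < m) (lam : Fin m → ℝ) (k : ℕ) {χ : ℝ} (hχ : 0 < χ) :
    m * threshold lam k ≤ limitRisk lam k χ := by
  rw [mul_threshold_eq hm]
  refine ciInf_le (f := fun α : Set.Ioi (0 : ℝ) => limitRisk lam k α) ⟨0, ?_⟩ ⟨χ, hχ⟩
  rintro _ ⟨α, rfl⟩
  exact limitRisk_nonneg lam k α

lemma le_mul_threshold (hm : 0 < m) (lam : Fin m → ℝ) (k : ℕ) {c : ℝ}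
    (hc : ∀ χ, 0 < χ → c ≤ limitRisk lam k χ) : c ≤ m * threshold lam k := by
  rw [mul_threshold_eq hm]
  have : Nonempty (Set.Ioi (0 : ℝ)) := ⟨⟨1, Set.mem_Ioi.2 one_pos⟩⟩
  exact le_ciInf fun α => hc α α.2

lemma mul_threshold_le_card (hl : Chamber lam) (hm : 0 < m) {k : ℕ} (hk : k ≤ m) :
    m * threshold lam k ≤ m := by
  set S := ∑ i ∈ headSet m k, lam i ^ 2 with hS
  have hb : ∀ χ, 0 < χ → m * threshold lam k ≤ m + χ ^ 2 * S := by
    intro χ hχ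
    refine (mul_threshold_le_limitRisk hm lam k hχ).trans ?_
    have h1 : ∫ h, sqNorm (prox h χ (tailWeights lam k)) ∂stdGauss (m - k) ≤ ((m - k : ℕ) : ℝ) := by
      have ht := chamber_tailWeights hl k
      have hi : Integrable (fun h => sqNorm (prox h χ (tailWeights lam k))) (stdGauss (m - k)) := by
        simpa using integrable_sqNorm_prox ht 0 0 hχ.le
      exact hi.hasMean.mono hasMean_sqNorm fun h => sqNorm_prox_le ht hχ.le h
    rw [Nat.cast_sub hk] at h1
    unfold limitRisk
    linarith
  -- let `χ` tend to zero
  have htend : Tendsto (fun χ : ℝ => (m : ℝ) + χ ^ 2 * S) (𝓝[>] 0) (𝓝 (m + 0 ^ 2 * S)) :=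
    Tendsto.mono_left (Continuous.tendsto (by fun_prop) 0) nhdsWithin_le_nhds
  simp only [ne_eq, OfNat.ofNat_ne_zero, not_false_eq_true, zero_pow, zero_mul, add_zero] at htend
  refine ge_of_tendsto htend ?_
  filter_upwards [self_mem_nhdsWithin] with χ hχ
  exact hb χ hχ

/-- Every number below the threshold is eventually a lower bound of the scaled risk, uniformly in
the regularization parameter. -/
lemma exists_lt_scaledRisk (hl : Chamber lam) {i : Fin m} (hi : 0 < lam i) {x : Fin m → ℝ}
    (hx : x ≠ 0) (hties : NoTies x) {μ : ℝ} (hμ : μ < m * threshold lam (sparsity x)) :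
    ∃ T, 0 ≤ T ∧ ∀ t, T ≤ t → ∀ χ, 0 ≤ χ → μ < scaledRisk lam x t χ := by
  have hm : 0 < m := i.pos
  have hX : 0 < sqNorm x := (sqNorm_nonneg x).lt_of_ne' fun h => hx (sqNorm_eq_zero.1 h)
  -- large `χ` are handled at one signal strength whose energy exceeds `μ + 1`
  obtain ⟨s, hs0, hs⟩ : ∃ s, 0 ≤ s ∧ μ + 1 ≤ s ^ 2 * sqNorm x := by
    have : Tendsto (fun s : ℝ => s ^ 2 * sqNorm x) atTop atTop :=
      (tendsto_pow_atTop two_ne_zero).atTop_mul_const hX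
    obtain ⟨s, h1, h2⟩ := ((this.eventually_ge_atTop (μ + 1)).and (eventually_ge_atTop 0)).exists
    exact ⟨s, h2, h1⟩
  obtain ⟨K, hK0, hK⟩ := exists_bound_large hl hi x hs0
  set B : ℝ := K + 1 with hB
  have hlargeχ : ∀ t, s ≤ t → ∀ χ, B ≤ χ → μ < scaledRisk lam x t χ := by
    intro t ht χ hχ
    have hχ1 : 1 ≤ χ := by linarith
    have h1 := (abs_le.1 (hK s hs0 le_rfl χ hχ1).2).1
    have h2 := scaledRisk_mono hl x χ hs0 ht
    have h3 : K / χ < 1 := by rw [div_lt_one (by linarith)]; linarith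
    linarith
  -- on the compact interval the monotone limit is attained uniformly
  have hpt : ∀ χ ∈ Set.Icc 0 B, ∃ t, 0 ≤ t ∧ μ < scaledRisk lam x t χ := by
    intro χ hχ
    rcases hχ.1.eq_or_lt with rfl | hχ0
    · refine ⟨0, le_rfl, ?_⟩
      rw [scaledRisk_zero_right hl]
      exact hμ.trans_le (mul_threshold_le_card hl hm (sparsity_le x))
    · have h1 := hμ.trans_le (mul_threshold_le_limitRisk hm lam (sparsity x) hχ0)
      obtain ⟨t, h2, h3⟩ := (((tendsto_scaledRisk_atTop hl hties hχ0.le).eventually_const_lt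
        h1).and (eventually_ge_atTop 0)).exists
      exact ⟨t, h3, h2⟩
  choose! τ hτ0 hτ using hpt
  have hopen : ∀ χ ∈ Set.Icc 0 B, {χ' | μ < scaledRisk lam x (τ χ) χ'} ∈ 𝓝[Set.Icc 0 B] χ := by
    intro χ hχ
    have hc : Continuous fun χ' => scaledRisk lam x (τ χ) χ' :=
      (continuous_scaledRisk hl x).comp (f := fun χ' : ℝ => (τ χ, χ')) (by fun_prop)
    exact mem_nhdsWithin_of_mem_nhds ((isOpen_lt continuous_const hc).mem_nhds (hτ χ hχ))
  obtain ⟨F, hF, hcover⟩ := isCompact_Icc.elim_nhdsWithin_subcover _ hopen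
  refine ⟨s + ∑ χ ∈ F, τ χ, add_nonneg hs0 (Finset.sum_nonneg fun χ hχ => hτ0 χ (hF χ hχ)),
    fun t ht χ hχ => ?_⟩
  have hsum : 0 ≤ ∑ χ ∈ F, τ χ := Finset.sum_nonneg fun χ hχ => hτ0 χ (hF χ hχ)
  rcases le_or_gt B χ with h | h
  · exact hlargeχ t (by linarith) χ h
  · obtain ⟨χ', hχ', hmem⟩ := Set.mem_iUnion₂.1 (hcover ⟨hχ, h.le⟩)
    have h1 : τ χ' ≤ ∑ χ ∈ F, τ χ :=
      Finset.single_le_sum (f := τ) (fun χ hχ => hτ0 χ (hF χ hχ)) hχ'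
    exact lt_of_lt_of_le hmem (scaledRisk_mono hl x χ (hτ0 χ' (hF χ' hχ')) (by linarith))

/-! ### The state evolution equations in scaled variables -/

lemma prox_add_smul (hl : Chamber lam) (x h : Fin m → ℝ) {σ χ : ℝ} (hσ : 0 < σ) (hχ : 0 ≤ χ) :
    prox (x + σ • h) (σ * χ) lam = σ • prox (σ⁻¹ • x + h) χ lam := by
  rw [← prox_smul_smul hl hχ hσ.le, smul_add, smul_smul, mul_inv_cancel₀ hσ.ne', one_smul]

lemma risk_eq (hl : Chamber lam) (x : Fin m → ℝ) {σ χ : ℝ} (hσ : 0 < σ) (hχ : 0 ≤ χ) :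
    risk lam x σ χ = 1 / (m : ℝ) * (σ ^ 2 * scaledRisk lam x σ⁻¹ χ) := by
  have h1 : ∀ h, sqNorm (prox (x + σ • h) (σ * χ) lam - x) =
      σ ^ 2 * sqNorm (err lam x σ⁻¹ χ h) := fun h => by
    rw [← sqNorm_smul, err, smul_sub, smul_smul, mul_inv_cancel₀ hσ.ne', one_smul,
      prox_add_smul hl x h hσ hχ]
  unfold risk
  simp only [h1, integral_const_mul, scaledRisk_eq _ _ _ hχ]

lemma corr_eq (hl : Chamber lam) (x : Fin m → ℝ) {σ χ : ℝ} (hσ : 0 < σ) (hχ : 0 ≤ χ) :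
    corr lam x σ χ = 1 / (m : ℝ) * (σ * scaledCorr lam x σ⁻¹ χ) := by
  have h1 : ∀ h, ∑ i, prox (x + σ • h) (σ * χ) lam i * h i =
      σ * (h ⬝ᵥ prox (σ⁻¹ • x + h) χ lam) := fun h => by
    rw [prox_add_smul hl x h hσ hχ, dotProduct, Finset.mul_sum]
    refine Finset.sum_congr rfl fun i _ => ?_
    rw [Pi.smul_apply, smul_eq_mul]; ring
  unfold corr
  simp only [h1, integral_const_mul, scaledCorr_eq_integral_prox hl x _ hχ]

/-- In the variables `t = 1 / σ` and `d = δ m`, the state evolution equations are polynomial in the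
scaled risk and the scaled correlation. -/
lemma isStateEvolution_iff (hl : Chamber lam) (hm : 0 < m) {δ : ℝ} (hδ : 0 < δ) (x : Fin m → ℝ)
    (γ z : ℝ) (s : ℝ × ℝ) : IsStateEvolution δ lam x γ z s ↔ 0 < s.1 ∧ 0 < s.2 ∧
      scaledRisk lam x s.1⁻¹ s.2 = δ * m * (1 - z ^ 2 * s.1⁻¹ ^ 2) ∧
      γ * s.1⁻¹ * (δ * m) = s.2 * (δ * m - scaledCorr lam x s.1⁻¹ s.2) := by
  obtain ⟨σ, χ⟩ := s
  unfold IsStateEvolution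
  refine and_congr_right fun hσ => and_congr_right fun hχ => ?_
  simp only at hσ hχ ⊢
  have hm' : (0 : ℝ) < m := by exact_mod_cast hm
  rw [risk_eq hl x hσ hχ.le, corr_eq hl x hσ hχ.le]
  generalize scaledRisk lam x σ⁻¹ χ = R
  generalize scaledCorr lam x σ⁻¹ χ = C
  refine and_congr ?_ ?_
  · field_simp
    constructor <;> intro h <;> linarith
  · field_simp

lemma scaled_solution_unique (hl : Chamber lam) (x : Fin m → ℝ) {d γ z : ℝ} (hd : 0 < d)
    (hγ : 0 < γ) (hz : 0 < z) {t₁ t₂ χ₁ χ₂ : ℝ} (ht₁ : 0 < t₁) (ht₂ : 0 < t₂) (hχ₁ : 0 < χ₁)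
    (hχ₂ : 0 < χ₂) (r₁ : scaledRisk lam x t₁ χ₁ = d * (1 - z ^ 2 * t₁ ^ 2))
    (r₂ : scaledRisk lam x t₂ χ₂ = d * (1 - z ^ 2 * t₂ ^ 2))
    (c₁ : γ * t₁ * d = χ₁ * (d - scaledCorr lam x t₁ χ₁))
    (c₂ : γ * t₂ * d = χ₂ * (d - scaledCorr lam x t₂ χ₂)) : t₁ = t₂ ∧ χ₁ = χ₂ := by
  have hmono := scaled_monotonicity hl x ht₁.le ht₂.le hχ₁.le hχ₂.le
  rw [r₁, r₂] at hmono
  generalize scaledCorr lam x t₁ χ₁ = C₁ at *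
  generalize scaledCorr lam x t₂ χ₂ = C₂ at *
  have hmul := mul_le_mul_of_nonneg_left hmono (mul_pos hχ₁ hχ₂).le
  -- after elimination of the correlations, the monotonicity becomes a sum of two squares
  have key : d * (γ * (t₁ * t₂) * (χ₁ - χ₂) ^ 2 +
      z ^ 2 * (χ₁ * χ₂) * (χ₂ * t₁ + χ₁ * t₂) * (t₁ - t₂) ^ 2 / 2) ≤ 0 := by
    linear_combination hmul - χ₁ * t₁ * (χ₂ - χ₁) * c₂ - χ₂ * t₂ * (χ₁ - χ₂) * c₁
  have key' := nonpos_of_mul_nonpos_right key hd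
  have n1 : 0 ≤ γ * (t₁ * t₂) * (χ₁ - χ₂) ^ 2 := by positivity
  have n2 : 0 ≤ z ^ 2 * (χ₁ * χ₂) * (χ₂ * t₁ + χ₁ * t₂) * (t₁ - t₂) ^ 2 / 2 := by positivity
  have e1 : γ * (t₁ * t₂) * (χ₁ - χ₂) ^ 2 = 0 := by linarith
  have e2 : z ^ 2 * (χ₁ * χ₂) * (χ₂ * t₁ + χ₁ * t₂) * (t₁ - t₂) ^ 2 / 2 = 0 := by linarith
  have p1 : γ * (t₁ * t₂) ≠ 0 := by positivity
  have p2 : z ^ 2 * (χ₁ * χ₂) * (χ₂ * t₁ + χ₁ * t₂) ≠ 0 := by positivity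
  have s1 := (mul_eq_zero.1 e1).resolve_left p1
  have s2 := (mul_eq_zero.1 ((div_eq_zero_iff.1 e2).resolve_right two_ne_zero)).resolve_left p2
  exact ⟨sub_eq_zero.1 (pow_eq_zero_iff two_ne_zero |>.1 s2),
    sub_eq_zero.1 (pow_eq_zero_iff two_ne_zero |>.1 s1)⟩

/-! ### Solving the first equation -/

/-- The defect of the first state evolution equation in scaled variables. -/
def defect (lam x : Fin m → ℝ) (d z t χ : ℝ) : ℝ :=
  scaledRisk lam x t χ - d * (1 - z ^ 2 * t ^ 2)

/-- The signal strength `t = 1 / σ` that solves the first state evolution equation for a given `χ`.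
It is `0` if there is no positive solution. -/
def strength (lam x : Fin m → ℝ) (d z χ : ℝ) : ℝ :=
  sSup {t | 0 ≤ t ∧ defect lam x d z t χ ≤ 0}

section FirstEquation

variable {x : Fin m → ℝ} {d z : ℝ}

lemma continuous_defect (hl : Chamber lam) (x : Fin m → ℝ) (d z : ℝ) :
    Continuous fun q : ℝ × ℝ => defect lam x d z q.1 q.2 := by
  have := continuous_scaledRisk hl x
  unfold defect
  fun_prop

lemma continuous_defect_left (hl : Chamber lam) (x : Fin m → ℝ) (d z χ : ℝ) :
    Continuous fun t => defect lam x d z t χ :=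
  (continuous_defect hl x d z).comp (f := fun t : ℝ => (t, χ)) (by fun_prop)

lemma continuous_defect_right (hl : Chamber lam) (x : Fin m → ℝ) (d z t : ℝ) :
    Continuous fun χ => defect lam x d z t χ :=
  (continuous_defect hl x d z).comp (f := fun χ : ℝ => (t, χ)) (by fun_prop)

lemma defect_lt_defect (hl : Chamber lam) (hd : 0 < d) (hz : 0 < z) {t s : ℝ} (ht : 0 ≤ t)
    (hts : t < s) (χ : ℝ) : defect lam x d z t χ < defect lam x d z s χ := by
  have h1 := scaledRisk_mono hl x χ ht hts.le
  have h2 : t ^ 2 < s ^ 2 := pow_lt_pow_left₀ hts ht two_ne_zero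
  have h3 := mul_lt_mul_of_pos_left h2 (mul_pos hd (pow_pos hz 2))
  unfold defect
  linarith

lemma le_of_defect_nonpos (hd : 0 < d) (hz : 0 < z) {t χ : ℝ}
    (h : defect lam x d z t χ ≤ 0) : t ≤ 1 / z := by
  by_contra hc
  have h1 : 1 < t * z := (div_lt_iff₀ hz).1 (not_le.1 hc)
  have h2 := scaledRisk_nonneg lam x t χ
  have h3 : 1 < z ^ 2 * t ^ 2 := by nlinarith
  have h4 : d * 1 < d * (z ^ 2 * t ^ 2) := mul_lt_mul_of_pos_left h3 hd
  unfold defect at h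
  linarith

lemma bddAbove_defect_nonpos (hd : 0 < d) (hz : 0 < z) (χ : ℝ) :
    BddAbove {t | 0 ≤ t ∧ defect lam x d z t χ ≤ 0} :=
  ⟨1 / z, fun _ ht => le_of_defect_nonpos hd hz ht.2⟩

lemma strength_nonneg (lam x : Fin m → ℝ) (d z χ : ℝ) : 0 ≤ strength lam x d z χ :=
  Real.sSup_nonneg fun _ h => h.1

lemma strength_le (hd : 0 < d) (hz : 0 < z) (χ : ℝ) : strength lam x d z χ ≤ 1 / z :=
  Real.sSup_le (fun _ h => le_of_defect_nonpos hd hz h.2) (by positivity)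

lemma lt_strength_iff (hl : Chamber lam) (hd : 0 < d) (hz : 0 < z) {a χ : ℝ} (ha : 0 ≤ a) :
    a < strength lam x d z χ ↔ defect lam x d z a χ < 0 := by
  constructor
  · intro h
    have hne : {t | 0 ≤ t ∧ defect lam x d z t χ ≤ 0}.Nonempty := by
      by_contra hc
      rw [strength, Set.not_nonempty_iff_eq_empty.1 hc, Real.sSup_empty] at h
      linarith
    obtain ⟨s, hs, has⟩ := exists_lt_of_lt_csSup hne h
    exact (defect_lt_defect hl hd hz ha has χ).trans_le hs.2
  · intro h
    have h1 := ((continuous_defect_left hl x d z χ).tendsto a).eventually_lt_const h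
    obtain ⟨s, hs, has⟩ := ((h1.filter_mono nhdsWithin_le_nhds).and
      (self_mem_nhdsWithin (s := Set.Ioi a))).exists
    exact lt_of_lt_of_le has (le_csSup (bddAbove_defect_nonpos hd hz χ)
      ⟨ha.trans (le_of_lt has), hs.le⟩)

lemma strength_lt_iff (hl : Chamber lam) (hd : 0 < d) (hz : 0 < z) {a χ : ℝ} (ha : 0 < a) :
    strength lam x d z χ < a ↔ 0 < defect lam x d z a χ := by
  constructor
  · intro h
    by_contra hc
    exact (le_csSup (bddAbove_defect_nonpos hd hz χ) ⟨ha.le, not_lt.1 hc⟩).not_gt h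
  · intro h
    have h1 := ((continuous_defect_left hl x d z χ).tendsto a).eventually_const_lt h
    obtain ⟨s, ⟨hs, hs0⟩, hsa⟩ := (((h1.and (eventually_gt_nhds ha)).filter_mono
      nhdsWithin_le_nhds).and (self_mem_nhdsWithin (s := Set.Iio a))).exists
    refine lt_of_le_of_lt (Real.sSup_le (fun t ht => ?_) hs0.le) hsa
    by_contra hc
    have := defect_lt_defect (x := x) hl hd hz hs0.le (not_le.1 hc) χ
    linarith [ht.2]

lemma defect_strength_nonneg (hl : Chamber lam) (hd : 0 < d) (hz : 0 < z) (χ : ℝ) :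
    0 ≤ defect lam x d z (strength lam x d z χ) χ :=
  not_lt.1 fun h => lt_irrefl _ ((lt_strength_iff hl hd hz (strength_nonneg _ _ _ _ _)).2 h)

lemma defect_strength (hl : Chamber lam) (hd : 0 < d) (hz : 0 < z) {χ : ℝ}
    (h : 0 < strength lam x d z χ) : defect lam x d z (strength lam x d z χ) χ = 0 :=
  le_antisymm (not_lt.1 fun hc => lt_irrefl _ ((strength_lt_iff hl hd hz h).2 hc))
    (defect_strength_nonneg hl hd hz χ)

lemma continuous_strength (hl : Chamber lam) (hd : 0 < d) (hz : 0 < z) (x : Fin m → ℝ) :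
    Continuous (strength lam x d z) := by
  refine continuous_iff_continuousAt.2 fun χ => tendsto_order.2 ⟨fun a ha => ?_, fun a ha => ?_⟩
  · rcases lt_or_ge a 0 with h | h
    · exact Eventually.of_forall fun χ' => h.trans_le (strength_nonneg _ _ _ _ _)
    · simp only [lt_strength_iff hl hd hz h] at ha ⊢
      exact ((continuous_defect_right hl x d z a).tendsto χ).eventually_lt_const ha
  · have h := lt_of_le_of_lt (strength_nonneg lam x d z χ) ha
    simp only [strength_lt_iff hl hd hz h] at ha ⊢
    exact ((continuous_defect_right hl x d z a).tendsto χ).eventually_const_lt ha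

/-! ### Existence of the solution -/

/-- The defect of the second state evolution equation along the solutions of the first one. -/
def tuningDefect (lam x : Fin m → ℝ) (d γ z χ : ℝ) : ℝ :=
  χ * (d - scaledCorr lam x (strength lam x d z χ) χ) - γ * d * strength lam x d z χ

lemma continuous_tuningDefect (hl : Chamber lam) (hd : 0 < d) (hz : 0 < z) (x : Fin m → ℝ)
    (γ : ℝ) : Continuous (tuningDefect lam x d γ z) := by
  have h1 := continuous_strength hl hd hz x
  have h2 := (continuous_scaledCorr hl x).comp
    (f := fun χ : ℝ => (strength lam x d z χ, χ)) (by fun_prop)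
  simp only [Function.comp_def] at h2
  unfold tuningDefect
  fun_prop

/-- Where the first equation has no positive root, the second one has negative defect. -/
lemma tuningDefect_neg_of_strength_eq_zero (hl : Chamber lam) {i : Fin m} (hi : 0 < lam i)
    (hd : 0 < d) (hz : 0 < z) (γ : ℝ) {χ : ℝ} (hχ : 0 < χ) (h : strength lam x d z χ = 0) :
    tuningDefect lam x d γ z χ < 0 := by
  have h1 := defect_strength_nonneg (x := x) hl hd hz χ
  rw [h] at h1
  have h2 : d ≤ scaledRisk lam x 0 χ := by
    unfold defect at h1; linarith
  have h3 := scaledRisk_lt_scaledCorr_zero_left hl hi x hχ (hd.trans_le h2)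
  unfold tuningDefect
  rw [h]
  have := mul_neg_of_pos_of_neg hχ (by linarith : d - scaledCorr lam x 0 χ < 0)
  linarith

lemma exists_tuningDefect_pos (hl : Chamber lam) {i : Fin m} (hi : 0 < lam i) (hd : 0 < d)
    (hz : 0 < z) (x : Fin m → ℝ) {γ : ℝ} (hγ : 0 < γ) : ∃ χ, 1 ≤ χ ∧
      0 < tuningDefect lam x d γ z χ := by
  obtain ⟨K, hK0, hK⟩ := exists_bound_large hl hi x (T := 1 / z) (by positivity)
  set χ := (K + γ * d * (1 / z)) / d + 1 with hχ
  have hq : 0 ≤ (K + γ * d * (1 / z)) / d := by positivity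
  have hχ1 : 1 ≤ χ := by linarith
  refine ⟨χ, hχ1, ?_⟩
  have h1 := (abs_le.1 (hK _ (strength_nonneg lam x d z χ) (strength_le hd hz χ) χ hχ1).1).2
  have h2 := mul_le_mul_of_nonneg_left (strength_le (lam := lam) (x := x) hd hz χ)
    (mul_pos hγ hd).le
  have h3 := mul_le_mul_of_nonneg_left h1 (by linarith : 0 ≤ χ)
  rw [mul_div_cancel₀ _ (by linarith : χ ≠ 0)] at h3
  have h4 : χ * d = K + γ * d * (1 / z) + d := by
    rw [hχ, add_mul, div_mul_cancel₀ _ hd.ne', one_mul]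
  unfold tuningDefect
  rw [mul_sub]
  linarith

/-- In the critical case `d = m` the solution of the first equation is at least of order `√χ` for
small `χ`, while `χ (d - c)` is of order `χ ^ 2`. -/
lemma exists_tuningDefect_neg_of_eq_card (hl : Chamber lam) {i : Fin m} (hi : 0 < lam i)
    (hz : 0 < z) (x : Fin m → ℝ) {γ : ℝ} (hγ : 0 < γ) :
    ∃ χ, 0 < χ ∧ χ < 1 ∧ tuningDefect lam x m γ z χ < 0 := by
  by_contra! hcon
  have hm : (0 : ℝ) < m := by exact_mod_cast i.pos
  set E := ∫ h, sortedL1 lam h ∂stdGauss m with hE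
  have hE0 : 0 < E := by
    simpa using mul_sortedL1_lt_integral hl hi x le_rfl
  set A := (m + resBound lam) / (γ * m) with hA
  have hR := resBound_nonneg lam
  have hA0 : 0 ≤ A := by positivity
  have hJ := sortedL1_nonneg hl x
  have hineq : ∀ χ, 0 < χ → χ < 1 →
      2 * E ≤ m * z ^ 2 * A ^ 2 * χ ^ 3 + 4 * A * χ ^ 2 * sortedL1 lam x +
        2 * χ * resBound lam := by
    intro χ h0 h1
    have hneg := hcon χ h0 h1
    set T := strength lam x m z χ with hT
    have hT0 : 0 ≤ T := strength_nonneg _ _ _ _ _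
    have hc := mul_le_mul_of_nonneg_left (card_sub_scaledCorr_le hl x T h0) h0.le
    have hTA : T ≤ A * χ ^ 2 := by
      rw [hA, div_mul_eq_mul_div, le_div_iff₀ (by positivity)]
      unfold tuningDefect at hneg
      rw [← hT] at hneg
      linarith
    have hdef := defect_strength_nonneg (x := x) hl hm hz χ
    rw [← hT, defect] at hdef
    have hge := card_sub_scaledRisk_ge hl x hT0 h0.le
    have hEJ : E - T * sortedL1 lam x ≤ ∫ h, sortedL1 lam (T • x + h) ∂stdGauss m := by
      have i0 : Integrable (fun h => sortedL1 lam h) (stdGauss m) := by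
        simpa using integrable_sortedL1 hl (0 : Fin m → ℝ)
      refine (i0.hasMean.sub (HasMean.const (T * sortedL1 lam x))).mono
        (integrable_sortedL1 hl (T • x)).hasMean fun h => ?_
      have h2 := sortedL1_add_le hl (T • x + h) (-(T • x))
      rw [sortedL1_neg hl, sortedL1_smul hl, abs_of_nonneg hT0,
        show T • x + h + -(T • x) = h by abel] at h2
      linarith
    have hTT : T ^ 2 ≤ (A * χ ^ 2) ^ 2 := pow_le_pow_left₀ hT0 hTA 2
    have h3 : 2 * χ * (E - 2 * (T * sortedL1 lam x) - χ * resBound lam) ≤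
        m * z ^ 2 * (A * χ ^ 2) ^ 2 := by
      have := mul_le_mul_of_nonneg_left hEJ (by linarith : 0 ≤ 2 * χ)
      have := mul_le_mul_of_nonneg_left hTT (by positivity : 0 ≤ m * z ^ 2)
      linarith
    have h4 := mul_le_mul_of_nonneg_right hTA hJ
    have h5 : χ * (2 * E) ≤ χ * (m * z ^ 2 * A ^ 2 * χ ^ 3 + 4 * A * χ ^ 2 * sortedL1 lam x +
        2 * χ * resBound lam) := by
      have := mul_le_mul_of_nonneg_left h4 (by linarith : 0 ≤ 4 * χ)
      linarith
    exact le_of_mul_le_mul_left h5 h0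
  have hcont : Continuous fun χ : ℝ => m * z ^ 2 * A ^ 2 * χ ^ 3 +
      4 * A * χ ^ 2 * sortedL1 lam x + 2 * χ * resBound lam := by fun_prop
  have hlt := (hcont.tendsto 0).eventually_lt_const (u := 2 * E) (by simpa using hE0)
  obtain ⟨χ, ⟨h2, h1⟩, h0⟩ := (((hlt.and (eventually_lt_nhds one_pos)).filter_mono
    nhdsWithin_le_nhds).and (self_mem_nhdsWithin (s := Set.Ioi (0 : ℝ)))).exists
  exact (hineq χ h0 h1).not_gt h2

lemma exists_tuningDefect_neg (hl : Chamber lam) {i : Fin m} (hi : 0 < lam i) (hd : 0 < d)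
    (hz : 0 < z) (x : Fin m → ℝ) {γ : ℝ} (hγ : 0 < γ) :
    ∃ χ, 0 < χ ∧ χ < 1 ∧ tuningDefect lam x d γ z χ < 0 := by
  have hsmall : ∀ {P : ℝ → Prop}, (∀ᶠ χ in 𝓝 0, P χ) → ∃ χ, 0 < χ ∧ χ < 1 ∧ P χ := fun hP => by
    obtain ⟨χ, ⟨h2, h1⟩, h0⟩ := (((hP.and (eventually_lt_nhds one_pos)).filter_mono
      nhdsWithin_le_nhds).and (self_mem_nhdsWithin (s := Set.Ioi (0 : ℝ)))).exists
    exact ⟨χ, h0, h1, h2⟩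
  have hd0 : defect lam x d z 0 0 = m - d := by
    rw [defect, scaledRisk_zero_right hl]; ring
  rcases lt_trichotomy d m with h | rfl | h
  · obtain ⟨χ, h0, h1, h2⟩ := hsmall
      (((continuous_defect_right hl x d z 0).tendsto 0).eventually_const_lt
        (by rw [hd0]; linarith : 0 < defect lam x d z 0 0))
    refine ⟨χ, h0, h1, tuningDefect_neg_of_strength_eq_zero hl hi hd hz γ h0 ?_⟩
    refine le_antisymm (not_lt.1 fun hc => ?_) (strength_nonneg _ _ _ _ _)
    linarith [(lt_strength_iff hl hd hz le_rfl).1 hc]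
  · exact exists_tuningDefect_neg_of_eq_card hl hi hz x hγ
  · refine hsmall (((continuous_tuningDefect hl hd hz x γ).tendsto 0).eventually_lt_const ?_)
    have : 0 < strength lam x d z 0 := (lt_strength_iff hl hd hz le_rfl).2 (by rw [hd0]; linarith)
    unfold tuningDefect
    have := mul_pos (mul_pos hγ hd) this
    linarith

lemma exists_scaled_solution (hl : Chamber lam) {i : Fin m} (hi : 0 < lam i) (hd : 0 < d)
    (hz : 0 < z) (x : Fin m → ℝ) {γ : ℝ} (hγ : 0 < γ) : ∃ t χ, 0 < t ∧ 0 < χ ∧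
      scaledRisk lam x t χ = d * (1 - z ^ 2 * t ^ 2) ∧
      γ * t * d = χ * (d - scaledCorr lam x t χ) := by
  -- the zero is not at strength `0`, where the defect is negative
  obtain ⟨a, ha0, ha1, ha⟩ := exists_tuningDefect_neg hl hi hd hz x hγ
  obtain ⟨b, hb1, hb⟩ := exists_tuningDefect_pos hl hi hd hz x hγ
  obtain ⟨χ, hχ, h0⟩ := intermediate_value_Icc (ha1.le.trans hb1)
    (continuous_tuningDefect hl hd hz x γ).continuousOn ⟨ha.le, hb.le⟩
  have hχ0 : 0 < χ := ha0.trans_le hχ.1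
  have ht : 0 < strength lam x d z χ := (strength_nonneg _ _ _ _ _).lt_of_ne' fun h =>
    (tuningDefect_neg_of_strength_eq_zero hl hi hd hz γ hχ0 h).ne h0
  refine ⟨_, χ, ht, hχ0, sub_eq_zero.1 (defect_strength hl hd hz ht), ?_⟩
  unfold tuningDefect at h0
  linarith

/-! ### Optimal tuning -/

/-- `t` is the largest signal strength that solves the first state evolution equation for some
`χ > 0`: the scaled risk at `t` is minimal over `χ` at that solution. -/
def IsOptimalStrength (lam x : Fin m → ℝ) (d z t : ℝ) : Prop :=
  0 < t ∧ (∃ χ, 0 < χ ∧ scaledRisk lam x t χ = d * (1 - z ^ 2 * t ^ 2)) ∧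
    ∀ χ, 0 ≤ χ → d * (1 - z ^ 2 * t ^ 2) ≤ scaledRisk lam x t χ

/-- The optimal strength bounds every other solution of the first equation, also at larger noise. -/
lemma IsOptimalStrength.le (hl : Chamber lam) (hd : 0 < d) {z' t t' : ℝ}
    (hz : 0 < z) (hzz : z ≤ z') (h : IsOptimalStrength lam x d z t) {χ : ℝ} (hχ : 0 ≤ χ)
    (ht' : scaledRisk lam x t' χ = d * (1 - z' ^ 2 * t' ^ 2)) : t' ≤ t := by
  by_contra hc
  have hlt := not_le.1 hc
  have h1 := h.2.2 χ hχ
  have h2 := scaledRisk_mono hl x χ h.1.le hlt.le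
  have h3 : z ^ 2 * t ^ 2 < z' ^ 2 * t' ^ 2 :=
    mul_lt_mul' (pow_le_pow_left₀ hz.le hzz 2) (pow_lt_pow_left₀ hlt h.1.le two_ne_zero)
      (sq_nonneg _) (by have := hz.trans_le hzz; positivity)
  have h4 := mul_lt_mul_of_pos_left h3 hd
  linarith

/-- The maximum of the strength over `χ` is attained in the interior, and there the correlation is
smaller than `d`, so that it corresponds to a positive tuning parameter. -/
lemma exists_isOptimalStrength (hl : Chamber lam) {i : Fin m} (hi : 0 < lam i) (hx : x ≠ 0)
    (hd : 0 < d) (hz : 0 < z) : ∃ t χ, IsOptimalStrength lam x d z t ∧ 0 < χ ∧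
      scaledRisk lam x t χ = d * (1 - z ^ 2 * t ^ 2) ∧ scaledCorr lam x t χ < d := by
  have hX : 0 < sqNorm x := (sqNorm_nonneg x).lt_of_ne' fun h => hx (sqNorm_eq_zero.1 h)
  -- `s` solves the first equation in the limit of infinite regularization
  have hD : 0 < sqNorm x + d * z ^ 2 := by positivity
  set s := √(d / (sqNorm x + d * z ^ 2)) with hs
  have hs0 : 0 < s := Real.sqrt_pos.2 (div_pos hd hD)
  have hs2 : s ^ 2 * (sqNorm x + d * z ^ 2) = d := by
    rw [hs, Real.sq_sqrt (div_pos hd hD).le, div_mul_cancel₀ _ hD.ne']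
  obtain ⟨χ₁, hχ₁, h1⟩ := exists_scaledRisk_lt_sqNorm hl hi hx hs0
  set T := strength lam x d z with hT
  have hsT : s < T χ₁ := (lt_strength_iff hl hd hz hs0.le).2 (by unfold defect; linarith)
  have hT1 : 0 < T χ₁ := hs0.trans hsT
  obtain ⟨K, hK0, hK⟩ := exists_bound_large hl hi x hT1.le
  -- the defect at `T χ₁` tends to `gap > 0` as `χ → ∞`, so that `T` is below `T χ₁` for large `χ`
  set gap := T χ₁ ^ 2 * (sqNorm x + d * z ^ 2) - d with hgap
  have hgap0 : 0 < gap := by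
    have := mul_lt_mul_of_pos_right (pow_lt_pow_left₀ hsT hs0.le two_ne_zero) hD
    linarith
  set B := max χ₁ (K / gap + 1) with hB
  have hlarge : ∀ χ, B ≤ χ → T χ < T χ₁ := by
    intro χ hχ
    have hq : 0 ≤ K / gap := by positivity
    have hχK : K / gap + 1 ≤ χ := (le_max_right _ _).trans hχ
    have hχ1 : 1 ≤ χ := by linarith
    have h2 := (abs_le.1 (hK _ hT1.le le_rfl χ hχ1).2).1
    have h3 : K / χ < gap := by
      rw [div_lt_iff₀ (by linarith), mul_comm, ← div_lt_iff₀ hgap0]; linarith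
    refine (strength_lt_iff hl hd hz hT1).2 ?_
    unfold defect
    linarith
  obtain ⟨χ₀, hχ₀, hmax⟩ := isCompact_Icc.exists_isMaxOn
    (⟨0, le_rfl, hχ₁.le.trans (le_max_left _ _)⟩ : (Set.Icc 0 B).Nonempty)
    (continuous_strength hl hd hz x).continuousOn
  have hge : T χ₁ ≤ T χ₀ := hmax ⟨hχ₁.le, le_max_left _ _⟩
  have hall : ∀ χ, 0 ≤ χ → T χ ≤ T χ₀ := fun χ hχ => by
    rcases le_or_gt χ B with h | h
    · exact hmax ⟨hχ, h⟩
    · exact (hlarge χ h.le).le.trans hge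
  have hT0 : 0 < T χ₀ := hT1.trans_le hge
  have heq : scaledRisk lam x (T χ₀) χ₀ = d * (1 - z ^ 2 * T χ₀ ^ 2) :=
    sub_eq_zero.1 (defect_strength hl hd hz hT0)
  have hle : ∀ χ, 0 ≤ χ → d * (1 - z ^ 2 * T χ₀ ^ 2) ≤ scaledRisk lam x (T χ₀) χ := fun χ hχ =>
    not_lt.1 fun hc => (hall χ hχ).not_gt
      ((lt_strength_iff hl hd hz hT0.le).2 (by unfold defect; linarith))
  -- at `χ = 0` the risk is `m`, which some `χ > 0` improves
  have hχ₀0 : 0 < χ₀ := hχ₀.1.lt_of_ne' fun h => by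
    obtain ⟨χ, hχ, hlt⟩ := exists_scaledRisk_lt_card hl hi x hT0.le
    have := hle χ hχ.le
    rw [h, scaledRisk_zero_right hl] at heq
    rw [h] at this hlt
    linarith
  refine ⟨T χ₀, χ₀, ⟨hT0, ⟨χ₀, hχ₀0, heq⟩, hle⟩, hχ₀0, heq, ?_⟩
  -- at a minimizer `c ≤ ρ < d`
  have h4 := scaledCorr_le_scaledRisk hl x hχ₀0 (t := T χ₀) fun χ hχ => by
    rw [heq]; exact hle χ (hχ₀0.trans hχ).le
  have h5 : 0 < d * (z ^ 2 * T χ₀ ^ 2) := by positivity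
  linarith

end FirstEquation

section Tuning

variable {δ : ℝ} {x : Fin m → ℝ} {z γ t : ℝ}

lemma existsUnique_isStateEvolution (hl : Chamber lam) {i : Fin m} (hi : 0 < lam i) (hδ : 0 < δ)
    (x : Fin m → ℝ) (hz : 0 < z) (hγ : 0 < γ) : ∃! s, IsStateEvolution δ lam x γ z s := by
  have hm := i.pos
  have hd : 0 < δ * m := mul_pos hδ (by exact_mod_cast hm)
  simp only [isStateEvolution_iff hl hm hδ]
  obtain ⟨t, χ, ht, hχ, h1, h2⟩ := exists_scaled_solution hl hi hd hz x hγ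
  refine ⟨(t⁻¹, χ), ⟨inv_pos.2 ht, hχ, by simpa only [inv_inv] using h1,
    by simpa only [inv_inv] using h2⟩, ?_⟩
  rintro ⟨σ, χ'⟩ ⟨hσ, hχ', h1', h2'⟩
  obtain ⟨e1, e2⟩ := scaled_solution_unique hl x hd hγ hz (inv_pos.2 hσ) ht hχ' hχ h1' h1 h2' h2
  rw [← e1, ← e2, inv_inv]

lemma isStateEvolution_seSolution (hl : Chamber lam) {i : Fin m} (hi : 0 < lam i) (hδ : 0 < δ)
    (x : Fin m → ℝ) (hz : 0 < z) (hγ : 0 < γ) :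
    IsStateEvolution δ lam x γ z (seSolution δ lam x γ z) :=
  Classical.epsilon_spec (existsUnique_isStateEvolution hl hi hδ x hz hγ).exists

lemma seMSE_eq (hl : Chamber lam) {i : Fin m} (hi : 0 < lam i) (hδ : 0 < δ)
    (x : Fin m → ℝ) (hz : 0 < z) (hγ : 0 < γ) :
    seMSE δ lam x γ z = δ * ((seSolution δ lam x γ z).1 ^ 2 - z ^ 2) := by
  have h := (isStateEvolution_seSolution hl hi hδ x hz hγ).2.2.1
  rw [seMSE, h]
  field_simp
  ring

lemma le_seMSE (hl : Chamber lam) {i : Fin m} (hi : 0 < lam i) (hδ : 0 < δ)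
    (hz : 0 < z) (ht : IsOptimalStrength lam x (δ * m) z t) (hγ : 0 < γ) :
    δ * (t⁻¹ ^ 2 - z ^ 2) ≤ seMSE δ lam x γ z := by
  have hm := i.pos
  have hd : 0 < δ * m := mul_pos hδ (by exact_mod_cast hm)
  obtain ⟨hσ, hχ, h1, -⟩ := (isStateEvolution_iff hl hm hδ x γ z _).1
    (isStateEvolution_seSolution hl hi hδ x hz hγ)
  rw [seMSE_eq hl hi hδ x hz hγ]
  have h2 := inv_le_of_inv_le₀ hσ (ht.le hl hd hz le_rfl hχ.le h1)
  have h3 := pow_le_pow_left₀ (inv_pos.2 ht.1).le h2 2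
  exact mul_le_mul_of_nonneg_left (by linarith) hδ.le

/-- The minimal mean square error is the one at the optimal strength, and it is attained. -/
lemma exists_isOptimalTuning (hl : Chamber lam) {i : Fin m} (hi : 0 < lam i) (hδ : 0 < δ)
    (hx : x ≠ 0) (hz : 0 < z) : ∃ t γ, IsOptimalStrength lam x (δ * m) z t ∧ 0 < γ ∧
      seMSE δ lam x γ z = δ * (t⁻¹ ^ 2 - z ^ 2) := by
  have hm := i.pos
  have hd : 0 < δ * m := mul_pos hδ (by exact_mod_cast hm)
  obtain ⟨t, χ, ht, hχ, h1, h2⟩ := exists_isOptimalStrength hl hi hx hd hz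
  have ht0 := ht.1
  set γ := χ * (δ * m - scaledCorr lam x t χ) / (t * (δ * m)) with hγdef
  have hγ : 0 < γ := div_pos (mul_pos hχ (sub_pos.2 h2)) (mul_pos ht0 hd)
  refine ⟨t, γ, ht, hγ, ?_⟩
  have hs : IsStateEvolution δ lam x γ z (t⁻¹, χ) := by
    rw [isStateEvolution_iff hl hm hδ]
    simp only [inv_inv]
    refine ⟨inv_pos.2 ht0, hχ, h1, ?_⟩
    rw [mul_assoc, hγdef, div_mul_cancel₀ _ (mul_pos ht0 hd).ne']
  rw [seMSE_eq hl hi hδ x hz hγ, (existsUnique_isStateEvolution hl hi hδ x hz hγ).unique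
    (isStateEvolution_seSolution hl hi hδ x hz hγ) hs]

/-- The optimal strengths and the optimally tuned error, as functions of the noise level. -/
lemma exists_optimalStrength_fun (hl : Chamber lam) {i : Fin m} (hi : 0 < lam i) (hδ : 0 < δ)
    (hx : x ≠ 0) : ∃ t : ℝ → ℝ, ∀ z, 0 < z → IsOptimalStrength lam x (δ * m) z (t z) ∧
      ∀ γ, IsOptimalTuning δ lam x z γ → seMSE δ lam x γ z = δ * ((t z)⁻¹ ^ 2 - z ^ 2) := by
  have : ∀ z, 0 < z → ∃ t, IsOptimalStrength lam x (δ * m) z t ∧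
      ∀ γ, IsOptimalTuning δ lam x z γ → seMSE δ lam x γ z = δ * (t⁻¹ ^ 2 - z ^ 2) := by
    intro z hz
    obtain ⟨t, γ', ht, hγ', he⟩ := exists_isOptimalTuning hl hi hδ hx hz
    refine ⟨t, ht, fun γ hγ => le_antisymm ?_ (le_seMSE hl hi hδ hz ht hγ.1)⟩
    rw [← he]
    exact hγ.2 γ' hγ'
  choose! t ht using this
  exact ⟨t, ht⟩

/-! ### The limit of vanishing noise -/

/-- Below the threshold the optimal strength stays bounded as the noise vanishes. -/
lemma tendsto_strength_of_lt_threshold (hl : Chamber lam) {i : Fin m} (hi : 0 < lam i)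
    (hδ : 0 < δ) (hx : x ≠ 0) (hties : NoTies x) {t : ℝ → ℝ}
    (ht : ∀ z, 0 < z → IsOptimalStrength lam x (δ * m) z (t z))
    (hlt : δ < threshold lam (sparsity x)) : ∃ T, 0 < T ∧ Tendsto t (𝓝[>] 0) (𝓝 T) := by
  have hm : (0 : ℝ) < m := by exact_mod_cast i.pos
  have hd : 0 < δ * m := mul_pos hδ hm
  obtain ⟨S, -, hS⟩ := exists_lt_scaledRisk hl hi hx hties (μ := δ * m)
    (by rw [mul_comm]; exact mul_lt_mul_of_pos_left hlt hm)
  have hb : ∀ z, 0 < z → t z ≤ S := fun z hz => by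
    by_contra hc
    obtain ⟨h0, ⟨χ, hχ, he⟩, -⟩ := ht z hz
    have h1 := hS (t z) (not_le.1 hc).le χ hχ.le
    have h2 : 0 ≤ δ * m * (z ^ 2 * t z ^ 2) := by positivity
    linarith
  have hanti : AntitoneOn t (Set.Ioi 0) := fun z hz z' hz' hzz => by
    obtain ⟨-, ⟨χ, hχ, he⟩, -⟩ := ht z' hz'
    exact (ht z hz).le hl hd hz hzz hχ.le he
  have hbdd : BddAbove (t '' Set.Ioi 0) := ⟨S, by rintro _ ⟨z, hz, rfl⟩; exact hb z hz⟩
  refine ⟨sSup (t '' Set.Ioi 0), (ht 1 one_pos).1.trans_le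
    (le_csSup hbdd ⟨1, Set.mem_Ioi.2 one_pos, rfl⟩), hanti.tendsto_nhdsGT hbdd⟩

/-- Above the threshold `σ` is proportional to the noise level: `(σz / σ)² → 1 - M / δ`. -/
lemma tendsto_strength_of_threshold_lt (hl : Chamber lam) {i : Fin m} (hi : 0 < lam i)
    (hδ : 0 < δ) (hx : x ≠ 0) (hties : NoTies x) {t : ℝ → ℝ}
    (ht : ∀ z, 0 < z → IsOptimalStrength lam x (δ * m) z (t z))
    (hlt : threshold lam (sparsity x) < δ) : Tendsto (fun z => z ^ 2 * t z ^ 2) (𝓝[>] 0)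
      (𝓝 ((δ - threshold lam (sparsity x)) / δ)) := by
  have hm : (0 : ℝ) < m := by exact_mod_cast i.pos
  have hd : 0 < δ * m := mul_pos hδ hm
  set M := threshold lam (sparsity x) with hM
  have hκ : 0 < (δ - M) / δ := div_pos (sub_pos.2 hlt) hδ
  have hlow : ∀ z, 0 < z → (δ - M) / δ ≤ z ^ 2 * t z ^ 2 := by
    intro z hz
    obtain ⟨h0, -, hle⟩ := ht z hz
    have h1 := le_mul_threshold i.pos lam (sparsity x) (c := δ * m * (1 - z ^ 2 * t z ^ 2))
      fun χ hχ => (hle χ hχ.le).trans (scaledRisk_le_limitRisk hl hties h0.le hχ.le)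
    rw [mul_comm δ, mul_assoc] at h1
    have h2 := le_of_mul_le_mul_left h1 hm
    rw [div_le_iff₀ hδ]
    linarith
  refine tendsto_order.2 ⟨fun a ha => ?_, fun a ha => ?_⟩
  · filter_upwards [self_mem_nhdsWithin] with z hz
    exact ha.trans_le (hlow z hz)
  · obtain ⟨T, hT0, hT⟩ := exists_lt_scaledRisk hl hi hx hties (μ := δ * m * (1 - a)) (by
      have ha := (div_lt_iff₀ hδ).1 ha
      rw [mul_comm δ, mul_assoc]
      exact mul_lt_mul_of_pos_left (by linarith) hm)
    have hc : Continuous fun z : ℝ => z ^ 2 * T ^ 2 := by fun_prop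
    have hsm := (hc.tendsto 0).eventually_lt_const (u := (δ - M) / δ) (by simpa using hκ)
    filter_upwards [hsm.filter_mono nhdsWithin_le_nhds, self_mem_nhdsWithin] with z h1 hz
    have hz : 0 < z := hz
    obtain ⟨h0, ⟨χ, hχ, he⟩, -⟩ := ht z hz
    have h2 : T ^ 2 < t z ^ 2 := lt_of_mul_lt_mul_left (h1.trans_le (hlow z hz)) (sq_nonneg z)
    have h3 := hT (t z) (lt_of_pow_lt_pow_left₀ 2 h0.le h2).le χ hχ.le
    rw [he] at h3
    have h4 := lt_of_mul_lt_mul_left h3 hd.le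
    linarith

lemma tendsto_sq_nhdsGT : Tendsto (fun z : ℝ => z ^ 2) (𝓝[>] 0) (𝓝[>] 0) := by
  refine tendsto_nhdsWithin_iff.2 ⟨?_, ?_⟩
  · have : Tendsto (fun z : ℝ => z ^ 2) (𝓝 0) (𝓝 (0 ^ 2)) := (continuous_pow 2).tendsto 0
    rw [zero_pow two_ne_zero] at this
    exact this.mono_left nhdsWithin_le_nhds
  · filter_upwards [self_mem_nhdsWithin] with z hz
    exact pow_pos (Set.mem_Ioi.1 hz) 2

lemma tendsto_div_sq_of_pos {e : ℝ → ℝ} {L : ℝ} (hL : 0 < L) (he : Tendsto e (𝓝[>] 0) (𝓝 L)) :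
    Tendsto (fun z => e z / z ^ 2) (𝓝[>] 0) atTop := by
  simp only [div_eq_mul_inv]
  exact he.pos_mul_atTop hL (tendsto_inv_nhdsGT_zero.comp tendsto_sq_nhdsGT)

end Tuning

end Slope

end


theorem theorem2 {p : ℕ} (δ : ℝ) (hδ : 0 < δ)
    (lam : Fin p → ℝ) (hlam_anti : Antitone lam) (hlam_nonneg : ∀ i, 0 ≤ lam i)
    (hlam_ne : lam ≠ 0)
    (x : Fin p → ℝ) (hx_ne : x ≠ 0) (hx_ties : Slope.NoTies x)
    (k : ℕ) (hk : k = Slope.sparsity x) :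
    (∀ σz : ℝ, 0 < σz → ∀ γ : ℝ, 0 < γ →
      ∃! s : ℝ × ℝ, Slope.IsStateEvolution δ lam x γ σz s) ∧
    (∀ σz : ℝ, 0 < σz → ∃ γ : ℝ, Slope.IsOptimalTuning δ lam x σz γ) ∧
    ∀ γopt : ℝ → ℝ, (∀ σz : ℝ, 0 < σz → Slope.IsOptimalTuning δ lam x σz (γopt σz)) →
      ((δ < Slope.threshold lam k →
          (∃ L : ℝ, 0 < L ∧
            Tendsto (fun σz => Slope.seMSE δ lam x (γopt σz) σz) (𝓝[>] 0) (𝓝 L)) ∧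
          Tendsto (fun σz => Slope.seMSE δ lam x (γopt σz) σz / σz ^ 2) (𝓝[>] 0) atTop) ∧
        (Slope.threshold lam k < δ →
          Tendsto (fun σz => Slope.seMSE δ lam x (γopt σz) σz) (𝓝[>] 0) (𝓝 0) ∧
          Tendsto (fun σz => Slope.seMSE δ lam x (γopt σz) σz / σz ^ 2) (𝓝[>] 0)
            (𝓝 (δ * Slope.threshold lam k / (δ - Slope.threshold lam k))))) := by
  subst hk
  have hl : Slope.Chamber lam := ⟨hlam_anti, hlam_nonneg⟩
  obtain ⟨i, hi⟩ : ∃ i, 0 < lam i := by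
    obtain ⟨i, hi⟩ := Function.ne_iff.1 hlam_ne
    exact ⟨i, (hlam_nonneg i).lt_of_ne' hi⟩
  refine ⟨fun z hz γ hγ => Slope.existsUnique_isStateEvolution hl hi hδ x hz hγ, fun z hz => ?_,
    fun γopt hopt => ?_⟩
  · obtain ⟨t, γ, ht, hγ, he⟩ := Slope.exists_isOptimalTuning hl hi hδ hx_ne hz
    exact ⟨γ, hγ, fun γ' hγ' => he ▸ Slope.le_seMSE hl hi hδ hz ht hγ'⟩
  obtain ⟨t, ht⟩ := Slope.exists_optimalStrength_fun hl hi hδ hx_ne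
  have ht1 := fun z hz => (ht z hz).1
  have hmse : (fun z => δ * ((t z)⁻¹ ^ 2 - z ^ 2)) =ᶠ[𝓝[>] 0]
      fun z => Slope.seMSE δ lam x (γopt z) z := by
    filter_upwards [self_mem_nhdsWithin] with z hz
    exact ((ht z hz).2 _ (hopt z hz)).symm
  have hsq : Tendsto (fun z : ℝ => z ^ 2) (𝓝[>] 0) (𝓝 0) :=
    tendsto_nhds_of_tendsto_nhdsWithin Slope.tendsto_sq_nhdsGT
  refine ⟨fun hlt => ?_, fun hlt => ?_⟩
  · obtain ⟨T, hT0, hT⟩ := Slope.tendsto_strength_of_lt_threshold hl hi hδ hx_ne hx_ties ht1 hlt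
    have hL := ((((hT.inv₀ hT0.ne').pow 2).sub hsq).const_mul δ).congr' hmse
    have hpos : 0 < δ * (T⁻¹ ^ 2 - 0) := by rw [sub_zero]; positivity
    exact ⟨⟨_, hpos, hL⟩, Slope.tendsto_div_sq_of_pos hpos hL⟩
  · have hg := Slope.tendsto_strength_of_threshold_lt hl hi hδ hx_ne hx_ties ht1 hlt
    set M := Slope.threshold lam (Slope.sparsity x) with hM
    have hκ : 0 < (δ - M) / δ := div_pos (sub_pos.2 hlt) hδ
    have hratio : Tendsto (fun z => Slope.seMSE δ lam x (γopt z) z / z ^ 2) (𝓝[>] 0)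
        (𝓝 (δ * M / (δ - M))) := by
      have h1 := ((hg.inv₀ hκ.ne').sub_const 1).const_mul δ
      have h2 : δ * (((δ - M) / δ)⁻¹ - 1) = δ * M / (δ - M) := by
        have := (sub_pos.2 hlt).ne'
        field_simp
        ring
      rw [h2] at h1
      refine h1.congr' ?_
      filter_upwards [hmse, self_mem_nhdsWithin] with z hz hz0
      have := (ht1 z hz0).1.ne'
      have hz0 : z ≠ 0 := (Set.mem_Ioi.1 hz0).ne'
      rw [← hz]
      field_simp
    refine ⟨?_, hratio⟩
    have h3 := hratio.mul hsq
    rw [mul_zero] at h3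
    refine h3.congr' ?_
    filter_upwards [self_mem_nhdsWithin] with z hz
    exact div_mul_cancel₀ _ (pow_pos (Set.mem_Ioi.1 hz) 2).ne'
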